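/- Let $P$ be a finite simple graph with a real weight $w(e)$ assigned to each edge $e$. A *realization* of $(P,w)$ is a three-dimensional convex polyhedron $Q$ in hyperbolic space $\mathbb{H}^3$, all of whose vertices lie on the sphere at infinity, together with an identification of $P$ with the one-skeleton of $Q$ (vertices with vertices, edges with edges), such that the dihedral angle of $Q$ at every edge $e$ equals $w(e)$. Any two realizations of $(P,w)$ are congruent: if $Q_1$ and $Q_2$ are realizations of $(P,w)$, then there is an isometry of $\mathbb{H}^3$ (possibly orientation-reversing) that maps $Q_1$ onto $Q_2$ and whose extension to the sphere at infinity carries, for every vertex $v$ of $P$, the ideal vertex of $Q_1$ labelled $v$ to the ideal vertex of $Q_2$ labelled $v$. -/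

import Mathlib

/-- Euclidean 3-space. -/
abbrev E3 : Type := EuclideanSpace ℝ (Fin 3)

/-- Hyperbolic 3-space in the projective (Klein) model: the open unit ball of `E3`. Geodesic
lines, planes and convex sets are the Euclidean ones; the sphere at infinity is the unit sphere. -/
abbrev H3 : Type := {p : E3 // ‖p‖ < 1}

/-- Hyperbolic distance in the Klein model (curvature -1):
`cosh d(p, q) = (1 - ⟪p, q⟫) / (√(1 - ‖p‖²) √(1 - ‖q‖²))`. -/
noncomputable def hypDist (p q : H3) : ℝ :=
  Real.arcosh ((1 - inner ℝ p.1 q.1) / (√(1 - ‖p.1‖ ^ 2) * √(1 - ‖q.1‖ ^ 2)))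

/-- Isometries of hyperbolic 3-space: bijections that preserve the hyperbolic distance
(orientation-reversing ones included). -/
def IsHypIsometry (φ : H3 ≃ H3) : Prop :=
  ∀ p q : H3, hypDist (φ p) (φ q) = hypDist p q

/-- `φ` sends the ideal point `ξ` to the ideal point `η`: whenever a point `p` of hyperbolic space
tends to `ξ` in the closed ball, `φ p` tends to `η`. -/
def SendsIdealPoint (φ : H3 ≃ H3) (ξ η : E3) : Prop :=
  Filter.Tendsto (fun p : H3 => (φ p : E3))
    (Filter.comap (fun p : H3 => (p : E3)) (nhds ξ)) (nhds η)

/-- The half-space `{p | ⟪normal, p⟫ ≤ offset}`, bounded by the plane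
`{p | ⟪normal, p⟫ = offset}`. -/
structure HalfSpace where
  normal : E3
  offset : ℝ

/-- Minkowski product (signature -,+,+,+) of the vectors `(offset, normal)`. In the hyperboloid
model, where the Klein point `p` lies on the ray of `(1, p)`, this vector is the outward Minkowski
normal of the half-space, because its product with `(1, p)` is `⟪normal, p⟫ - offset`. -/
noncomputable def HalfSpace.minkowski (h k : HalfSpace) : ℝ :=
  inner ℝ h.normal k.normal - h.offset * k.offset

/-- The angle between the outward Minkowski unit normals of two half-spaces (an angle in the tangent
space of hyperbolic space at any point where their bounding planes meet). -/
noncomputable def HalfSpace.normalAngle (h k : HalfSpace) : ℝ :=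
  Real.arccos (h.minkowski k / (√(h.minkowski h) * √(k.minkowski k)))

/-- The part of `K` on the bounding plane. -/
def HalfSpace.contact (h : HalfSpace) (K : Set E3) : Set E3 :=
  {p ∈ K | inner ℝ h.normal p = h.offset}

/-- The half-space contains `K` and its bounding plane cuts out a two-dimensional face of `K`. -/
def HalfSpace.SupportsFacet (h : HalfSpace) (K : Set E3) : Prop :=
  (∀ p ∈ K, inner ℝ h.normal p ≤ h.offset) ∧
    Module.finrank ℝ (vectorSpan ℝ (h.contact K)) = 2

/-- `θ` is the (interior) hyperbolic dihedral angle of the convex polyhedron `K` at its edge with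
ends `p` and `q`: it is supplementary to the angle between the outward normals of the two facets
that meet in that edge. -/
def HasDihedralAngle (K : Set E3) (p q : E3) (θ : ℝ) : Prop :=
  ∃ h k : HalfSpace, h.SupportsFacet K ∧ k.SupportsFacet K ∧ h.contact K ≠ k.contact K ∧
    p ∈ h.contact K ∧ q ∈ h.contact K ∧ p ∈ k.contact K ∧ q ∈ k.contact K ∧
    θ = Real.pi - h.normalAngle k

/-- The closed convex hull, in the closed ball, of a family of points. -/
def idealHull {V : Type*} (x : V → E3) : Set E3 := convexHull ℝ (Set.range x)

/-- The convex polyhedron in hyperbolic space that is spanned by a family of ideal points. -/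
def idealPolyhedron {V : Type*} (x : V → E3) : Set H3 := {p : H3 | (p : E3) ∈ idealHull x}

/-- `x` realizes the graph `G` with edge weights `w` as a (three-dimensional) convex polyhedron in
hyperbolic 3-space with vertices `x v`, all on the sphere at infinity, with one-skeleton `G`
(each vertex `v` of `G` being the vertex `x v`), and with dihedral angle `w e` at every edge `e`.
All points `x v` are vertices of the hull, since they are distinct points of the sphere. -/
structure IsIdealRealization {V : Type*} (G : SimpleGraph V) (w : G.edgeSet → ℝ) (x : V → E3) :
    Prop where
  ideal : ∀ v, ‖x v‖ = 1
  injective : Function.Injective x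
  solid : (interior (idealHull x)).Nonempty
  adj_iff : ∀ u v, G.Adj u v ↔ u ≠ v ∧ IsExposed ℝ (idealHull x) (segment ℝ (x u) (x v))
  angle : ∀ (u v : V) (huv : G.Adj u v),
    HasDihedralAngle (idealHull x) (x u) (x v) (w ⟨s(u, v), G.mem_edgeSet.2 huv⟩)

/-! The Klein model is the slice at height one of Minkowski space. A polyhedron becomes a cone, its
ideal vertices become future null vectors, and each facet gets an outward spacelike unit normal. It
is enough to find a Lorentz map carrying the null ray of each vertex of the first realization to
that of the second. Such a map exists once the two Gram matrices of null vectors agree up to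
positive rescaling of the vectors (`exists_gram`, `exists_lorentz`). The argument has three
ingredients.

Combinatorics. The realizations share only a graph, but the graph determines which vertex sets are
facets (`isFacet_of_isFacet`). The facet boundaries generate the mod 2 cycle space
(`exists_eq_facetBoundary`), and the vertices outside a facet are connected. Connectivity comes from
linear functionals and simplex steps, with no planar topology. Adjacent facets then correspond, and
the dihedral angle fixes the product `c` of their unit normals.

Maximum principle. Fix a vertex and a facet `S` not containing it, and project the vertex
orthogonally to the plane of `S`. From the projection the edges of the ideal polygon `S` are seen
under total angle `2π` (`sum_halfVisualAngle`). Let `m_T` be the product of the vertex with the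
normal of `T`. The edge shared with `T` has half angle `π/2 - arctan((m_T/m_S - c)/√(1 - c²))`,
which decreases in `m_T/m_S`. Now compare the numbers `m` of the two realizations. At a facet where
their ratio is largest, every half angle of one realization is at most that of the other, while both
sums are `π`. So all of them agree, and the ratio has the same value on the neighbouring facets. The
facets avoiding the vertex are connected (`facet_connected`), so the ratio is constant
(`exists_ratio`).

Reassembly. At a corner of a facet, the unit conormals of the two edges add up to a positive
multiple of the ideal vertex (`exists_corner`). Up to scale, a vertex is thus a combination of three
normals with coefficients fixed by the angles. The constant ratios therefore determine all products
of vertices up to scaling, and symmetry of the form makes the scaling factors consistent. -/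

open Module

/-! ### Faces of a polyhedral cone -/

/-- A finite configuration of vectors generating the extreme rays of a four-dimensional pointed
cone, with the graph of its two-dimensional faces; no three of the vectors are dependent. -/
structure IsConeConfig {V W : Type*} [AddCommGroup W] [Module ℝ W] (G : SimpleGraph V)
    (X : V → W) : Prop where
  finrank : Module.finrank ℝ W = 4
  span : Submodule.span ℝ (Set.range X) = ⊤
  indep : ∀ u v w, u ≠ v → u ≠ w → v ≠ w → LinearIndependent ℝ ![X u, X v, X w]
  exposed : ∀ v, ∃ a : Dual ℝ W, a (X v) = 0 ∧ ∀ u, u ≠ v → 0 < a (X u)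
  adj_iff : ∀ u v, G.Adj u v ↔
    u ≠ v ∧ ∃ φ : Dual ℝ W, (∀ w, 0 ≤ φ (X w)) ∧ ∀ w, φ (X w) = 0 ↔ w = u ∨ w = v
  height : ∃ τ : Dual ℝ W, ∀ v, τ (X v) = 1

/-- A linear functional that is nonnegative on the configuration and vanishes on a facet. -/
structure IsFacetFun {V W : Type*} [AddCommGroup W] [Module ℝ W] (X : V → W) (φ : Dual ℝ W) :
    Prop where
  ne_zero : φ ≠ 0
  nonneg : ∀ v, 0 ≤ φ (X v)
  three : ∃ u v w, u ≠ v ∧ u ≠ w ∧ v ≠ w ∧ φ (X u) = 0 ∧ φ (X v) = 0 ∧ φ (X w) = 0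

theorem IsFacetFun.exists_third {V W : Type*} [AddCommGroup W] [Module ℝ W] {X : V → W}
    {φ : Dual ℝ W} (hφ : IsFacetFun X φ) (u v : V) : ∃ w, φ (X w) = 0 ∧ w ≠ u ∧ w ≠ v := by
  obtain ⟨a, b, c, hab, hac, hbc, ha, hb, hc⟩ := hφ.three
  by_cases h1 : a ≠ u ∧ a ≠ v
  · exact ⟨a, ha, h1⟩
  by_cases h2 : b ≠ u ∧ b ≠ v
  · exact ⟨b, hb, h2⟩
  refine ⟨c, hc, ?_⟩
  clear ha hb hc hφ
  grind

/-- The zero set of a facet functional. -/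
def IsFacet {V W : Type*} [AddCommGroup W] [Module ℝ W] (X : V → W) (S : Set V) : Prop :=
  ∃ φ : Dual ℝ W, IsFacetFun X φ ∧ S = {v | φ (X v) = 0}

theorem exists_mem_notMem_span_of_finrank {M : Type*} [AddCommGroup M] [Module ℝ M]
    {A : Submodule ℝ M} [FiniteDimensional ℝ A] {n : ℕ}
    (hA : finrank ℝ A = n + 1) (f : Fin n → M) (hf : LinearIndependent ℝ f) (hfA : ∀ i, f i ∈ A) :
    ∃ b ∈ A, b ∉ Submodule.span ℝ (Set.range f) ∧
      ∀ η ∈ A, ∃ t : ℝ, ∃ z ∈ Submodule.span ℝ (Set.range f), η = t • b + z := by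
  obtain ⟨b, hbA, hb⟩ : ∃ b ∈ A, b ∉ Submodule.span ℝ (Set.range f) := by
    by_contra! h
    have h1 : A ≤ Submodule.span ℝ (Set.range f) := h
    have := FiniteDimensional.span_of_finite ℝ (Set.finite_range f)
    have h2 := Submodule.finrank_mono h1
    rw [finrank_span_eq_card hf, hA] at h2
    simp at h2
  refine ⟨b, hbA, hb, fun η hη => ?_⟩
  have hli : LinearIndependent ℝ (Fin.cons b f : Fin (n + 1) → M) :=
    linearIndependent_finCons.2 ⟨hf, hb⟩
  have hle : Submodule.span ℝ (Set.range (Fin.cons b f : Fin (n + 1) → M)) ≤ A := by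
    rw [Submodule.span_le, Fin.range_cons]
    rintro _ (rfl | ⟨i, rfl⟩)
    · exact hbA
    · exact hfA i
  have htop := Submodule.eq_of_le_of_finrank_eq hle (by
    rw [finrank_span_eq_card hli, hA]; simp)
  rw [← htop, Fin.range_cons, Submodule.mem_span_insert] at hη
  obtain ⟨t, z, hz, h⟩ := hη
  exact ⟨t, z, hz, h⟩

namespace IsConeConfig

variable {V W : Type*} [AddCommGroup W] [Module ℝ W] {G : SimpleGraph V} {X : V → W}

theorem finiteDimensional (h : IsConeConfig G X) : FiniteDimensional ℝ W :=
  FiniteDimensional.of_finrank_pos (by rw [h.finrank]; norm_num)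

theorem mem_dualAnnihilator_span_range {n : ℕ} (f : Fin n → W) (η : Dual ℝ W) :
    η ∈ (Submodule.span ℝ (Set.range f)).dualAnnihilator ↔ ∀ i, η (f i) = 0 := by
  rw [Submodule.mem_dualAnnihilator]
  constructor
  · intro hη i
    exact hη _ (Submodule.subset_span ⟨i, rfl⟩)
  · intro hη w hw
    induction hw using Submodule.span_induction with
    | mem x hx => obtain ⟨i, rfl⟩ := hx; exact hη i
    | zero => simp
    | add x y _ _ hx hy => simp [hx, hy]
    | smul a x _ hx => simp [hx]

theorem finrank_dualAnnihilator (h : IsConeConfig G X) {n m : ℕ} (f : Fin n → W)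
    (hf : LinearIndependent ℝ f) (hn : n + m = 4) :
    Module.finrank ℝ (Submodule.span ℝ (Set.range f)).dualAnnihilator = m := by
  have := h.finiteDimensional
  have h1 := Subspace.finrank_add_finrank_dualAnnihilator_eq (Submodule.span ℝ (Set.range f))
  rw [finrank_span_eq_card hf, h.finrank] at h1
  simp at h1
  omega

/-- A basis of the functionals vanishing on independent vectors can be completed by its last
member. -/
theorem exists_complement (h : IsConeConfig G X) {n m : ℕ} (f : Fin n → W)
    (hf : LinearIndependent ℝ f) (hn : n + (m + 1) = 4) (g : Fin m → Dual ℝ W)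
    (hg : LinearIndependent ℝ g) (hgf : ∀ i j, g i (f j) = 0) :
    ∃ b : Dual ℝ W, (∀ j, b (f j) = 0) ∧ b ∉ Submodule.span ℝ (Set.range g) ∧
      ∀ η : Dual ℝ W, (∀ j, η (f j) = 0) →
        ∃ t : ℝ, ∃ z ∈ Submodule.span ℝ (Set.range g), η = t • b + z := by
  have := h.finiteDimensional
  obtain ⟨b, hbA, hb, hall⟩ := exists_mem_notMem_span_of_finrank
    (h.finrank_dualAnnihilator f hf hn) g hg
    fun i => (mem_dualAnnihilator_span_range f _).2 (hgf i)
  exact ⟨b, (mem_dualAnnihilator_span_range f _).1 hbA, hb, fun η hη =>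
    hall η ((mem_dualAnnihilator_span_range f _).2 hη)⟩

theorem eq_of_eqOn (h : IsConeConfig G X) {η ξ : Dual ℝ W} (hη : ∀ v, η (X v) = ξ (X v)) :
    η = ξ := by
  apply LinearMap.ext_on h.span
  rintro _ ⟨v, rfl⟩
  exact hη v

theorem exists_ne_zero (h : IsConeConfig G X) {η : Dual ℝ W} (hη : η ≠ 0) :
    ∃ v, η (X v) ≠ 0 := by
  by_contra! hc
  exact hη (h.eq_of_eqOn fun v => by simp [hc v])

theorem injective (h : IsConeConfig G X) : Function.Injective X := by
  intro u v huv
  by_contra hne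
  obtain ⟨a, ha, hpos⟩ := h.exposed v
  have := hpos u hne
  rw [huv, ha] at this
  exact lt_irrefl _ this

/-- Functionals vanishing at three vertices are proportional. -/
theorem exists_smul_of_three (h : IsConeConfig G X) {u v w : V} (huv : u ≠ v) (huw : u ≠ w)
    (hvw : v ≠ w) {φ η : Dual ℝ W} (hφ : φ ≠ 0) (h1 : φ (X u) = 0) (h2 : φ (X v) = 0)
    (h3 : φ (X w) = 0) (e1 : η (X u) = 0) (e2 : η (X v) = 0) (e3 : η (X w) = 0) :
    ∃ c : ℝ, η = c • φ := by
  have hfr := h.finrank_dualAnnihilator _ (h.indep u v w huv huw hvw) (m := 1) rfl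
  have hmem : ∀ ξ : Dual ℝ W, ξ (X u) = 0 → ξ (X v) = 0 → ξ (X w) = 0 →
      ξ ∈ (Submodule.span ℝ (Set.range ![X u, X v, X w])).dualAnnihilator := by
    intro ξ a b c
    rw [mem_dualAnnihilator_span_range]
    intro i
    fin_cases i <;> simp [a, b, c]
  obtain ⟨c, hc⟩ := (finrank_eq_one_iff_of_nonzero' (⟨φ, hmem φ h1 h2 h3⟩ :
    (Submodule.span ℝ (Set.range ![X u, X v, X w])).dualAnnihilator)
    (by intro hh; exact hφ (congrArg Subtype.val hh))).1 hfr ⟨η, hmem η e1 e2 e3⟩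
  exact ⟨c, by simpa using (congrArg Subtype.val hc).symm⟩

theorem indep_two (h : IsConeConfig G X) [Finite V] {u v : V} (huv : u ≠ v) :
    LinearIndependent ℝ ![X u, X v] := by
  rw [LinearIndependent.pair_iff]
  intro s t hst
  obtain ⟨a, ha, hpa⟩ := h.exposed u
  obtain ⟨b, hb, hpb⟩ := h.exposed v
  have h1 := congrArg a hst
  have h2 := congrArg b hst
  simp only [map_add, map_smul, ha, hb, smul_eq_mul, mul_zero, zero_add, add_zero, map_zero,
    mul_eq_zero] at h1 h2
  exact ⟨h2.resolve_right (hpb u huv).ne', h1.resolve_right (hpa v huv.symm).ne'⟩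

theorem ne_zero_apply (h : IsConeConfig G X) {u v : V} (huv : u ≠ v) : X u ≠ 0 := by
  obtain ⟨b, hb, hpb⟩ := h.exposed v
  intro h0
  have := hpb u huv
  simp [h0] at this

/-- The functionals vanishing at two vertices separate every third one. -/
theorem exists_sep (h : IsConeConfig G X) {u v w : V} (huv : u ≠ v) (huw : u ≠ w)
    (hvw : v ≠ w) : ∃ η : Dual ℝ W, η (X u) = 0 ∧ η (X v) = 0 ∧ η (X w) ≠ 0 := by
  have hli := h.indep u v w huv huw hvw
  by_contra! hc
  have hli2 : LinearIndependent ℝ ![X w, X u, X v] := h.indep w u v huw.symm hvw.symm huv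
  have h3 : X w ∉ Submodule.span ℝ (Set.range ![X u, X v]) := by
    have := (linearIndependent_finCons (x := X w) (v := ![X u, X v])).1 hli2
    exact this.2
  obtain ⟨η, hη, hz⟩ := Submodule.exists_le_ker_of_notMem h3
  apply hη
  apply hc
  · exact hz (Submodule.subset_span ⟨0, rfl⟩)
  · exact hz (Submodule.subset_span ⟨1, rfl⟩)

theorem span_pair_of_three (h : IsConeConfig G X) {u v w : V} (huv : u ≠ v) (huw : u ≠ w)
    (hvw : v ≠ w) (A B : W) :
    X u ∉ Submodule.span ℝ {A, B} ∨ X v ∉ Submodule.span ℝ {A, B} ∨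
      X w ∉ Submodule.span ℝ {A, B} := by
  by_contra! hc
  have := h.finiteDimensional
  have hle : Submodule.span ℝ (Set.range ![X u, X v, X w]) ≤ Submodule.span ℝ {A, B} := by
    rw [Submodule.span_le]
    rintro _ ⟨i, rfl⟩
    fin_cases i
    · exact hc.1
    · exact hc.2.1
    · exact hc.2.2
  have h1 := Submodule.finrank_mono hle
  rw [finrank_span_eq_card (h.indep u v w huv huw hvw)] at h1
  have h2 : Module.finrank ℝ (Submodule.span ℝ {A, B}) ≤ 2 := by
    have := finrank_range_le_card (R := ℝ) ![A, B]
    rw [Set.finrank, Matrix.range_cons, Matrix.range_cons, Matrix.range_empty, Set.union_empty,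
      Set.singleton_union] at this
    simpa using this
  simp only [Fintype.card_fin] at h1
  omega

variable [Finite V]

theorem exists_third (h : IsConeConfig G X) {u v : V} (huv : u ≠ v) : ∃ w, w ≠ u ∧ w ≠ v := by
  by_contra! hc
  have := h.finiteDimensional
  have hsub : Set.range X ⊆ Set.range ![X u, X v] := by
    rintro _ ⟨w, rfl⟩
    by_cases hw : w = u
    · exact ⟨0, by simp [hw]⟩
    · exact ⟨1, by simp [hc w hw]⟩
  have h1 : Submodule.span ℝ (Set.range ![X u, X v]) = ⊤ :=
    eq_top_iff.2 (h.span ▸ Submodule.span_mono hsub)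
  have h2 := finrank_span_eq_card (h.indep_two huv)
  rw [h1, finrank_top, h.finrank] at h2
  simp at h2

/-- An edge lies in exactly two facets, and their functionals span those vanishing on the edge. -/
theorem pencil (h : IsConeConfig G X) {u v : V} (hadj : G.Adj u v) :
    ∃ φ₁ φ₂ : Dual ℝ W, IsFacetFun X φ₁ ∧ IsFacetFun X φ₂ ∧ φ₁ (X u) = 0 ∧ φ₁ (X v) = 0 ∧
      φ₂ (X u) = 0 ∧ φ₂ (X v) = 0 ∧
      (∀ w, φ₁ (X w) = 0 → φ₂ (X w) = 0 → w = u ∨ w = v) ∧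
      ∀ η : Dual ℝ W, η (X u) = 0 → η (X v) = 0 → ∃ s t : ℝ, η = s • φ₁ + t • φ₂ := by
  obtain ⟨huv, a, ha0, ha⟩ := (h.adj_iff u v).1 hadj
  have hau : a (X u) = 0 := (ha u).2 (Or.inl rfl)
  have hav : a (X v) = 0 := (ha v).2 (Or.inr rfl)
  have hapos : ∀ w, w ≠ u → w ≠ v → 0 < a (X w) := fun w h1 h2 =>
    lt_of_le_of_ne (ha0 w) fun h0 => ((ha w).1 h0.symm).elim h1 h2
  obtain ⟨w0, hw0u, hw0v⟩ := h.exists_third huv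
  have hane : a ≠ 0 := by
    intro h0
    have := hapos w0 hw0u hw0v
    simp [h0] at this
  obtain ⟨b, hb, hbn, hall⟩ := h.exists_complement ![X u, X v] (h.indep_two huv) (m := 1) rfl
    ![a] (linearIndependent_unique_iff.2 (by simpa using hane)) (by
      intro i j
      fin_cases i
      fin_cases j
      · simpa using hau
      · simpa using hav)
  have hbu : b (X u) = 0 := by simpa using hb 0
  have hbv : b (X v) = 0 := by simpa using hb 1
  have hrange : Set.range (![a] : Fin 1 → Dual ℝ W) = {a} := by simp
  rw [hrange] at hbn hall
  simp only [Submodule.mem_span_singleton] at hbn hall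
  let ι := {w : V // w ≠ u ∧ w ≠ v}
  have : Nonempty ι := ⟨⟨w0, hw0u, hw0v⟩⟩
  -- The functionals vanishing on the edge form a plane spanned by `a` and `b`. The extreme slopes
  -- `b / a` over the other vertices are where `r • a - b` and `b - r • a` stop being nonnegative,
  -- so each extreme functional acquires a third zero: these are the two facets.
  obtain ⟨⟨w1, h1u, h1v⟩, hmax⟩ := Finite.exists_max (fun w : ι => b (X w.1) / a (X w.1))
  obtain ⟨⟨w2, h2u, h2v⟩, hmin⟩ := Finite.exists_min (fun w : ι => b (X w.1) / a (X w.1))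
  set r₁ := b (X w1) / a (X w1) with hr1
  set r₂ := b (X w2) / a (X w2) with hr2
  have hw1 : b (X w1) = r₁ * a (X w1) := by rw [hr1, div_mul_cancel₀]; exact (hapos _ h1u h1v).ne'
  have hw2 : b (X w2) = r₂ * a (X w2) := by rw [hr2, div_mul_cancel₀]; exact (hapos _ h2u h2v).ne'
  have hle1 : ∀ w, b (X w) ≤ r₁ * a (X w) := by
    intro w
    by_cases hwu : w = u
    · subst hwu; simp [hbu, hau]
    by_cases hwv : w = v
    · subst hwv; simp [hbv, hav]
    exact (div_le_iff₀ (hapos w hwu hwv)).1 (hmax ⟨w, hwu, hwv⟩)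
  have hle2 : ∀ w, r₂ * a (X w) ≤ b (X w) := by
    intro w
    by_cases hwu : w = u
    · subst hwu; simp [hbu, hau]
    by_cases hwv : w = v
    · subst hwv; simp [hbv, hav]
    exact (le_div_iff₀ (hapos w hwu hwv)).1 (hmin ⟨w, hwu, hwv⟩)
  have hlt : r₂ < r₁ := by
    refine lt_of_le_of_ne (hmin ⟨w1, h1u, h1v⟩) fun heq => hbn ⟨r₁, ?_⟩
    apply h.eq_of_eqOn
    intro w
    have := hle1 w
    have := hle2 w
    rw [heq] at this
    simp only [LinearMap.smul_apply, smul_eq_mul]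
    linarith
  refine ⟨r₁ • a - b, b - r₂ • a, ⟨?_, ?_, u, v, w1, huv, h1u.symm, h1v.symm, ?_⟩,
    ⟨?_, ?_, u, v, w2, huv, h2u.symm, h2v.symm, ?_⟩, ?_, ?_, ?_, ?_, ?_, ?_⟩
  · intro h0; exact hbn ⟨r₁, by rwa [sub_eq_zero] at h0⟩
  · intro w; simpa using hle1 w
  · simp [hau, hav, hbu, hbv, hw1]
  · intro h0; exact hbn ⟨r₂, by rw [sub_eq_zero] at h0; exact h0.symm⟩
  · intro w; simpa using hle2 w
  · simp [hau, hav, hbu, hbv, hw2]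
  · simp [hau, hbu]
  · simp [hav, hbv]
  · simp [hau, hbu]
  · simp [hav, hbv]
  · intro w hz1 hz2
    simp only [LinearMap.sub_apply, LinearMap.smul_apply, smul_eq_mul] at hz1 hz2
    rw [← ha]
    have : (r₁ - r₂) * a (X w) = 0 := by linarith
    exact (mul_eq_zero.1 this).resolve_left (by linarith)
  · intro η hηu hηv
    obtain ⟨t, _, ⟨s, rfl⟩, rfl⟩ := hall η (by intro j; fin_cases j <;> simp [hηu, hηv])
    have hd : r₁ - r₂ ≠ 0 := by linarith
    refine ⟨(s + t * r₂) / (r₁ - r₂), t + (s + t * r₂) / (r₁ - r₂), ?_⟩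
    ext w
    simp only [LinearMap.add_apply, LinearMap.smul_apply, LinearMap.sub_apply, smul_eq_mul]
    field_simp
    ring

/-- An edge of a face is an edge. -/
theorem adj_of_pos_on_face (h : IsConeConfig G X) {φ ψ : Dual ℝ W} (hφ0 : ∀ w, 0 ≤ φ (X w))
    {v z : V} (hv : φ (X v) = 0) (hφz : φ (X z) = 0) (hvz : v ≠ z) (hψv : ψ (X v) = 0)
    (hψz : ψ (X z) = 0) (hψ : ∀ w, φ (X w) = 0 → w ≠ v → w ≠ z → 0 < ψ (X w)) :
    G.Adj v z := by
  -- A large multiple of `φ` makes the sum positive off the face and changes nothing on it.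
  obtain ⟨N, hN⟩ : ∃ N : ℝ, ∀ w, φ (X w) ≠ 0 → 0 < (N • φ + ψ) (X w) := by
    have : Nonempty V := ⟨v⟩
    obtain ⟨m, hm⟩ := Finite.exists_max (fun w => -ψ (X w) / φ (X w))
    refine ⟨-ψ (X m) / φ (X m) + 1, fun w hw => ?_⟩
    have hpos : 0 < φ (X w) := lt_of_le_of_ne (hφ0 w) hw.symm
    have h1 := (div_le_iff₀ hpos).1 (hm w)
    simp only [LinearMap.add_apply, LinearMap.smul_apply, smul_eq_mul]
    nlinarith
  refine (h.adj_iff v z).2 ⟨hvz, N • φ + ψ, ?_, ?_⟩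
  · intro w
    by_cases hw : φ (X w) = 0
    · by_cases hwv : w = v
      · subst hwv; simp [hv, hψv]
      by_cases hwz : w = z
      · subst hwz; simp [hφz, hψz]
      simpa [hw] using (hψ w hw hwv hwz).le
    · exact (hN w hw).le
  · intro w
    constructor
    · intro hw
      by_contra! hc
      by_cases hφw : φ (X w) = 0
      · have := hψ w hφw hc.1 hc.2
        simp [hφw] at hw
        exact this.ne' hw
      · exact (hN w hφw).ne' hw
    · rintro (rfl | rfl) <;> simp [*]

/-- A facet is a polygon: each of its vertices has exactly two neighbours in it. -/
theorem polygon (h : IsConeConfig G X) {φ : Dual ℝ W} (hφ : IsFacetFun X φ) {v : V}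
    (hv : φ (X v) = 0) :
    ∃ a b : V, a ≠ b ∧ G.Adj v a ∧ G.Adj v b ∧ φ (X a) = 0 ∧ φ (X b) = 0 ∧
      (∀ w, G.Adj v w → φ (X w) = 0 → w = a ∨ w = b) ∧
      ∃ α β : Dual ℝ W, α (X v) = 0 ∧ β (X v) = 0 ∧ α (X a) = 0 ∧ β (X b) = 0 ∧
        (∀ w, φ (X w) = 0 → w ≠ v → w ≠ a → 0 < α (X w)) ∧
        (∀ w, φ (X w) = 0 → w ≠ v → w ≠ b → 0 < β (X w)) ∧
        ∀ η : Dual ℝ W, η (X v) = 0 → ∃ s t r : ℝ, η = s • α + t • β + r • φ := by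
  obtain ⟨a, hav, hapos⟩ := h.exposed v
  obtain ⟨w0, hw0, hw0v⟩ : ∃ w, φ (X w) = 0 ∧ w ≠ v := by
    obtain ⟨p, q, r, hpq, -, -, hp, hq, -⟩ := hφ.three
    by_cases hpv : p = v
    · exact ⟨q, hq, fun hh => hpq (hpv.trans hh.symm)⟩
    · exact ⟨p, hp, hpv⟩
  have hliφ : LinearIndependent ℝ ![a, φ] := by
    rw [LinearIndependent.pair_iff]
    intro s t hst
    have h1 := congrArg (fun η : Dual ℝ W => η (X w0)) hst
    simp only [LinearMap.add_apply, LinearMap.smul_apply, hw0, smul_eq_mul, mul_zero, add_zero,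
      LinearMap.zero_apply, mul_eq_zero] at h1
    have hs := h1.resolve_right (hapos w0 hw0v).ne'
    refine ⟨hs, ?_⟩
    rw [hs, zero_smul, zero_add, smul_eq_zero] at hst
    exact hst.resolve_right hφ.ne_zero
  obtain ⟨b, hb, hbn, hall⟩ := h.exists_complement ![X v]
    (linearIndependent_unique_iff.2 (by simpa using h.ne_zero_apply hw0v.symm)) (m := 2) rfl
    ![a, φ] hliφ (by
      intro i j
      fin_cases j
      fin_cases i
      · simpa using hav
      · simpa using hv)
  have hbv : b (X v) = 0 := by simpa using hb 0
  have hrange : Set.range (![a, φ] : Fin 2 → Dual ℝ W) = {a, φ} := by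
    simp [Matrix.range_cons, Set.pair_comm]
  rw [hrange] at hbn hall
  simp only [Submodule.mem_span_pair] at hbn hall
  let ι := {w : V // φ (X w) = 0 ∧ w ≠ v}
  have : Nonempty ι := ⟨⟨w0, hw0, hw0v⟩⟩
  -- The extreme slopes again, now only over the vertices of the facet: modulo `φ`, the functionals
  -- vanishing at `v` form a plane, and the extreme ones cut out the two sides of the polygon at
  -- `v`.
  obtain ⟨⟨w1, h1φ, h1v⟩, hmax⟩ := Finite.exists_max (fun w : ι => b (X w.1) / a (X w.1))
  obtain ⟨⟨w2, h2φ, h2v⟩, hmin⟩ := Finite.exists_min (fun w : ι => b (X w.1) / a (X w.1))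
  set r₁ := b (X w1) / a (X w1) with hr1
  set r₂ := b (X w2) / a (X w2) with hr2
  have hw1 : b (X w1) = r₁ * a (X w1) := by rw [hr1, div_mul_cancel₀]; exact (hapos _ h1v).ne'
  have hw2 : b (X w2) = r₂ * a (X w2) := by rw [hr2, div_mul_cancel₀]; exact (hapos _ h2v).ne'
  have hle1 : ∀ w, φ (X w) = 0 → b (X w) ≤ r₁ * a (X w) := by
    intro w hw
    by_cases hwv : w = v
    · subst hwv; simp [hbv, hav]
    exact (div_le_iff₀ (hapos w hwv)).1 (hmax ⟨w, hw, hwv⟩)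
  have hle2 : ∀ w, φ (X w) = 0 → r₂ * a (X w) ≤ b (X w) := by
    intro w hw
    by_cases hwv : w = v
    · subst hwv; simp [hbv, hav]
    exact (le_div_iff₀ (hapos w hwv)).1 (hmin ⟨w, hw, hwv⟩)
  have hnc : ∀ r c : ℝ, r • a - b ≠ c • φ := by
    intro r c hrc
    exact hbn ⟨r, -c, by rw [neg_smul, ← hrc]; abel⟩
  have hlt : r₂ < r₁ := by
    refine lt_of_le_of_ne (hmin ⟨w1, h1φ, h1v⟩) fun heq => ?_
    obtain ⟨p, q, r, hpq, hpr, hqr, hp, hq, hr⟩ := hφ.three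
    have hz : ∀ w, φ (X w) = 0 → (r₁ • a - b) (X w) = 0 := by
      intro w hw
      have := hle1 w hw
      have := hle2 w hw
      rw [heq] at this
      simp only [LinearMap.sub_apply, LinearMap.smul_apply, smul_eq_mul]
      linarith
    obtain ⟨c, hc⟩ := h.exists_smul_of_three hpq hpr hqr hφ.ne_zero hp hq hr (hz p hp) (hz q hq)
      (hz r hr)
    exact hnc _ _ hc
  have key : ∀ (r : ℝ) (w' : V), φ (X w') = 0 → w' ≠ v → (r • a - b) (X w') = 0 →
      ∀ w, φ (X w) = 0 → w ≠ v → w ≠ w' → (r • a - b) (X w) ≠ 0 := by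
    intro r w' hw' hw'v hz w hw hwv hww' hz'
    obtain ⟨c, hc⟩ := h.exists_smul_of_three hw'v.symm hwv.symm hww'.symm hφ.ne_zero hv hw' hw
      (by simp [hav, hbv]) hz hz'
    exact hnc _ _ hc
  have hα1 : (r₁ • a - b) (X w1) = 0 := by simp [hw1]
  have hβ2 : (r₂ • a - b) (X w2) = 0 := by simp [hw2]
  have hα : ∀ w, φ (X w) = 0 → w ≠ v → w ≠ w1 → 0 < (r₁ • a - b) (X w) := by
    intro w hw hwv hww
    refine lt_of_le_of_ne ?_ (key r₁ w1 h1φ h1v hα1 w hw hwv hww).symm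
    simpa using hle1 w hw
  have hβ : ∀ w, φ (X w) = 0 → w ≠ v → w ≠ w2 → 0 < (b - r₂ • a) (X w) := by
    intro w hw hwv hww
    have h1 := key r₂ w2 h2φ h2v hβ2 w hw hwv hww
    have h2 := hle2 w hw
    simp only [LinearMap.sub_apply, LinearMap.smul_apply, smul_eq_mul] at h1 ⊢
    refine lt_of_le_of_ne (by linarith) fun h0 => h1 (by linarith)
  have hβ2' : (b - r₂ • a) (X w2) = 0 := by simp [hw2]
  have h12 : w1 ≠ w2 := by
    intro he
    rw [he] at hw1
    have : (r₁ - r₂) * a (X w2) = 0 := by linarith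
    rcases mul_eq_zero.1 this with h0 | h0
    · linarith
    · exact (hapos _ h2v).ne' h0
  have hspan : ∀ η : Dual ℝ W, η (X v) = 0 →
      ∃ s t r : ℝ, η = s • (r₁ • a - b) + t • (b - r₂ • a) + r • φ := by
    intro η hη
    obtain ⟨t, _, ⟨s, r, rfl⟩, rfl⟩ := hall η (by intro j; fin_cases j; simpa using hη)
    have hd : r₁ - r₂ ≠ 0 := by linarith
    refine ⟨(s + t * r₂) / (r₁ - r₂), t + (s + t * r₂) / (r₁ - r₂), r, ?_⟩
    ext w
    simp only [LinearMap.add_apply, LinearMap.smul_apply, LinearMap.sub_apply, smul_eq_mul]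
    field_simp
    ring
  refine ⟨w1, w2, h12, ?_, ?_, h1φ, h2φ, ?_, r₁ • a - b, b - r₂ • a, by simp [hav, hbv],
    by simp [hav, hbv], hα1, hβ2', hα, hβ, hspan⟩
  · exact h.adj_of_pos_on_face hφ.nonneg hv h1φ h1v.symm (by simp [hav, hbv]) hα1 hα
  · exact h.adj_of_pos_on_face hφ.nonneg hv h2φ h2v.symm (by simp [hav, hbv]) hβ2' hβ
  · intro w hadj hw
    by_contra! hc
    obtain ⟨hvw, ψ, hψ0, hψ⟩ := (h.adj_iff v w).1 hadj
    -- Positivity of `ψ` at both side vertices makes both coefficients positive, so `ψ` cannot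
    -- vanish at a third vertex of the facet besides `v`.
    obtain ⟨s, t, r, hst⟩ := hspan ψ ((hψ v).2 (Or.inl rfl))
    have e : ∀ z, φ (X z) = 0 →
        ψ (X z) = s * (r₁ • a - b) (X z) + t * (b - r₂ • a) (X z) := by
      intro z hz
      rw [hst]
      simp only [LinearMap.add_apply, LinearMap.smul_apply, smul_eq_mul, hz]
      ring
    have hψ1 : 0 < ψ (X w1) := lt_of_le_of_ne (hψ0 w1)
      fun h0 => ((hψ w1).1 h0.symm).elim h1v fun h0 => hc.1 h0.symm
    have hψ2 : 0 < ψ (X w2) := lt_of_le_of_ne (hψ0 w2)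
      fun h0 => ((hψ w2).1 h0.symm).elim h2v fun h0 => hc.2 h0.symm
    have hψw : ψ (X w) = 0 := (hψ w).2 (Or.inr rfl)
    rw [e w1 h1φ, hα1, mul_zero, zero_add] at hψ1
    rw [e w2 h2φ, hβ2', mul_zero, add_zero] at hψ2
    rw [e w hw] at hψw
    have ht := pos_of_mul_pos_left hψ1 (hβ w1 h1φ h1v h12).le
    have hs := pos_of_mul_pos_left hψ2 (hα w2 h2φ h2v h12.symm).le
    have p1 := mul_pos hs (hα w hw hvw.symm hc.1)
    have p2 := mul_pos ht (hβ w hw hvw.symm hc.2)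
    linarith

end IsConeConfig

/-! ### Simplex steps and connectivity -/

/-- Small positive `ε` preserves the finitely many strict inequalities of `p`, while `q` breaks the
ties. -/
theorem exists_injective_perturbation {ι : Type*} [Finite ι] (p q : ι → ℝ)
    (hq : Function.Injective q) :
    ∃ ε > 0, Function.Injective (fun i => p i + ε * q i) ∧
      ∀ i j, p i < p j → p i + ε * q i < p j + ε * q j := by
  have h1 : ∀ i j : ι, ∀ᶠ ε : ℝ in nhdsWithin 0 (Set.Ioi 0),
      p i < p j → p i + ε * q i < p j + ε * q j := by
    intro i j
    by_cases hij : p i < p j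
    · have ht : Filter.Tendsto (fun ε : ℝ => p j + ε * q j - (p i + ε * q i))
          (nhdsWithin 0 (Set.Ioi 0)) (nhds (p j - p i)) := by
        have : Continuous fun ε : ℝ => p j + ε * q j - (p i + ε * q i) := by fun_prop
        have h2 := this.tendsto 0
        simp only [zero_mul, add_zero] at h2
        exact h2.mono_left nhdsWithin_le_nhds
      filter_upwards [ht.eventually (lt_mem_nhds (sub_pos.2 hij))] with ε hε _
      linarith
    · exact Filter.Eventually.of_forall fun ε hc => absurd hc hij
  have h2 : ∀ i j : ι, ∀ᶠ ε : ℝ in nhdsWithin 0 (Set.Ioi 0),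
      p i = p j → i ≠ j → p i + ε * q i ≠ p j + ε * q j := by
    intro i j
    filter_upwards [self_mem_nhdsWithin] with ε hε hp hij he
    have h3 : ε * q i = ε * q j := by linarith
    exact hij (hq (mul_left_cancel₀ (ne_of_gt hε) h3))
  have h1' := Filter.eventually_all.2 fun i => Filter.eventually_all.2 (h1 i)
  have h2' := Filter.eventually_all.2 fun i => Filter.eventually_all.2 (h2 i)
  obtain ⟨ε, ⟨ha, hb⟩, hε⟩ := ((h1'.and h2').and self_mem_nhdsWithin).exists
  refine ⟨ε, hε, fun i j hij => ?_, ha⟩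
  by_contra hne
  rcases lt_trichotomy (p i) (p j) with hp | hp | hp
  · exact (ha i j hp).ne hij
  · exact hb i j hp hne hij
  · exact (ha j i hp).ne hij.symm

/-- If every element of `U` that is not a maximum of `r` has a higher neighbour, then `U` is
connected. -/
theorem subset_of_ascending {ι : Type*} [Finite ι] (R : ι → ι → Prop) (r : ι → ℝ)
    (hr : Function.Injective r) (hasc : ∀ i j, r i < r j → ∃ k, R i k ∧ r i < r k)
    {U A : Set ι} (hU : ∀ i ∈ U, ∀ k, r i < r k → k ∈ U) (hAU : A ⊆ U) (hA : A.Nonempty)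
    (hR : ∀ i ∈ U, ∀ k ∈ U, R i k → (i ∈ A ↔ k ∈ A)) : U ⊆ A := by
  intro b hb
  by_contra hbA
  -- Compare the highest elements of `A` and of its complement in `U`. The lower of the two has a
  -- higher neighbour, which lies in the same class and contradicts maximality.
  obtain ⟨i, hiA, hi⟩ := Set.exists_max_image A r (Set.toFinite _) hA
  obtain ⟨j, hjB, hj⟩ := Set.exists_max_image (U \ A) r (Set.toFinite _) ⟨b, hb, hbA⟩
  rcases lt_trichotomy (r i) (r j) with hlt | heq | hlt
  · obtain ⟨k, hk, hlt'⟩ := hasc i j hlt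
    have hkU := hU i (hAU hiA) k hlt'
    exact absurd (hi k ((hR i (hAU hiA) k hkU hk).1 hiA)) (not_le.2 hlt')
  · exact hjB.2 (hr heq ▸ hiA)
  · obtain ⟨k, hk, hlt'⟩ := hasc j i hlt
    have hkU := hU j hjB.1 k hlt'
    exact absurd (hj k ⟨hkU, fun hkA => hjB.2 ((hR j hjB.1 k hkU hk).2 hkA)⟩) (not_le.2 hlt')

namespace IsConeConfig

variable {V W : Type*} [AddCommGroup W] [Module ℝ W] {G : SimpleGraph V} {X : V → W} [Finite V]

/-- Tilt the exposing functional `a` to `a - t • η`, with the first `t` at which some vertex where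
`η` is positive is hit. The result is nonzero because `a` is not a multiple of `η`, and it exposes
either an edge at `v` or a facet. On a facet, `η` is a combination of the two side functionals of
the polygon at `v`, so it is positive at one of the two neighbours. -/
theorem exists_adj_pos_of_ne_smul (h : IsConeConfig G X) {v : V} {a η : Dual ℝ W}
    (hav : a (X v) = 0) (hapos : ∀ u, u ≠ v → 0 < a (X u)) (hne : ∀ t : ℝ, a ≠ t • η)
    (hv : η (X v) = 0) (hu : ∃ u, 0 < η (X u)) : ∃ w, G.Adj v w ∧ 0 < η (X w) := by
  let ι := {u : V // 0 < η (X u)}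
  obtain ⟨u0, hu0⟩ := hu
  have : Nonempty ι := ⟨⟨u0, hu0⟩⟩
  obtain ⟨⟨w, hw⟩, hmin⟩ := Finite.exists_min (fun u : ι => a (X u.1) / η (X u.1))
  set t := a (X w) / η (X w) with ht
  have hwv : w ≠ v := by rintro rfl; exact hw.ne' hv
  have htpos : 0 < t := div_pos (hapos w hwv) hw
  set φ := a - t • η with hφ
  have hφv : φ (X v) = 0 := by simp [hφ, hav, hv]
  have hφw : φ (X w) = 0 := by
    simp only [hφ, LinearMap.sub_apply, LinearMap.smul_apply, smul_eq_mul, ht]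
    rw [div_mul_cancel₀ _ hw.ne', sub_self]
  have ha0 : ∀ u, 0 ≤ a (X u) := by
    intro u
    by_cases huv : u = v
    · rw [huv, hav]
    · exact (hapos u huv).le
  have hφ0 : ∀ u, 0 ≤ φ (X u) := by
    intro u
    simp only [hφ, LinearMap.sub_apply, LinearMap.smul_apply, smul_eq_mul]
    by_cases hu : 0 < η (X u)
    · have := (le_div_iff₀ hu).1 (hmin ⟨u, hu⟩)
      simp only at this
      linarith
    · have := mul_nonneg htpos.le (neg_nonneg.2 (not_lt.1 hu))
      have := ha0 u
      linarith
  by_cases hex : ∃ w', w' ≠ v ∧ w' ≠ w ∧ φ (X w') = 0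
  · obtain ⟨w', hw'v, hw'w, hφw'⟩ := hex
    have hφz : φ ≠ 0 := fun h0 => hne t (sub_eq_zero.1 h0)
    obtain ⟨p, q, hpq, hp, hq, hφp, hφq, -, α, β, hαv, hβv, hαp, hβq, hα, hβ, hall⟩ :=
      h.polygon (⟨hφz, hφ0, v, w, w', hwv.symm, hw'v.symm, hw'w.symm, hφv, hφw, hφw'⟩ :
        IsFacetFun X φ) hφv
    obtain ⟨s, t', r, he⟩ := hall η hv
    have e : ∀ z, φ (X z) = 0 → η (X z) = s * α (X z) + t' * β (X z) := by
      intro z hz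
      rw [he]
      simp [hz]
    have hα0 : ∀ z, φ (X z) = 0 → 0 ≤ α (X z) := by
      intro z hz
      by_cases h1 : z = v
      · rw [h1, hαv]
      by_cases h2 : z = p
      · rw [h2, hαp]
      exact (hα z hz h1 h2).le
    have hβ0 : ∀ z, φ (X z) = 0 → 0 ≤ β (X z) := by
      intro z hz
      by_cases h1 : z = v
      · rw [h1, hβv]
      by_cases h2 : z = q
      · rw [h2, hβq]
      exact (hβ z hz h1 h2).le
    rw [e w hφw] at hw
    by_cases hs : 0 < s
    · refine ⟨q, hq, ?_⟩
      rw [e q hφq, hβq, mul_zero, add_zero]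
      exact mul_pos hs (hα q hφq hq.ne' hpq.symm)
    · have ht' : 0 < t' := by
        by_contra hc
        have := mul_nonneg (neg_nonneg.2 (not_lt.1 hs)) (hα0 w hφw)
        have := mul_nonneg (neg_nonneg.2 (not_lt.1 hc)) (hβ0 w hφw)
        linarith
      refine ⟨p, hp, ?_⟩
      rw [e p hφp, hαp, mul_zero, zero_add]
      exact mul_pos ht' (hβ p hφp hp.ne' hpq)
  · push Not at hex
    exact ⟨w, (h.adj_iff v w).2 ⟨hwv.symm, φ, hφ0, fun z => ⟨fun hz => by
      by_contra! hc
      exact hex z hc.1 hc.2 hz, by rintro (rfl | rfl) <;> assumption⟩⟩, hw⟩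

/-- The simplex step at a vertex, in homogeneous form. -/
theorem exists_adj_pos (h : IsConeConfig G X) {v : V} {η : Dual ℝ W} (hv : η (X v) = 0)
    (hu : ∃ u, 0 < η (X u)) : ∃ w, G.Adj v w ∧ 0 < η (X w) := by
  obtain ⟨a, hav, hapos⟩ := h.exposed v
  by_cases hne : ∃ t : ℝ, a = t • η
  · obtain ⟨t, ht⟩ := hne
    obtain ⟨u, hu⟩ := hu
    have huv : u ≠ v := by rintro rfl; exact hu.ne' hv
    have htu : 0 < t := by
      have h1 := hapos u huv
      rw [ht] at h1
      exact pos_of_mul_pos_left h1 hu.le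
    obtain ⟨w, hwu, hwv⟩ := h.exists_third huv
    -- Here `η` is positive away from `v`, so any neighbour will do. To get one, the general case is
    -- applied to a multiple of `ξ` positive at `w`; it is not proportional to `a` because it
    -- vanishes at `u`.
    obtain ⟨ξ, hξv, hξu, hξw⟩ := h.exists_sep huv.symm hwv.symm hwu.symm
    have hξ : ∀ c : ℝ, ∀ t : ℝ, a ≠ t • c • ξ := by
      intro c t' ht'
      have h1 := hapos u huv
      rw [ht'] at h1
      simp [hξu] at h1
    obtain ⟨z, hz, -⟩ := h.exists_adj_pos_of_ne_smul hav hapos (hξ (ξ (X w)))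
      (by simp [hξv]) ⟨w, by simpa using mul_self_pos.2 hξw⟩
    refine ⟨z, hz, ?_⟩
    have h1 := hapos z hz.ne'
    rw [ht] at h1
    exact pos_of_mul_pos_right h1 htu.le
  · push Not at hne
    exact h.exists_adj_pos_of_ne_smul hav hapos hne hv hu

/-- Functionals refining the order of a given one and separating the vertices. -/
theorem exists_injective_refinement (h : IsConeConfig G X) (φ : Dual ℝ W) :
    ∃ η : Dual ℝ W, Function.Injective (fun v => η (X v)) ∧
      ∀ u v, φ (X u) < φ (X v) → η (X u) < η (X v) := by
  obtain ⟨q, hq⟩ := Module.exists_dual_forall_apply_ne_zero (K := ℝ)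
    (fun p : {p : V × V // p.1 ≠ p.2} => X p.1.1 - X p.1.2)
    (fun p => sub_ne_zero.2 (h.injective.ne p.2))
  obtain ⟨ε, -, h1, h2⟩ := exists_injective_perturbation (fun v => φ (X v)) (fun v => q (X v))
    (by
      intro u v huv
      by_contra hne
      exact hq ⟨(u, v), hne⟩ (by simpa [sub_eq_zero] using huv))
  exact ⟨φ + ε • q, by simpa using h1, by simpa using h2⟩

/-- The simplex step at a vertex. -/
theorem exists_adj_lt (h : IsConeConfig G X) (η : Dual ℝ W) {v u : V} (hu : η (X v) < η (X u)) :
    ∃ w, G.Adj v w ∧ η (X v) < η (X w) := by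
  obtain ⟨τ, hτ⟩ := h.height
  -- Since `τ` is one on every vertex, subtracting `η (X v) • τ` turns a comparison with the value
  -- at `v` into a sign.
  obtain ⟨w, hw, hpos⟩ := h.exists_adj_pos (v := v) (η := η - η (X v) • τ) (by simp [hτ])
    ⟨u, by simpa [hτ] using hu⟩
  exact ⟨w, hw, by simpa [hτ] using hpos⟩

/-- A set of vertices that is closed upwards for a linear functional is connected. -/
theorem subset_of_upper (h : IsConeConfig G X) (φ : Dual ℝ W) {U A : Set V}
    (hU : ∀ u ∈ U, ∀ w, φ (X u) ≤ φ (X w) → w ∈ U) (hAU : A ⊆ U) (hA : A.Nonempty)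
    (hadj : ∀ u ∈ U, ∀ w ∈ U, G.Adj u w → (u ∈ A ↔ w ∈ A)) : U ⊆ A := by
  obtain ⟨η, hinj, hη⟩ := h.exists_injective_refinement φ
  refine subset_of_ascending G.Adj _ hinj (fun i j hij => h.exists_adj_lt η hij) ?_ hAU hA hadj
  intro u hu w huw
  refine hU u hu w ?_
  by_contra hc
  exact lt_asymm huw (hη w u (not_le.1 hc))

/-- The link induction needs every `η - r • a` to be nonzero. If `η` is a multiple of `a`, replace
`a` by `N • a + ξ` with `N` large: it still exposes `v`, but has another direction. -/
theorem exists_exposing_ne_smul (h : IsConeConfig G X) {v : V} {η : Dual ℝ W} (hη : η ≠ 0) :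
    ∃ a : Dual ℝ W, a (X v) = 0 ∧ (∀ u, u ≠ v → 0 < a (X u)) ∧ ∀ r : ℝ, η ≠ r • a := by
  obtain ⟨a, hav, hapos⟩ := h.exposed v
  by_cases hc : ∃ r : ℝ, η = r • a
  · obtain ⟨r, hr⟩ := hc
    have hr0 : r ≠ 0 := by rintro rfl; exact hη (by simpa using hr)
    obtain ⟨u, hu⟩ : ∃ u, u ≠ v := by
      obtain ⟨z, hz⟩ := h.exists_ne_zero hη
      refine ⟨z, ?_⟩
      rintro rfl
      exact hz (by simp [hr, hav])
    obtain ⟨w, hwu, hwv⟩ := h.exists_third hu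
    obtain ⟨ξ, hξv, hξu, hξw⟩ := h.exists_sep hu.symm hwv.symm hwu.symm
    have : Nonempty V := ⟨v⟩
    obtain ⟨m, hm⟩ := Finite.exists_max (fun w => -ξ (X w) / a (X w))
    refine ⟨(-ξ (X m) / a (X m) + 1) • a + ξ, by simp [hav, hξv], fun z hz => ?_, fun r' hr' => ?_⟩
    · have h1 := (div_le_iff₀ (hapos z hz)).1 (hm z)
      have h2 := hapos z hz
      simp only [LinearMap.add_apply, LinearMap.smul_apply, smul_eq_mul]
      nlinarith
    · set N := -ξ (X m) / a (X m) + 1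
      rw [hr] at hr'
      have e1 := congrArg (fun f : Dual ℝ W => f (X u)) hr'
      have e2 := congrArg (fun f : Dual ℝ W => f (X w)) hr'
      simp only [LinearMap.add_apply, LinearMap.smul_apply, smul_eq_mul, hξu, add_zero] at e1 e2
      have h1 : r = r' * N := mul_right_cancel₀ (hapos u hu).ne' (by linarith)
      have h2 : r' * ξ (X w) = 0 := by rw [h1] at e2; linarith
      have h3 : r' = 0 := (mul_eq_zero.1 h2).resolve_right hξw
      exact hr0 (by rw [h1, h3, zero_mul])
  · push Not at hc
    exact ⟨a, hav, hapos, hc⟩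

/-- The link of a vertex is connected along any pencil of functionals: properties propagate
from the lowest neighbour through the facets at the vertex. -/
theorem link_induction (h : IsConeConfig G X) {v : V} {a η : Dual ℝ W} (hav : a (X v) = 0)
    (hapos : ∀ u, u ≠ v → 0 < a (X u)) (hη : η (X v) = 0)
    (hne : ∀ r : ℝ, η ≠ r • a) {w₀ : V} (hw₀ : G.Adj v w₀)
    (hmin : ∀ w, G.Adj v w → η (X w₀) / a (X w₀) ≤ η (X w) / a (X w)) {P : V → Prop} (h0 : P w₀)
    (hstep : ∀ w w' S, G.Adj v w → G.Adj v w' → w ≠ w' → IsFacet X S → v ∈ S → w ∈ S → w' ∈ S →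
      (∀ u ∈ S, u ≠ v → η (X u) / a (X u) ≤ η (X w) / a (X w)) → P w' → P w) :
    ∀ w, G.Adj v w → P w := by
  -- Induction on the number of vertices of smaller slope `η / a`. The vertex `v` itself has slope
  -- `0 / 0 = 0`; this only affects the count and does no harm.
  have key : ∀ n : ℕ, ∀ w, G.Adj v w →
      {u | η (X u) / a (X u) < η (X w) / a (X w)}.ncard = n → P w := by
    intro n
    induction n using Nat.strong_induction_on with
    | _ n ih =>
      intro w hw hn
      by_cases hww : w = w₀
      · rwa [hww]
      set r := η (X w) / a (X w) with hr
      have haw := hapos w hw.ne'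
      have hwr : η (X w) = r * a (X w) := by rw [hr, div_mul_cancel₀ _ haw.ne']
      have hlt_iff : ∀ u, u ≠ v → (η (X u) / a (X u) < r ↔ (η - r • a) (X u) < 0) := by
        intro u hu
        rw [div_lt_iff₀ (hapos u hu)]
        simp
      have hle_iff : ∀ u, u ≠ v → (η (X u) / a (X u) ≤ r ↔ (η - r • a) (X u) ≤ 0) := by
        intro u hu
        rw [div_le_iff₀ (hapos u hu)]
        simp
      rcases (hmin w hw).lt_or_eq with hlt | heq
      · obtain ⟨φ₁, φ₂, hφ₁, hφ₂, h1v, h1w, h2v, h2w, hint, hall⟩ := h.pencil hw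
        obtain ⟨s, t, hst⟩ := hall (η - r • a) (by simp [hη, hav]) (by simp [hwr])
        have hneg := (hlt_iff w₀ hw₀.ne').1 hlt
        -- In the pencil of the edge, `η - r • a` is `s • φ₁ + t • φ₂`, and its negative value at
        -- `w₀` makes `s` or `t` negative. On the facet where the other term vanishes, it is
        -- negative off the edge, so the other neighbour of `v` there has smaller slope.
        obtain ⟨φ, hφ, hφv, hφw, hφneg⟩ : ∃ φ : Dual ℝ W, IsFacetFun X φ ∧ φ (X v) = 0 ∧
            φ (X w) = 0 ∧ ∀ u, φ (X u) = 0 → u ≠ v → u ≠ w → (η - r • a) (X u) < 0 := by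
          rw [hst] at hneg ⊢
          simp only [LinearMap.add_apply, LinearMap.smul_apply, smul_eq_mul] at hneg ⊢
          by_cases hs : s < 0
          · refine ⟨φ₂, hφ₂, h2v, h2w, fun u hu huv huw => ?_⟩
            rw [hu, mul_zero, add_zero]
            refine mul_neg_of_neg_of_pos hs (lt_of_le_of_ne (hφ₁.nonneg u) fun h0 => ?_)
            exact (hint u h0.symm hu).elim huv huw
          · have ht : t < 0 := by
              by_contra hc
              have := mul_nonneg (not_lt.1 hs) (hφ₁.nonneg w₀)
              have := mul_nonneg (not_lt.1 hc) (hφ₂.nonneg w₀)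
              linarith
            refine ⟨φ₁, hφ₁, h1v, h1w, fun u hu huv huw => ?_⟩
            rw [hu, mul_zero, zero_add]
            refine mul_neg_of_neg_of_pos ht (lt_of_le_of_ne (hφ₂.nonneg u) fun h0 => ?_)
            exact (hint u hu h0.symm).elim huv huw
        obtain ⟨p, q, hpq, hp, hq, hφp, hφq, -⟩ := h.polygon hφ hφv
        obtain ⟨w', hw', hφw', hne⟩ : ∃ w', G.Adj v w' ∧ φ (X w') = 0 ∧ w' ≠ w := by
          by_cases hpw : p = w
          · exact ⟨q, hq, hφq, fun hh => hpq (hpw.trans hh.symm)⟩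
          · exact ⟨p, hp, hφp, hpw⟩
        have hlt' := (hlt_iff w' hw'.ne').2 (hφneg w' hφw' hw'.ne' hne)
        refine hstep w w' {u | φ (X u) = 0} hw hw' hne.symm ⟨φ, hφ, rfl⟩ hφv hφw hφw' ?_
          (ih _ ?_ w' hw' rfl)
        · intro u hu huv
          by_cases huw : u = w
          · rw [huw]
          · exact ((hlt_iff u huv).2 (hφneg u hu huv huw)).le
        · rw [← hn]
          refine Set.ncard_lt_ncard ⟨fun u hu => lt_trans hu hlt', fun hsub => ?_⟩ (Set.toFinite _)
          exact lt_irrefl (η (X w') / a (X w')) (hsub hlt')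
      -- If `w` ties with `w₀`, the simplex step shows that `η - r • a` is nonnegative, so it is
      -- itself a facet functional through `v`, `w` and `w₀`.
      · have hnn : ∀ u, 0 ≤ (η - r • a) (X u) := by
          by_contra! hc
          obtain ⟨u, hu⟩ := hc
          obtain ⟨z, hz, hzpos⟩ := h.exists_adj_pos (v := v) (η := -(η - r • a))
            (by simp [hη, hav]) ⟨u, by simpa using hu⟩
          have h1 := hmin z hz
          rw [heq] at h1
          have h2 := (hlt_iff z hz.ne').2 (by simpa using hzpos)
          exact absurd h1 (not_le.2 h2)
        have hz0 : (η - r • a) (X w₀) = 0 :=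
          le_antisymm ((hle_iff w₀ hw₀.ne').1 heq.le) (hnn w₀)
        have hφ : IsFacetFun X (η - r • a) := ⟨fun h0 => hne r (sub_eq_zero.1 h0), hnn, v, w, w₀,
          hw.ne, hw₀.ne, hww, by simp [hη, hav], by simp [hwr], hz0⟩
        refine hstep w w₀ _ hw hw₀ hww ⟨_, hφ, rfl⟩ (by simp [hη, hav]) (by simp [hwr]) hz0 ?_ h0
        intro u hu huv
        exact (hle_iff u huv).2 (le_of_eq hu)
  exact fun w hw => key _ w hw rfl

/-- A point of the plane of a facet that violates an inequality satisfied by the facet is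
separated from it by one of the adjacent facets. -/
theorem exists_adjacent_facet_neg (h : IsConeConfig G X) {φ : Dual ℝ W} (hφ : IsFacetFun X φ)
    {Z : W} (hZ : φ Z = 0) {ψ₀ : Dual ℝ W} (hψ₀ : ∀ v, φ (X v) = 0 → 0 ≤ ψ₀ (X v))
    (hψ₀Z : ψ₀ Z < 0) :
    ∃ φ' : Dual ℝ W, IsFacetFun X φ' ∧ φ' Z < 0 ∧
      ∃ u v, G.Adj u v ∧ φ (X u) = 0 ∧ φ (X v) = 0 ∧ φ' (X u) = 0 ∧ φ' (X v) = 0 := by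
  -- Among the functionals nonnegative on the facet and negative at `Z`, one with a maximal zero set
  -- on the facet is taken; its zeros turn out to be the ends of an edge.
  let F : Set (Set V) := {T | ∃ ψ : Dual ℝ W, (∀ v, φ (X v) = 0 → 0 ≤ ψ (X v)) ∧ ψ Z < 0 ∧
    T = {v | φ (X v) = 0 ∧ ψ (X v) = 0}}
  obtain ⟨T, ⟨ψ, hψ, hψZ, rfl⟩, hmax⟩ := (Set.toFinite F).exists_maximal ⟨_, ψ₀, hψ₀, hψ₀Z, rfl⟩
  -- Otherwise `ψ + c • η`, with the first `c` creating a new zero on the facet, has the same value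
  -- at `Z` and contradicts maximality. Applied to `η` and `-η`, this makes `η` vanish on the facet.
  have hneg : ∀ η : Dual ℝ W, η Z = 0 → (∀ v, φ (X v) = 0 → ψ (X v) = 0 → η (X v) = 0) →
      ∀ v, φ (X v) = 0 → 0 ≤ η (X v) := by
    intro η hηZ hη v hv
    by_contra! hlt
    let ι := {v // φ (X v) = 0 ∧ η (X v) < 0}
    have : Nonempty ι := ⟨⟨v, hv, hlt⟩⟩
    obtain ⟨⟨m, hmφ, hmη⟩, hm⟩ := Finite.exists_min (fun v : ι => ψ (X v.1) / -η (X v.1))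
    set c := ψ (X m) / -η (X m) with hc
    have hc0 : 0 ≤ c := div_nonneg (hψ m hmφ) (by linarith)
    have hmem : {v | φ (X v) = 0 ∧ (ψ + c • η) (X v) = 0} ∈ F := by
      refine ⟨ψ + c • η, fun z hz => ?_, by simpa [hηZ] using hψZ, rfl⟩
      simp only [LinearMap.add_apply, LinearMap.smul_apply, smul_eq_mul]
      by_cases hzη : η (X z) < 0
      · have h1 := (le_div_iff₀ (by linarith)).1 (hm ⟨z, hz, hzη⟩)
        simp only at h1
        linarith
      · have := mul_nonneg hc0 (not_lt.1 hzη)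
        have := hψ z hz
        linarith
    have hsub := hmax hmem (fun z hz => ⟨hz.1, by simp [hz.2, hη z hz.1 hz.2]⟩)
    have hmz : (ψ + c • η) (X m) = 0 := by
      simp only [LinearMap.add_apply, LinearMap.smul_apply, smul_eq_mul, hc]
      have hd := hmη.ne
      field_simp
      ring
    exact hmη.ne (hη m hmφ (hsub ⟨hmφ, hmz⟩).2)
  have hzero : ∀ η : Dual ℝ W, η Z = 0 → (∀ v, φ (X v) = 0 → ψ (X v) = 0 → η (X v) = 0) →
      ∀ v, φ (X v) = 0 → η (X v) = 0 := by
    intro η hηZ hη v hv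
    have h1 := hneg η hηZ hη v hv
    have h2 := hneg (-η) (by simp [hηZ]) (fun z hz hz' => by simp [hη z hz hz']) v hv
    simp at h2
    exact le_antisymm h2 h1
  obtain ⟨p, q, r, hpq, hpr, hqr, hp, hq, hr⟩ := hφ.three
  -- With no zero other than `u`, all vectors of the facet would lie in the span of `X u` and `Z`,
  -- which is too small for three independent vectors.
  have hsome : ∀ u, ∃ z, φ (X z) = 0 ∧ ψ (X z) = 0 ∧ z ≠ u := by
    intro u
    by_contra! hc
    have key : ∀ z, φ (X z) = 0 → X z ∈ Submodule.span ℝ {X u, Z} := by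
      intro z hz
      by_contra hnot
      obtain ⟨η, hη, hker⟩ := Submodule.exists_le_ker_of_notMem hnot
      refine hη (hzero η (hker (Submodule.subset_span (by simp))) (fun w hw hw' => ?_) z hz)
      rw [hc w hw hw']
      exact hker (Submodule.subset_span (by simp))
    rcases h.span_pair_of_three hpq hpr hqr (X u) Z with h0 | h0 | h0
    · exact h0 (key p hp)
    · exact h0 (key q hq)
    · exact h0 (key r hr)
  obtain ⟨u, hu, hu', -⟩ := hsome p
  obtain ⟨v, hv, hv', hvu⟩ := hsome u
  have hpos : ∀ w, φ (X w) = 0 → w ≠ u → w ≠ v → 0 < ψ (X w) := by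
    intro w hw hwu hwv
    refine lt_of_le_of_ne (hψ w hw) fun h0 => ?_
    obtain ⟨c, hc⟩ := h.exists_smul_of_three hvu.symm hwu.symm hwv.symm hφ.ne_zero hu hv hw hu' hv'
      h0.symm
    rw [hc] at hψZ
    simp [hZ] at hψZ
  have hadj := h.adj_of_pos_on_face hφ.nonneg hu hv hvu.symm hu' hv' hpos
  obtain ⟨φ₁, φ₂, hφ₁, hφ₂, h1u, h1v, h2u, h2v, hint, hall⟩ := h.pencil hadj
  obtain ⟨s, t, hst⟩ := hall φ hu hv
  obtain ⟨s', t', hst'⟩ := hall ψ hu' hv'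
  by_cases h1Z : φ₁ Z < 0
  · exact ⟨φ₁, hφ₁, h1Z, u, v, hadj, hu, hv, h1u, h1v⟩
  by_cases h2Z : φ₂ Z < 0
  · exact ⟨φ₂, hφ₂, h2Z, u, v, hadj, hu, hv, h2u, h2v⟩
  -- The coefficients of `φ` are nonnegative and not both zero. If both `φ₁` and `φ₂` were
  -- nonnegative at `Z`, the one with nonzero coefficient would vanish at `w` and at `Z`; then `ψ`
  -- acts at these points as a multiple of the other one, with positive factor by its value at `w`,
  -- against `ψ Z < 0`.
  exfalso
  obtain ⟨w, hw, hwu, hwv⟩ := hφ.exists_third u v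
  have hψw := hpos w hw hwu hwv
  have hpos' : ∀ z, z ≠ u → z ≠ v → φ₁ (X z) = 0 → 0 < φ₂ (X z) := fun z hzu hzv hz =>
    lt_of_le_of_ne (hφ₂.nonneg z) fun h0 => (hint z hz h0.symm).elim hzu hzv
  obtain ⟨z₁, h1z, hz1u, hz1v⟩ := hφ₁.exists_third u v
  obtain ⟨z₂, h2z, hz2u, hz2v⟩ := hφ₂.exists_third u v
  have p1 := hpos' z₁ hz1u hz1v h1z
  have p2 : 0 < φ₁ (X z₂) := lt_of_le_of_ne (hφ₁.nonneg z₂) fun h0 =>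
    (hint z₂ h0.symm h2z).elim hz2u hz2v
  have ht : 0 ≤ t := by
    have := hφ.nonneg z₁
    rw [hst] at this
    simp only [LinearMap.add_apply, LinearMap.smul_apply, smul_eq_mul, h1z, mul_zero,
      zero_add] at this
    exact nonneg_of_mul_nonneg_left this p1
  have hs : 0 ≤ s := by
    have := hφ.nonneg z₂
    rw [hst] at this
    simp only [LinearMap.add_apply, LinearMap.smul_apply, smul_eq_mul, h2z, mul_zero,
      add_zero] at this
    exact nonneg_of_mul_nonneg_left this p2
  have n1 := hφ₁.nonneg w
  have n2 := hφ₂.nonneg w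
  rw [hst] at hZ hw
  rw [hst'] at hψw hψZ
  simp only [LinearMap.add_apply, LinearMap.smul_apply, smul_eq_mul] at hZ hw hψw hψZ
  have hst0 : s ≠ 0 ∨ t ≠ 0 := by
    by_contra! hc
    exact hφ.ne_zero (by rw [hst, hc.1, hc.2]; simp)
  have a1 := mul_nonneg hs n1
  have a2 := mul_nonneg ht n2
  have b1 := mul_nonneg hs (not_lt.1 h1Z)
  have b2 := mul_nonneg ht (not_lt.1 h2Z)
  have a1' : s * φ₁ (X w) = 0 := by linarith
  have a2' : t * φ₂ (X w) = 0 := by linarith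
  have b1' : s * φ₁ Z = 0 := by linarith
  have b2' : t * φ₂ Z = 0 := by linarith
  rcases hst0 with h0 | h0
  · have c1 := (mul_eq_zero.1 a1').resolve_left h0
    have c2 := (mul_eq_zero.1 b1').resolve_left h0
    rw [c1, mul_zero, zero_add] at hψw
    rw [c2, mul_zero, zero_add] at hψZ
    have := pos_of_mul_pos_left hψw n2
    have := mul_nonneg this.le (not_lt.1 h2Z)
    linarith
  · have c1 := (mul_eq_zero.1 a2').resolve_left h0
    have c2 := (mul_eq_zero.1 b2').resolve_left h0
    rw [c1, mul_zero, add_zero] at hψw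
    rw [c2, mul_zero, add_zero] at hψZ
    have := pos_of_mul_pos_left hψw n1
    have := mul_nonneg this.le (not_lt.1 h1Z)
    linarith

/-- The facets that avoid a vertex are connected through their common edges. -/
theorem facet_connected (h : IsConeConfig G X) (v₀ : V) {P : Set V → Prop}
    (hP : ∀ S T, IsFacet X S → IsFacet X T → v₀ ∉ S → v₀ ∉ T →
      (∃ u v, G.Adj u v ∧ u ∈ S ∧ v ∈ S ∧ u ∈ T ∧ v ∈ T) → (P S ↔ P T))
    {S₀ : Set V} (hS₀ : IsFacet X S₀) (hv₀ : v₀ ∉ S₀) (h0 : P S₀) :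
    ∀ S, IsFacet X S → v₀ ∉ S → P S := by
  have := h.finiteDimensional
  have := Fintype.ofFinite V
  -- Facet functionals normalized to be one at the interior vector `O` are the vertices of the polar
  -- polytope. Those avoiding `v₀` have positive value at `X v₀`, so they form an upper set for this
  -- evaluation, and the ascending argument applies to them.
  let O : W := ∑ v, X v
  have hO : ∀ φ : Dual ℝ W, IsFacetFun X φ → 0 < φ O := by
    intro φ hφ
    obtain ⟨v, hv⟩ := h.exists_ne_zero hφ.ne_zero
    simp only [O, map_sum]
    exact Finset.sum_pos' (fun i _ => hφ.nonneg i)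
      ⟨v, Finset.mem_univ v, lt_of_le_of_ne (hφ.nonneg v) hv.symm⟩
  let ι := {S : Set V // IsFacet X S}
  choose f hf hfS using fun S : ι => S.2
  have hmem : ∀ (S : ι) v, v ∈ S.1 ↔ f S (X v) = 0 := by
    intro S v
    conv_lhs => rw [hfS S]
    rfl
  let g : ι → Dual ℝ W := fun S => (f S O)⁻¹ • f S
  have hgO : ∀ S, g S O = 1 := fun S => by
    simp only [g, LinearMap.smul_apply, smul_eq_mul]
    exact inv_mul_cancel₀ (hO _ (hf S)).ne'
  have hg0 : ∀ S v, 0 ≤ g S (X v) := fun S v =>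
    mul_nonneg (inv_nonneg.2 (hO _ (hf S)).le) ((hf S).nonneg v)
  have hgz : ∀ (S : ι) Z, g S Z = 0 ↔ f S Z = 0 := fun S Z => by
    simp [g, (hO _ (hf S)).ne']
  have hginj : ∀ S T, g S = g T → S = T := by
    intro S T hST
    apply Subtype.ext
    ext v
    rw [hmem, hmem, ← hgz, ← hgz, hST]
  -- A generic direction `R` breaks the ties between facets with equal value at `X v₀`.
  obtain ⟨R, hR⟩ := Module.Dual.exists_forall_ne_zero_of_forall_exists
    (fun p : {p : ι × ι // p.1 ≠ p.2} => g p.1.1 - g p.1.2) (by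
      intro p
      by_contra! hc
      exact p.2 (hginj _ _ (sub_eq_zero.1 (LinearMap.ext hc))))
  obtain ⟨ε, -, hinj, hlt⟩ := exists_injective_perturbation (fun S => g S (X v₀)) (fun S => g S R)
    (by
      intro S T hST
      by_contra hne
      exact hR ⟨(S, T), hne⟩ (by simpa [sub_eq_zero] using hST))
  set Z := X v₀ + ε • R with hZ
  have hr : ∀ S, g S (X v₀) + ε * g S R = g S Z := by simp [hZ]
  simp only [hr] at hinj hlt
  have hunique : ∀ (φ : Dual ℝ W) (hφ : IsFacetFun X φ) (Y : W),
      g ⟨_, φ, hφ, rfl⟩ Y = (φ O)⁻¹ * φ Y := by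
    intro φ hφ Y
    set S : ι := ⟨_, φ, hφ, rfl⟩
    obtain ⟨a, b, c, hab, hac, hbc, ha, hb, hc⟩ := hφ.three
    obtain ⟨k, hk⟩ := h.exists_smul_of_three hab hac hbc hφ.ne_zero ha hb hc
      ((hgz S _).2 ((hmem S a).1 ha)) ((hgz S _).2 ((hmem S b).1 hb))
      ((hgz S _).2 ((hmem S c).1 hc))
    have h1 := hgO S
    rw [hk] at h1 ⊢
    simp only [LinearMap.smul_apply, smul_eq_mul] at h1 ⊢
    rw [eq_inv_of_mul_eq_one_left h1]
  let U : Set ι := {S | v₀ ∉ S.1}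
  have hU : ∀ S ∈ U, ∀ T, g S Z < g T Z → T ∈ U := by
    intro S hS T hST hT
    have hT0 : g T (X v₀) = 0 := (hgz T _).2 ((hmem T v₀).1 hT)
    have hS0 : 0 < g S (X v₀) := lt_of_le_of_ne (hg0 S v₀) fun h0 =>
      hS ((hmem S v₀).2 ((hgz S _).1 h0.symm))
    exact lt_asymm hST (hlt T S (by rwa [hT0]))
  have hmain := subset_of_ascending
    (fun S T : ι => ∃ u v, G.Adj u v ∧ u ∈ S.1 ∧ v ∈ S.1 ∧ u ∈ T.1 ∧ v ∈ T.1)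
    (fun S => g S Z) hinj ?_ (U := U) (A := {S | v₀ ∉ S.1 ∧ P S.1}) hU (fun S hS => hS.1)
    ⟨⟨S₀, hS₀⟩, hv₀, h0⟩ ?_
  · intro S hS hvS
    exact (hmain (show (⟨S, hS⟩ : ι) ∈ U from hvS)).2
  · intro S T hST
    -- The vector `g S Z • O - Z` lies in the plane of `S`, and a normalized facet functional is
    -- negative there exactly when its value at `Z` exceeds that of `S`. The separating adjacent
    -- facet is thus a higher neighbour.
    obtain ⟨φ', hφ', hneg, u, v, huv, hu, hv, hu', hv'⟩ := h.exists_adjacent_facet_neg (hf S)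
      (Z := g S Z • O - Z) (ψ₀ := g T) (by
        rw [← hgz]
        simp [hgO]) (fun v _ => hg0 T v) (by simpa [hgO] using hST)
    refine ⟨⟨_, φ', hφ', rfl⟩, ⟨u, v, huv, (hmem S u).2 hu, (hmem S v).2 hv, hu', hv'⟩, ?_⟩
    rw [hunique φ' hφ', lt_inv_mul_iff₀ (hO _ hφ')]
    simp only [map_sub, map_smul, smul_eq_mul] at hneg
    linarith
  · intro S hS T hT hST
    have := hP S.1 T.1 S.2 T.2 hS hT hST
    exact ⟨fun hh => ⟨hT, this.1 hh.2⟩, fun hh => ⟨hS, this.2 hh.2⟩⟩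

end IsConeConfig

/-! ### Facet boundaries and the mod 2 cycle space -/

namespace IsConeConfig

variable {V W : Type*} [AddCommGroup W] [Module ℝ W] {G : SimpleGraph V} {X : V → W} [Finite V]

/-- A facet functional through the edge is `s • φ₁ + t • φ₂`. Third vertices of the two known facets
give `s, t ≥ 0`, and a third zero of its own forces one coefficient to vanish. -/
theorem exists_two_facets (h : IsConeConfig G X) {u v : V} (huv : G.Adj u v) :
    ∃ S T, IsFacet X S ∧ IsFacet X T ∧ S ≠ T ∧ u ∈ S ∧ v ∈ S ∧ u ∈ T ∧ v ∈ T ∧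
      ∀ R, IsFacet X R → u ∈ R → v ∈ R → R = S ∨ R = T := by
  obtain ⟨φ₁, φ₂, hφ₁, hφ₂, h1u, h1v, h2u, h2v, hint, hall⟩ := h.pencil huv
  obtain ⟨z₁, h1z, hz1u, hz1v⟩ := hφ₁.exists_third u v
  obtain ⟨z₂, h2z, hz2u, hz2v⟩ := hφ₂.exists_third u v
  have p1 : 0 < φ₂ (X z₁) := lt_of_le_of_ne (hφ₂.nonneg z₁) fun h0 =>
    (hint z₁ h1z h0.symm).elim hz1u hz1v
  have p2 : 0 < φ₁ (X z₂) := lt_of_le_of_ne (hφ₁.nonneg z₂) fun h0 =>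
    (hint z₂ h0.symm h2z).elim hz2u hz2v
  refine ⟨_, _, ⟨φ₁, hφ₁, rfl⟩, ⟨φ₂, hφ₂, rfl⟩, ?_, h1u, h1v, h2u, h2v, ?_⟩
  · intro heq
    have : z₁ ∈ {v | φ₂ (X v) = 0} := heq ▸ h1z
    exact p1.ne' this
  · rintro _ ⟨φ, hφ, rfl⟩ hu hv
    obtain ⟨s, t, hst⟩ := hall φ hu hv
    have ht : 0 ≤ t := by
      have := hφ.nonneg z₁
      rw [hst] at this
      simp only [LinearMap.add_apply, LinearMap.smul_apply, smul_eq_mul, h1z, mul_zero,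
        zero_add] at this
      exact nonneg_of_mul_nonneg_left this p1
    have hs : 0 ≤ s := by
      have := hφ.nonneg z₂
      rw [hst] at this
      simp only [LinearMap.add_apply, LinearMap.smul_apply, smul_eq_mul, h2z, mul_zero,
        add_zero] at this
      exact nonneg_of_mul_nonneg_left this p2
    obtain ⟨w, hw, hwu, hwv⟩ := hφ.exists_third u v
    rw [hst] at hw
    simp only [LinearMap.add_apply, LinearMap.smul_apply, smul_eq_mul] at hw
    have a1 := mul_nonneg hs (hφ₁.nonneg w)
    have a2 := mul_nonneg ht (hφ₂.nonneg w)
    have b1 : s * φ₁ (X w) = 0 := by linarith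
    have b2 : t * φ₂ (X w) = 0 := by linarith
    by_cases hs0 : s = 0
    · right
      have ht0 : t ≠ 0 := by
        rintro rfl
        exact hφ.ne_zero (by rw [hst, hs0]; simp)
      ext z
      simp [hst, hs0, ht0]
    · left
      have c1 := (mul_eq_zero.1 b1).resolve_left hs0
      have ht0 : t = 0 := (mul_eq_zero.1 b2).resolve_right fun c2 =>
        (hint w c1 c2).elim hwu hwv
      ext z
      simp [hst, hs0, ht0]

theorem exists_two_adj_in_facet (h : IsConeConfig G X) {S : Set V} (hS : IsFacet X S) {v : V}
    (hv : v ∈ S) : ∃ a b, a ≠ b ∧ G.Adj v a ∧ G.Adj v b ∧ a ∈ S ∧ b ∈ S ∧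
      ∀ w, G.Adj v w → w ∈ S → w = a ∨ w = b := by
  obtain ⟨φ, hφ, rfl⟩ := hS
  obtain ⟨a, b, hab, ha, hb, hφa, hφb, hall, -⟩ := h.polygon hφ hv
  exact ⟨a, b, hab, ha, hb, hφa, hφb, hall⟩

end IsConeConfig

section CycleSpace

open Classical

variable {V W : Type*} [AddCommGroup W] [Module ℝ W] [Fintype V]

/-- The mod 2 boundary of a set of facets, as a function on the darts of the graph. -/
noncomputable def facetBoundary (G : SimpleGraph V) (X : V → W) (A : Set V → ZMod 2)
    (u v : V) : ZMod 2 :=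
  ∑ S : Set V, if G.Adj u v ∧ IsFacet X S ∧ u ∈ S ∧ v ∈ S then A S else 0

/-- A mod 2 cycle of the graph, as a symmetric function on its darts. -/
structure IsGraphCycle (G : SimpleGraph V) (c : V → V → ZMod 2) : Prop where
  symm : ∀ u v, c u v = c v u
  supp : ∀ u v, ¬ G.Adj u v → c u v = 0
  sum_eq_zero : ∀ u, ∑ v, c u v = 0

variable {G : SimpleGraph V} {X : V → W}

theorem facetBoundary_add (A B : Set V → ZMod 2) (u v : V) :
    facetBoundary G X (A + B) u v = facetBoundary G X A u v + facetBoundary G X B u v := by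
  simp only [facetBoundary, ← Finset.sum_add_distrib]
  refine Finset.sum_congr rfl fun S _ => ?_
  split_ifs <;> simp

theorem facetBoundary_sum {ι : Type*} (s : Finset ι) (c : ι → ZMod 2) (A : ι → Set V → ZMod 2)
    (u v : V) : facetBoundary G X (fun S => ∑ i ∈ s, c i * A i S) u v =
      ∑ i ∈ s, c i * facetBoundary G X (A i) u v := by
  simp only [facetBoundary, Finset.mul_sum]
  rw [Finset.sum_comm]
  refine Finset.sum_congr rfl fun S _ => ?_
  split_ifs <;> simp

theorem facetBoundary_eq_zero_of_not_adj {u v : V} (huv : ¬ G.Adj u v) (A : Set V → ZMod 2) :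
    facetBoundary G X A u v = 0 := by
  simp [facetBoundary, huv]

theorem facetBoundary_single {S : Set V} (hS : IsFacet X S) (u v : V) :
    facetBoundary G X (Pi.single S 1) u v = if G.Adj u v ∧ u ∈ S ∧ v ∈ S then 1 else 0 := by
  rw [facetBoundary, Finset.sum_eq_single S]
  · simp [hS]
  · intro T _ hT
    simp [hT]
  · simp

theorem IsGraphCycle.add {c d : V → V → ZMod 2} (hc : IsGraphCycle G c) (hd : IsGraphCycle G d) :
    IsGraphCycle G (c + d) where
  symm u v := by simp [hc.symm u v, hd.symm u v]
  supp u v huv := by simp [hc.supp u v huv, hd.supp u v huv]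
  sum_eq_zero u := by simp [Finset.sum_add_distrib, hc.sum_eq_zero, hd.sum_eq_zero]

namespace IsConeConfig

theorem sum_adj_in_facet (h : IsConeConfig G X) {S : Set V} (hS : IsFacet X S) (u : V)
    (x : ZMod 2) : (∑ v, if G.Adj u v ∧ u ∈ S ∧ v ∈ S then x else 0) = 0 := by
  by_cases hu : u ∈ S
  · obtain ⟨a, b, hab, ha, hb, haS, hbS, hall⟩ := h.exists_two_adj_in_facet hS hu
    have : (Finset.univ.filter fun v => G.Adj u v ∧ u ∈ S ∧ v ∈ S) = {a, b} := by
      ext v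
      simp only [Finset.mem_filter, Finset.mem_univ, true_and, Finset.mem_insert,
        Finset.mem_singleton]
      constructor
      · rintro ⟨h1, -, h2⟩
        exact hall v h1 h2
      · rintro (rfl | rfl)
        · exact ⟨ha, hu, haS⟩
        · exact ⟨hb, hu, hbS⟩
    rw [← Finset.sum_filter, this, Finset.sum_pair hab]
    exact CharTwo.add_self_eq_zero x
  · simp [hu]

theorem isGraphCycle_facetBoundary (h : IsConeConfig G X) (A : Set V → ZMod 2) :
    IsGraphCycle G (facetBoundary G X A) where
  symm u v := by
    simp only [facetBoundary]
    refine Finset.sum_congr rfl fun S _ => ?_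
    simp only [G.adj_comm u v, and_comm (a := u ∈ S)]
  supp u v huv := facetBoundary_eq_zero_of_not_adj huv A
  sum_eq_zero u := by
    simp only [facetBoundary]
    rw [Finset.sum_comm]
    refine Finset.sum_eq_zero fun S _ => ?_
    by_cases hS : IsFacet X S
    · simpa [hS] using h.sum_adj_in_facet hS u (A S)
    · simp [hS]

theorem facetBoundary_apply (h : IsConeConfig G X) {u v : V} (huv : G.Adj u v)
    (A : Set V → ZMod 2) {S T : Set V} (hS : IsFacet X S) (hT : IsFacet X T) (hST : S ≠ T)
    (huS : u ∈ S) (hvS : v ∈ S) (huT : u ∈ T) (hvT : v ∈ T) :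
    facetBoundary G X A u v = A S + A T := by
  obtain ⟨S', T', -, -, -, -, -, -, -, hall⟩ := h.exists_two_facets huv
  have hST' : ∀ R, IsFacet X R → u ∈ R → v ∈ R → R = S ∨ R = T := by
    intro R hR hu hv
    have h1 := hall R hR hu hv
    have h2 := hall S hS huS hvS
    have h3 := hall T hT huT hvT
    grind
  have : (Finset.univ.filter fun R => G.Adj u v ∧ IsFacet X R ∧ u ∈ R ∧ v ∈ R) = {S, T} := by
    ext R
    simp only [Finset.mem_filter, Finset.mem_univ, true_and, Finset.mem_insert,
      Finset.mem_singleton]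
    constructor
    · rintro ⟨-, h1, h2, h3⟩
      exact hST' R h1 h2 h3
    · rintro (rfl | rfl)
      · exact ⟨huv, hS, huS, hvS⟩
      · exact ⟨huv, hT, huT, hvT⟩
  rw [facetBoundary, ← Finset.sum_filter, this, Finset.sum_pair hST]

/-- The chain `B` consists of the facets around `v` passed by the link induction from `w₀` to `w`.
Slopes along the way stay below that of `w`, hence negative, so `B` can modify a cycle at `v`
without reaching vertices where `η` is positive. -/
theorem exists_chain (h : IsConeConfig G X) {v w₀ : V} {a η : Dual ℝ W} (hav : a (X v) = 0)
    (hapos : ∀ u, u ≠ v → 0 < a (X u)) (hη : η (X v) = 0)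
    (hne : ∀ r : ℝ, η ≠ r • a) (hw₀ : G.Adj v w₀)
    (hmin : ∀ w, G.Adj v w → η (X w₀) / a (X w₀) ≤ η (X w) / a (X w)) :
    ∀ w, G.Adj v w → η (X w) < 0 → ∃ B : Set V → ZMod 2,
      (∀ S, B S ≠ 0 → ∀ u ∈ S, η (X u) ≤ 0) ∧ ∀ z, G.Adj v z →
        facetBoundary G X B v z = (if z = w then 1 else 0) + if z = w₀ then 1 else 0 := by
  refine h.link_induction hav hapos hη hne hw₀ hmin ?_ ?_
  · intro _
    refine ⟨0, by simp, fun z _ => ?_⟩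
    rw [CharTwo.add_self_eq_zero]
    simp [facetBoundary]
  · intro w w' S hw hw' hww hS hvS hwS hw'S hle ih hneg
    have hSneg : ∀ u ∈ S, u ≠ v → η (X u) < 0 := by
      intro u hu huv
      have h1 := hle u hu huv
      have h2 := div_neg_of_neg_of_pos hneg (hapos w hw.ne')
      by_contra hc
      have h3 := div_nonneg (not_lt.1 hc) (hapos u huv).le
      linarith
    obtain ⟨B, hB, hBz⟩ := ih (hSneg w' hw'S hw'.ne')
    refine ⟨B + Pi.single S 1, fun T hT u hu => ?_, fun z hz => ?_⟩
    · by_cases hTS : T = S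
      · subst hTS
        by_cases huv : u = v
        · rw [huv, hη]
        · exact (hSneg u hu huv).le
      · exact hB T (by simpa [hTS] using hT) u hu
    · rw [facetBoundary_add, hBz z hz, facetBoundary_single hS]
      obtain ⟨p, q, hpq, hp, hq, hpS, hqS, hall⟩ := h.exists_two_adj_in_facet hS hvS
      have hww' : ∀ z, G.Adj v z → z ∈ S → z = w ∨ z = w' := by
        intro z hz hzS
        have h1 := hall z hz hzS
        have h2 := hall w hw hwS
        have h3 := hall w' hw' hw'S
        grind
      have hif : (if G.Adj v z ∧ v ∈ S ∧ z ∈ S then (1 : ZMod 2) else 0) =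
          (if z = w then 1 else 0) + if z = w' then 1 else 0 := by
        by_cases hzw : z = w
        · subst hzw
          simp [hz, hvS, hwS, hww]
        · by_cases hzw' : z = w'
          · subst hzw'
            simp [hz, hvS, hw'S, hzw]
          · have : z ∉ S := fun hzS => (hww' z hz hzS).elim hzw hzw'
            simp [this, hzw, hzw']
      rw [hif]
      have := CharTwo.add_self_eq_zero (if z = w' then (1 : ZMod 2) else 0)
      linear_combination this

/-- The facets generate the mod 2 cycle space of the graph. -/
theorem exists_eq_facetBoundary (h : IsConeConfig G X) {c : V → V → ZMod 2}
    (hc : IsGraphCycle G c) : ∃ A : Set V → ZMod 2, ∀ u v, c u v = facetBoundary G X A u v := by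
  obtain ⟨η, hinj, -⟩ := h.exists_injective_refinement 0
  obtain ⟨τ, hτ⟩ := h.height
  -- Induction on the number of vertices not above the highest vertex of the cycle.
  generalize hn : {u | ∃ v w, c v w ≠ 0 ∧ η (X u) ≤ η (X v)}.ncard = n
  induction n using Nat.strong_induction_on generalizing c with
  | _ n ih =>
    by_cases hzero : ∀ v w, c v w = 0
    · exact ⟨0, fun u v => by simp [hzero, facetBoundary]⟩
    push Not at hzero
    obtain ⟨v, ⟨w₁, hw₁⟩, hvmax⟩ := Set.exists_max_image {v | ∃ w, c v w ≠ 0} (fun v => η (X v))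
      (Set.toFinite _) hzero
    have hlt : ∀ w, c v w ≠ 0 → G.Adj v w ∧ η (X w) < η (X v) := by
      intro w hw
      have hadj : G.Adj v w := by
        by_contra hc'
        exact hw (hc.supp v w hc')
      refine ⟨hadj, lt_of_le_of_ne (hvmax w ⟨v, by rwa [hc.symm]⟩) fun he => ?_⟩
      exact hadj.ne' (hinj he)
    set ξ := η - η (X v) • τ with hξ
    have hξapp : ∀ u, ξ (X u) = η (X u) - η (X v) := by simp [hξ, hτ]
    have hξ0 : ξ ≠ 0 := by
      intro h0
      have h1 := hξapp w₁
      rw [h0] at h1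
      have h2 := (hlt w₁ hw₁).2
      simp at h1
      linarith
    obtain ⟨a, hav, hapos, hne⟩ := h.exists_exposing_ne_smul (v := v) hξ0
    obtain ⟨w₀, hw₀, hmin⟩ := Set.exists_min_image {w | G.Adj v w} (fun w => ξ (X w) / a (X w))
      (Set.toFinite _) ⟨w₁, (hlt w₁ hw₁).1⟩
    have hchain := h.exists_chain hav hapos (by simp [hξapp]) hne hw₀ hmin
    have hex : ∀ w, ∃ B : Set V → ZMod 2, c v w ≠ 0 → (∀ S, B S ≠ 0 → ∀ u ∈ S, ξ (X u) ≤ 0) ∧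
        ∀ z, G.Adj v z →
          facetBoundary G X B v z = (if z = w then 1 else 0) + if z = w₀ then 1 else 0 := by
      intro w
      by_cases hw : c v w = 0
      · exact ⟨0, fun hc => absurd hw hc⟩
      · obtain ⟨B, hB⟩ := hchain w (hlt w hw).1 (by rw [hξapp]; linarith [(hlt w hw).2])
        exact ⟨B, fun _ => hB⟩
    choose B hB using hex
    -- Sum of the chains over the edges of the cycle at its top vertex `v`. The edge to `w₀` picks
    -- up the sum of `c` at `v`, which is zero, so the boundary of `A` agrees with `c` at `v`.
    -- Adding it pushes the cycle strictly below `v`.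
    let A : Set V → ZMod 2 := fun S => ∑ w, c v w * B w S
    have hA : ∀ S, A S ≠ 0 → ∀ u ∈ S, η (X u) ≤ η (X v) := by
      intro S hS u hu
      obtain ⟨w, -, hw⟩ := Finset.exists_ne_zero_of_sum_ne_zero hS
      have := (hB w (left_ne_zero_of_mul hw)).1 S (right_ne_zero_of_mul hw) u hu
      rw [hξapp] at this
      linarith
    have hAv : ∀ z, facetBoundary G X A v z = c v z := by
      intro z
      by_cases hz : G.Adj v z
      · rw [facetBoundary_sum]
        have : ∀ w, c v w * facetBoundary G X (B w) v z =
            (if z = w then c v w else 0) + c v w * (if z = w₀ then 1 else 0) := by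
          intro w
          by_cases hw : c v w = 0
          · simp [hw]
          · rw [(hB w hw).2 z hz, mul_add]
            simp
        simp only [this, Finset.sum_add_distrib, ← Finset.sum_mul, hc.sum_eq_zero]
        simp
      · rw [facetBoundary_eq_zero_of_not_adj hz, hc.supp v z hz]
    set c' := c + facetBoundary G X A with hc'
    have hcyc : IsGraphCycle G c' := hc.add (h.isGraphCycle_facetBoundary A)
    have hc'v : ∀ z, c' v z = 0 := by
      intro z
      simp only [hc', Pi.add_apply, hAv]
      exact CharTwo.add_self_eq_zero _
    have htouch : ∀ u w, c' u w ≠ 0 → η (X u) < η (X v) := by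
      intro u w hu
      have hle : η (X u) ≤ η (X v) := by
        by_cases hcu : c u w = 0
        · simp only [hc', Pi.add_apply, hcu, zero_add, facetBoundary] at hu
          obtain ⟨S, -, hS⟩ := Finset.exists_ne_zero_of_sum_ne_zero hu
          by_cases hcond : G.Adj u w ∧ IsFacet X S ∧ u ∈ S ∧ w ∈ S
          · rw [if_pos hcond] at hS
            exact hA S hS u hcond.2.2.1
          · rw [if_neg hcond] at hS
            exact absurd rfl hS
        · exact hvmax u ⟨w, hcu⟩
      refine lt_of_le_of_ne hle fun he => hu ?_
      rw [hinj he]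
      exact hc'v w
    obtain ⟨A', hA'⟩ := ih _ (by
      rw [← hn]
      refine Set.ncard_lt_ncard ⟨?_, fun hsub => ?_⟩ (Set.toFinite _)
      · rintro u ⟨x, w, hx, hux⟩
        exact ⟨v, w₁, hw₁, hux.trans (htouch x w hx).le⟩
      · obtain ⟨x, w, hx, hvx⟩ := hsub (show v ∈ _ from ⟨v, w₁, hw₁, le_rfl⟩)
        exact absurd (htouch x w hx) (not_lt.2 hvx)) hcyc rfl
    refine ⟨A' + A, fun u w => ?_⟩
    rw [facetBoundary_add, ← hA' u w]
    simp only [hc', Pi.add_apply]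
    have := CharTwo.add_self_eq_zero (facetBoundary G X A u w)
    linear_combination -this

end IsConeConfig

end CycleSpace

/-! ### The graph determines the facets -/

namespace IsConeConfig

variable {V W W' : Type*} [AddCommGroup W] [Module ℝ W] [AddCommGroup W'] [Module ℝ W']
  {G : SimpleGraph V} {X : V → W} {Y : V → W'} [Finite V]

theorem exists_adj (h : IsConeConfig G X) {u v : V} (huv : u ≠ v) : ∃ w, G.Adj u w := by
  obtain ⟨a, ha, hpos⟩ := h.exposed u
  obtain ⟨w, hw, -⟩ := h.exists_adj_pos ha ⟨v, hpos v huv.symm⟩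
  exact ⟨w, hw⟩

theorem exists_facet_of_vertex (h : IsConeConfig G X) {u v : V} (huv : u ≠ v) :
    ∃ S, IsFacet X S ∧ u ∈ S := by
  obtain ⟨w, hw⟩ := h.exists_adj huv
  obtain ⟨S, T, hS, -, -, hu, -⟩ := h.exists_two_facets hw
  exact ⟨S, hS, hu⟩

/-- Whitney: the facets are determined by the graph. -/
theorem isFacet_of_isFacet (hX : IsConeConfig G X) (hY : IsConeConfig G Y) {S : Set V}
    (hS : IsFacet X S) : IsFacet Y S := by
  classical
  have := Fintype.ofFinite V
  let c : V → V → ZMod 2 := fun u v => if G.Adj u v ∧ u ∈ S ∧ v ∈ S then 1 else 0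
  have hc : IsGraphCycle G c :=
    { symm := fun u v => by simp only [c, G.adj_comm u v, and_comm (a := u ∈ S)]
      supp := fun u v huv => by simp [c, huv]
      sum_eq_zero := fun u => hX.sum_adj_in_facet hS u 1 }
  obtain ⟨A, hA⟩ := hY.exists_eq_facetBoundary hc
  have hedge : ∀ u w, G.Adj u w → u ∉ S → ∀ T T', IsFacet Y T → IsFacet Y T' → u ∈ T → w ∈ T →
      u ∈ T' → w ∈ T' → A T = A T' := by
    intro u w huw hu T T' hT hT' huT hwT huT' hwT'
    by_cases hTT : T = T'
    · rw [hTT]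
    have h1 := hA u w
    rw [hY.facetBoundary_apply huw A hT hT' hTT huT hwT huT' hwT'] at h1
    simp only [c, hu, false_and, and_false, if_false] at h1
    exact CharTwo.add_eq_zero.1 h1.symm
  -- The cycle of `S` uses no edge at `u`, so `A` does not jump across edges at `u`; going round the
  -- link, it is constant on the facets at `u`.
  have hconst : ∀ u, u ∉ S → ∃ α, ∀ T, IsFacet Y T → u ∈ T → A T = α := by
    intro u hu
    obtain ⟨z, hz⟩ : ∃ z, z ≠ u := by
      obtain ⟨φ, hφ, rfl⟩ := hS
      obtain ⟨z, -, hz, -⟩ := hφ.exists_third u u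
      exact ⟨z, hz⟩
    obtain ⟨z', hz'z, hz'u⟩ := hY.exists_third hz
    obtain ⟨ξ, hξu, hξz, hξz'⟩ := hY.exists_sep hz.symm hz'u.symm hz'z.symm
    obtain ⟨a, hau, hapos, hne⟩ := hY.exists_exposing_ne_smul (v := u) (η := ξ)
      (by rintro rfl; simp at hξz')
    obtain ⟨w₀, hw₀, hmin⟩ := Set.exists_min_image {w | G.Adj u w} (fun w => ξ (Y w) / a (Y w))
      (Set.toFinite _) (hY.exists_adj hz.symm)
    obtain ⟨T₀, -, hT₀, -, -, huT₀, hwT₀, -⟩ := hY.exists_two_facets hw₀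
    have key := hY.link_induction hau hapos hξu hne hw₀ hmin
      (P := fun w => ∀ T, IsFacet Y T → u ∈ T → w ∈ T → A T = A T₀)
      (fun T hT hu' hw' => hedge u w₀ hw₀ hu T T₀ hT hT₀ hu' hw' huT₀ hwT₀)
      (fun w w' R hw hw' _ hR huR hwR hw'R _ ih T hT huT hwT =>
        (hedge u w hw hu T R hT hR huT hwT huR hwR).trans (ih R hR huR hw'R))
    refine ⟨A T₀, fun T hT huT => ?_⟩
    obtain ⟨p, -, -, hp, -, hpT, -⟩ := hY.exists_two_adj_in_facet hT huT
    exact key p hp T hT huT hpT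
  obtain ⟨φ, hφ, hφS⟩ := hS
  have hmem : ∀ v, v ∈ S ↔ φ (X v) = 0 := fun v => by rw [hφS]; rfl
  obtain ⟨u₁, hu₁⟩ := hX.exists_ne_zero hφ.ne_zero
  obtain ⟨α, hα⟩ := hconst u₁ (by rwa [hmem])
  -- The vertices off `S` are those where `φ` is positive, a connected set, so the constants at all
  -- of them agree.
  have hout := hX.subset_of_upper φ (U := {u | u ∉ S})
    (A := {u | u ∉ S ∧ ∀ T, IsFacet Y T → u ∈ T → A T = α}) (by
      intro u hu w huw hw
      rw [hmem] at hw
      refine hu ((hmem u).2 (le_antisymm (hw ▸ huw) (hφ.nonneg u)))) (fun u hu => hu.1)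
    ⟨u₁, by rwa [hmem], hα⟩ (by
      have key : ∀ u, u ∉ S → ∀ w, w ∉ S → G.Adj u w →
          (∀ T, IsFacet Y T → u ∈ T → A T = α) → ∀ T, IsFacet Y T → w ∈ T → A T = α := by
        intro u hu w hw huw hall T hT hwT
        obtain ⟨β, hβ⟩ := hconst w hw
        obtain ⟨R, -, hR, -, -, huR, hwR, -⟩ := hY.exists_two_facets huw
        rw [hβ T hT hwT, ← hβ R hR hwR, hall R hR huR]
      intro u hu w hw huw
      exact ⟨fun hh => ⟨hw, key u hu w hw huw hh.2⟩, fun hh => ⟨hu, key w hw u hu huw.symm hh.2⟩⟩)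
  have hS : IsFacet X S := ⟨φ, hφ, hφS⟩
  obtain ⟨v, -, -, -, -, -, hv, -⟩ := hφ.three
  rw [← hmem] at hv
  obtain ⟨p, -, -, hp, -, hpS, -⟩ := hX.exists_two_adj_in_facet hS hv
  obtain ⟨T₁, T₂, hT₁, hT₂, hT12, hv1, hp1, hv2, hp2, -⟩ := hY.exists_two_facets hp
  have hsum : (1 : ZMod 2) = A T₁ + A T₂ := by
    rw [← hY.facetBoundary_apply hp A hT₁ hT₂ hT12 hv1 hp1 hv2 hp2, ← hA]
    simp [c, hp, hv, hpS]
  -- An edge of `S` separates facets with different values of `A`. One of them differs from `α`, so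
  -- it has no vertex outside `S`.
  obtain ⟨T, hT, hTα⟩ : ∃ T, IsFacet Y T ∧ A T ≠ α := by
    by_cases h1 : A T₁ = α
    · refine ⟨T₂, hT₂, fun h2 => ?_⟩
      rw [h1, h2, CharTwo.add_self_eq_zero] at hsum
      exact one_ne_zero hsum
    · exact ⟨T₁, hT₁, h1⟩
  have hTS : T ⊆ S := by
    intro u huT
    by_contra hu
    exact hTα ((hout hu).2 T hT huT)
  -- At a vertex of `T`, its two neighbours in `T` are already its only two neighbours in `S`, so
  -- `T` is closed under adjacency in the connected set `S`.
  have hST := hX.subset_of_upper (-φ) (U := S) (A := T) (by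
      intro u hu w huw
      rw [hmem] at hu ⊢
      simp only [LinearMap.neg_apply, neg_le_neg_iff, hu] at huw
      exact le_antisymm huw (hφ.nonneg w)) hTS (by
      obtain ⟨ψ, hψ, rfl⟩ := hT
      obtain ⟨z, -, -, -, -, -, hz, -⟩ := hψ.three
      exact ⟨z, hz⟩) (by
      have key : ∀ u ∈ S, ∀ w ∈ S, G.Adj u w → u ∈ T → w ∈ T := by
        intro u hu w hw huw huT
        obtain ⟨a, b, hab, ha, hb, haT, hbT, -⟩ := hY.exists_two_adj_in_facet hT huT
        obtain ⟨a', b', -, -, -, -, -, hall⟩ := hX.exists_two_adj_in_facet hS hu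
        have e1 := hall a ha (hTS haT)
        have e2 := hall b hb (hTS hbT)
        have e3 := hall w huw hw
        have e4 : w = a ∨ w = b := by
          clear * - e1 e2 e3 hab
          grind
        rcases e4 with rfl | rfl <;> assumption
      intro u hu w hw huw
      exact ⟨key u hu w hw huw, key w hw u hu huw.symm⟩)
  rwa [Set.Subset.antisymm hST hTS]

end IsConeConfig

/-! ### Minkowski space and null vectors -/

/-- Minkowski space, with the time coordinate first. -/
abbrev Mink : Type := ℝ × E3

/-- The Minkowski form. -/
noncomputable def minkForm : Mink →ₗ[ℝ] Mink →ₗ[ℝ] ℝ :=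
  LinearMap.mk₂ ℝ (fun a b => inner ℝ a.2 b.2 - a.1 * b.1)
    (fun a b c => by simp only [Prod.snd_add, Prod.fst_add, inner_add_left]; ring)
    (fun r a b => by
      simp only [Prod.smul_snd, Prod.smul_fst, real_inner_smul_left, smul_eq_mul]; ring)
    (fun a b c => by simp only [Prod.snd_add, Prod.fst_add, inner_add_right]; ring)
    (fun r a b => by
      simp only [Prod.smul_snd, Prod.smul_fst, real_inner_smul_right, smul_eq_mul]; ring)

theorem minkForm_apply (a b : Mink) : minkForm a b = inner ℝ a.2 b.2 - a.1 * b.1 := rfl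

theorem minkForm_comm (a b : Mink) : minkForm a b = minkForm b a := by
  simp only [minkForm_apply, real_inner_comm, mul_comm]

/-- The vector of Minkowski space at height one above a Klein point. -/
def kleinLift (p : E3) : Mink := (1, p)

theorem minkForm_kleinLift (p q : E3) : minkForm (kleinLift p) (kleinLift q) = inner ℝ p q - 1 := by
  simp [minkForm_apply, kleinLift]

theorem minkForm_kleinLift_self {p : E3} (hp : ‖p‖ = 1) :
    minkForm (kleinLift p) (kleinLift p) = 0 := by
  rw [minkForm_kleinLift, real_inner_self_eq_norm_sq, hp]
  norm_num

theorem minkForm_kleinLift_neg {p q : E3} (hp : ‖p‖ = 1) (hq : ‖q‖ = 1) (hpq : p ≠ q) :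
    minkForm (kleinLift p) (kleinLift q) < 0 := by
  rw [minkForm_kleinLift, sub_neg]
  exact (inner_lt_one_iff_real_of_norm_eq_one hp hq).2 hpq

/-- Pairing a vector with its time reflection gives the Euclidean square norm. -/
theorem minkForm_injective : Function.Injective minkForm := by
  rw [← LinearMap.ker_eq_bot, LinearMap.ker_eq_bot']
  intro a ha
  have h1 : minkForm a (-a.1, a.2) = 0 := by rw [ha]; rfl
  rw [minkForm_apply] at h1
  simp only [real_inner_self_eq_norm_sq, mul_neg, sub_neg_eq_add] at h1
  have h2 : ‖a.2‖ = 0 := by nlinarith [sq_nonneg ‖a.2‖, mul_self_nonneg a.1]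
  have h3 : a.1 = 0 := by nlinarith [sq_nonneg ‖a.2‖, mul_self_nonneg a.1]
  exact Prod.ext h3 (norm_eq_zero.1 h2)

theorem exists_minkForm_eq (φ : Dual ℝ Mink) : ∃ N, minkForm N = φ :=
  (LinearMap.injective_iff_surjective_of_finrank_eq_finrank
    (Subspace.dual_finrank_eq (K := ℝ) (V := Mink)).symm).1 minkForm_injective φ

theorem finrank_mink : finrank ℝ Mink = 4 := by
  simp [Mink, E3]

/-- The orthogonal complement of a timelike vector is positive definite. -/
theorem minkForm_self_pos {T N : Mink} (hT : minkForm T T < 0) (hTN : minkForm T N = 0)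
    (hN : N ≠ 0) : 0 < minkForm N N := by
  obtain ⟨s, p⟩ := T
  obtain ⟨t, n⟩ := N
  simp only [minkForm_apply, real_inner_self_eq_norm_sq] at hT hTN ⊢
  have h1 := abs_real_inner_le_norm p n
  have h2 : inner ℝ p n = s * t := by linarith
  rw [h2, abs_mul] at h1
  have hps : ‖p‖ < |s| := by
    apply lt_of_pow_lt_pow_left₀ 2 (abs_nonneg s)
    rw [sq_abs]
    nlinarith
  have hs : 0 < |s| := (norm_nonneg p).trans_lt hps
  by_cases hn : ‖n‖ = 0
  · exfalso
    rw [hn, mul_zero] at h1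
    have h3 : |t| ≤ 0 := by
      by_contra hc
      nlinarith [mul_pos hs (not_le.1 hc)]
    exact hN (Prod.ext (abs_nonpos_iff.1 h3) (norm_eq_zero.1 hn))
  · have hn' : 0 < ‖n‖ := lt_of_le_of_ne (norm_nonneg n) (Ne.symm hn)
    have h3 : |s| * |t| < |s| * ‖n‖ := h1.trans_lt (mul_lt_mul_of_pos_right hps hn')
    have h4 : |t| < ‖n‖ := lt_of_mul_lt_mul_left h3 hs.le
    have h5 : |t| ^ 2 < ‖n‖ ^ 2 := pow_lt_pow_left₀ h4 (abs_nonneg t) two_ne_zero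
    rw [sq_abs] at h5
    nlinarith

/-- The Gram matrix has zero diagonal and negative off-diagonal entries `a`, `b`, `c`, hence
determinant `2abc ≠ 0`. -/
theorem linearIndependent_kleinLift {p q r : E3} (hp : ‖p‖ = 1) (hq : ‖q‖ = 1) (hr : ‖r‖ = 1)
    (hpq : p ≠ q) (hpr : p ≠ r) (hqr : q ≠ r) :
    LinearIndependent ℝ ![kleinLift p, kleinLift q, kleinLift r] := by
  have hpq' := minkForm_kleinLift_neg hp hq hpq
  have hpr' := minkForm_kleinLift_neg hp hr hpr
  have hqr' := minkForm_kleinLift_neg hq hr hqr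
  rw [Fintype.linearIndependent_iff]
  intro g hg
  simp only [Fin.sum_univ_three, Matrix.cons_val_zero, Matrix.cons_val_one,
    Matrix.cons_val] at hg
  have e : ∀ z, g 0 * minkForm (kleinLift p) z + g 1 * minkForm (kleinLift q) z +
      g 2 * minkForm (kleinLift r) z = 0 := by
    intro z
    have := congrArg (fun w => minkForm w z) hg
    simpa using this
  have e1 := e (kleinLift p)
  have e2 := e (kleinLift q)
  have e3 := e (kleinLift r)
  rw [minkForm_kleinLift_self hp, minkForm_comm _ (kleinLift p),
    minkForm_comm _ (kleinLift p)] at e1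
  rw [minkForm_kleinLift_self hq, minkForm_comm (kleinLift r)] at e2
  rw [minkForm_kleinLift_self hr] at e3
  set a := minkForm (kleinLift p) (kleinLift q)
  set b := minkForm (kleinLift p) (kleinLift r)
  set c := minkForm (kleinLift q) (kleinLift r)
  have key : 2 * g 2 * b * c = 0 := by linear_combination c * e1 + b * e2 - a * e3
  have h2 : g 2 = 0 := by
    have : b * c ≠ 0 := (mul_pos_of_neg_of_neg hpr' hqr').ne'
    have h3 : g 2 * (b * c) = 0 := by linarith
    exact (mul_eq_zero.1 h3).resolve_right this
  rw [h2] at e1 e2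
  have h1 : g 1 = 0 := (mul_eq_zero.1 (by linarith : g 1 * a = 0)).resolve_right hpq'.ne
  have h0 : g 0 = 0 := (mul_eq_zero.1 (by linarith : g 0 * a = 0)).resolve_right hpq'.ne
  intro i
  fin_cases i <;> assumption

theorem eq_of_mem_segment_of_norm_eq_one {p q r : E3} (hp : ‖p‖ = 1) (hq : ‖q‖ = 1)
    (hr : ‖r‖ = 1) (h : r ∈ segment ℝ p q) : r = p ∨ r = q := by
  by_contra! hc
  by_cases hpq : p = q
  · rw [hpq, segment_same] at h
    exact hc.2 h
  obtain ⟨a, b, -, -, hab, hr'⟩ := h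
  have hli := linearIndependent_kleinLift hp hq hr hpq hc.1.symm hc.2.symm
  rw [Fintype.linearIndependent_iff] at hli
  have := hli ![a, b, -1] (by
    simp only [Fin.sum_univ_three, Matrix.cons_val_zero, Matrix.cons_val_one, Matrix.cons_val]
    rw [← hr']
    simp only [kleinLift]
    ext1
    · simp [hab]
    · simp) 2
  simp at this

theorem continuous_kleinLift : Continuous kleinLift := by
  unfold kleinLift
  fun_prop

theorem kleinLift_combo (p q : E3) {a b : ℝ} (hab : a + b = 1) :
    kleinLift (a • p + b • q) = a • kleinLift p + b • kleinLift q := by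
  ext1 <;> simp [kleinLift, hab]

/-! ### The ideal polyhedron as a cone -/

section IdealHull

variable {V : Type*}

/-- The two claims are proved together because the points satisfying both form a convex set: a
convex combination of nonnegative values vanishes only if every term does. -/
theorem nonneg_and_mem_face (x : V → E3) {φ : Dual ℝ Mink}
    (hφ : ∀ v, 0 ≤ φ (kleinLift (x v))) {p : E3} (hp : p ∈ idealHull x) :
    0 ≤ φ (kleinLift p) ∧ (φ (kleinLift p) = 0 →
      p ∈ convexHull ℝ (x '' {v | φ (kleinLift (x v)) = 0})) := by
  refine convexHull_min (t := {p | 0 ≤ φ (kleinLift p) ∧ (φ (kleinLift p) = 0 →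
      p ∈ convexHull ℝ (x '' {v | φ (kleinLift (x v)) = 0}))}) ?_ ?_ hp
  · rintro _ ⟨v, rfl⟩
    exact ⟨hφ v, fun hv => subset_convexHull ℝ _ ⟨v, hv, rfl⟩⟩
  · rintro p ⟨hp, hp'⟩ q ⟨hq, hq'⟩ a b ha hb hab
    have e : φ (kleinLift (a • p + b • q)) = a * φ (kleinLift p) + b * φ (kleinLift q) := by
      rw [kleinLift_combo p q hab]
      simp
    have n1 := mul_nonneg ha hp
    have n2 := mul_nonneg hb hq
    refine ⟨by rw [e]; linarith, fun h0 => ?_⟩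
    rw [e] at h0
    have z1 : a * φ (kleinLift p) = 0 := by linarith
    have z2 : b * φ (kleinLift q) = 0 := by linarith
    rcases mul_eq_zero.1 z1 with ha0 | hp0
    · have hb1 : b = 1 := by linarith
      rw [hb1, one_mul] at z2
      simpa [ha0, hb1] using hq' z2
    · rcases mul_eq_zero.1 z2 with hb0 | hq0
      · have ha1 : a = 1 := by linarith
        simpa [hb0, ha1] using hp' hp0
      · exact convex_convexHull ℝ _ (hp' hp0) (hq' hq0) ha hb hab

/-- A linear functional vanishing over an open set of Klein points is zero. -/
theorem eq_zero_of_interior_nonempty {K : Set E3} (hK : (interior K).Nonempty) {φ : Dual ℝ Mink}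
    (hφ : ∀ p ∈ K, φ (kleinLift p) = 0) : φ = 0 := by
  obtain ⟨p, hp⟩ := hK
  have h0 : ∀ n : E3, φ (0, n) = 0 := by
    intro n
    have hcont : Continuous fun t : ℝ => p + t • n := by fun_prop
    have hmem : (fun t : ℝ => p + t • n) ⁻¹' interior K ∈ nhds (0 : ℝ) :=
      (isOpen_interior.preimage hcont).mem_nhds (by simpa using hp)
    obtain ⟨ε, hε, hball⟩ := Metric.mem_nhds_iff.1 hmem
    have h1 := hφ _ (interior_subset (hball (show ε / 2 ∈ Metric.ball (0 : ℝ) ε by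
      rw [Metric.mem_ball, Real.dist_eq, sub_zero, abs_of_pos (by linarith)]; linarith)))
    have h2 := hφ _ (interior_subset hp)
    have h3 : kleinLift (p + (ε / 2) • n) = kleinLift p + (ε / 2) • ((0, n) : Mink) := by
      ext1 <;> simp [kleinLift]
    rw [h3, map_add, h2, zero_add, map_smul, smul_eq_mul] at h1
    exact (mul_eq_zero.1 h1).resolve_left (by linarith)
  ext1
  · ext
    have h2 := hφ _ (interior_subset hp)
    have h3 : kleinLift p = (1, 0) + (0, p) := by ext1 <;> simp [kleinLift]
    rw [h3, map_add, h0, add_zero] at h2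
    simpa using h2
  · exact LinearMap.ext fun n => by simpa using h0 n

/-- Affine functions on the ball are linear functionals at height one, so a function maximal exactly
on the segment becomes a nonnegative functional with that zero set. The segment contains no further
vertex, since the sphere is strictly convex. -/
theorem isExposed_segment_iff [Finite V] {x : V → E3} (hx : ∀ v, ‖x v‖ = 1)
    (hinj : Function.Injective x) (u v : V) :
    IsExposed ℝ (idealHull x) (segment ℝ (x u) (x v)) ↔
      ∃ φ : Dual ℝ Mink, (∀ w, 0 ≤ φ (kleinLift (x w))) ∧
        ∀ w, φ (kleinLift (x w)) = 0 ↔ w = u ∨ w = v := by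
  have hmem : ∀ w, x w ∈ idealHull x := fun w => subset_convexHull ℝ _ ⟨w, rfl⟩
  constructor
  · intro h
    obtain ⟨l, hl⟩ := h ⟨x u, left_mem_segment ℝ _ _⟩
    have hu : x u ∈ {p | p ∈ idealHull x ∧ ∀ y ∈ idealHull x, l y ≤ l p} :=
      hl ▸ left_mem_segment ℝ _ _
    have hv : x v ∈ {p | p ∈ idealHull x ∧ ∀ y ∈ idealHull x, l y ≤ l p} :=
      hl ▸ right_mem_segment ℝ _ _
    let φ : Dual ℝ Mink := l (x u) • LinearMap.fst ℝ ℝ E3 -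
      (l : E3 →ₗ[ℝ] ℝ) ∘ₗ LinearMap.snd ℝ ℝ E3
    have hφ : ∀ p, φ (kleinLift p) = l (x u) - l p := fun p => by simp [φ, kleinLift]
    refine ⟨φ, fun w => ?_, fun w => ?_⟩
    · rw [hφ, sub_nonneg]
      exact hu.2 _ (hmem w)
    · rw [hφ, sub_eq_zero]
      constructor
      · intro hw
        have : x w ∈ segment ℝ (x u) (x v) := by
          rw [hl]
          exact ⟨hmem w, fun y hy => hw ▸ hu.2 y hy⟩
        exact (eq_of_mem_segment_of_norm_eq_one (hx u) (hx v) (hx w) this).imp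
          (fun h => hinj h) fun h => hinj h
      · rintro (rfl | rfl)
        · rfl
        · exact le_antisymm (hv.2 _ (hmem u)) (hu.2 _ (hmem _))
  · rintro ⟨φ, hφ0, hφ⟩ -
    let l : E3 →L[ℝ] ℝ := LinearMap.toContinuousLinearMap (-(φ ∘ₗ LinearMap.inr ℝ ℝ E3))
    have hl : ∀ p, l p = φ (1, 0) - φ (kleinLift p) := by
      intro p
      have h3 : kleinLift p = (1, 0) + (0, p) := by ext1 <;> simp [kleinLift]
      rw [h3, map_add]
      simp [l]
    have hzero : {w | φ (kleinLift (x w)) = 0} = {u, v} := by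
      ext w
      simp [hφ]
    have hu0 : φ (kleinLift (x u)) = 0 := (hφ u).2 (Or.inl rfl)
    have hv0 : φ (kleinLift (x v)) = 0 := (hφ v).2 (Or.inr rfl)
    refine ⟨l, Set.Subset.antisymm ?_ ?_⟩
    · rintro p ⟨a, b, ha, hb, hab, rfl⟩
      refine ⟨convex_convexHull ℝ _ (hmem u) (hmem v) ha hb hab, fun y hy => ?_⟩
      rw [hl, hl, kleinLift_combo _ _ hab]
      simp only [map_add, map_smul, hu0, hv0, smul_zero, add_zero, sub_zero]
      linarith [(nonneg_and_mem_face x hφ0 hy).1]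
    · rintro p ⟨hp, hmax⟩
      have h1 := hmax _ (hmem u)
      rw [hl, hl, hu0] at h1
      obtain ⟨h2, h3⟩ := nonneg_and_mem_face x hφ0 hp
      have h4 := h3 (by linarith)
      rwa [hzero, Set.image_pair, convexHull_pair] at h4

theorem IsIdealRealization.isConeConfig [Finite V] {G : SimpleGraph V} {w : G.edgeSet → ℝ}
    {x : V → E3} (h : IsIdealRealization G w x) :
    IsConeConfig G fun v => kleinLift (x v) where
  finrank := finrank_mink
  span := by
    by_contra hne
    obtain ⟨φ, hφ, hle⟩ := Submodule.exists_le_ker_of_lt_top _ (lt_top_iff_ne_top.2 hne)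
    refine hφ (eq_zero_of_interior_nonempty h.solid fun p hp => ?_)
    have hz : ∀ v, φ (kleinLift (x v)) = 0 := fun v => hle (Submodule.subset_span ⟨v, rfl⟩)
    have h1 := (nonneg_and_mem_face x (φ := φ) (fun v => (hz v).ge) hp).1
    have h2 := (nonneg_and_mem_face x (φ := -φ) (fun v => by simp [hz v]) hp).1
    simp at h2
    exact le_antisymm h2 h1
  indep u v w huv huw hvw := linearIndependent_kleinLift (h.ideal u) (h.ideal v) (h.ideal w)
    (h.injective.ne huv) (h.injective.ne huw) (h.injective.ne hvw)
  exposed v := by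
    -- The tangent plane of the sphere at the ideal vertex exposes it.
    refine ⟨-minkForm (kleinLift (x v)), by simp [minkForm_kleinLift_self (h.ideal v)], ?_⟩
    intro z hz
    have := minkForm_kleinLift_neg (h.ideal v) (h.ideal z) (h.injective.ne (Ne.symm hz))
    simpa using this
  adj_iff u v := by rw [h.adj_iff, isExposed_segment_iff h.ideal h.injective]
  height := ⟨LinearMap.fst ℝ ℝ E3, fun v => by simp [kleinLift]⟩

/-- The outward Minkowski normal of a half-space. -/
def HalfSpace.vector (h : HalfSpace) : Mink := (h.offset, h.normal)

theorem HalfSpace.minkForm_vector_kleinLift (h : HalfSpace) (p : E3) :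
    minkForm h.vector (kleinLift p) = inner ℝ h.normal p - h.offset := by
  simp [minkForm_apply, HalfSpace.vector, kleinLift]

theorem HalfSpace.minkForm_vector_vector (h k : HalfSpace) :
    minkForm h.vector k.vector = h.minkowski k := rfl

/-- The contact set lies in the hull of the vertices on the plane, so dimension two needs at least
three of them. A zero functional would have the whole three-dimensional hull as contact set. -/
theorem HalfSpace.SupportsFacet.isFacetFun [Finite V] {x : V → E3}
    (hsolid : (interior (idealHull x)).Nonempty) {h : HalfSpace}
    (hh : h.SupportsFacet (idealHull x)) :
    IsFacetFun (fun v => kleinLift (x v)) (-minkForm h.vector) := by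
  obtain ⟨hle, hfr⟩ := hh
  have happ : ∀ p, (-minkForm h.vector) (kleinLift p) = h.offset - inner ℝ h.normal p := by
    intro p
    simp [h.minkForm_vector_kleinLift]
  have hnn : ∀ v, 0 ≤ (-minkForm h.vector) (kleinLift (x v)) := by
    intro v
    rw [happ, sub_nonneg]
    exact hle _ (subset_convexHull ℝ _ ⟨v, rfl⟩)
  refine ⟨fun h0 => ?_, hnn, ?_⟩
  · have h1 : h.vector = 0 := by
      apply minkForm_injective
      rw [map_zero]
      exact neg_eq_zero.1 h0
    have hn : h.normal = 0 := congrArg Prod.snd h1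
    have ho : h.offset = 0 := congrArg Prod.fst h1
    have hc : h.contact (idealHull x) = idealHull x := by
      ext p
      simp [HalfSpace.contact, hn, ho]
    rw [hc, ← direction_affineSpan] at hfr
    have htop : affineSpan ℝ (idealHull x) = ⊤ := by
      obtain ⟨p, hp⟩ := hsolid
      have h2 := isOpen_interior.affineSpan_eq_top ⟨p, hp⟩
      exact top_le_iff.1 (h2 ▸ affineSpan_mono ℝ interior_subset)
    rw [htop, AffineSubspace.direction_top, finrank_top] at hfr
    simp [E3] at hfr
  · set S := {v | (-minkForm h.vector) (kleinLift (x v)) = 0} with hS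
    have h2 : 2 < S.ncard := by
      by_contra hc
      have hsub : h.contact (idealHull x) ⊆ convexHull ℝ (x '' S) := by
        rintro p ⟨hp, hpe⟩
        exact (nonneg_and_mem_face x hnn hp).2 (by rw [happ, hpe, sub_self])
      have h3 := Submodule.finrank_mono (vectorSpan_mono ℝ hsub)
      rw [hfr, ← direction_affineSpan, affineSpan_convexHull, direction_affineSpan] at h3
      classical
      have : Fintype V := Fintype.ofFinite V
      by_cases hS0 : S = ∅
      · rw [hS0, Set.image_empty, vectorSpan_empty, finrank_bot] at h3
        omega
      · have hpos : 0 < S.ncard := (Set.ncard_pos (Set.toFinite S)).2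
          (Set.nonempty_iff_ne_empty.2 hS0)
        have h4 := finrank_vectorSpan_image_finset_le ℝ x S.toFinset (n := S.ncard - 1)
          (by rw [← Set.ncard_eq_toFinset_card' S]; omega)
        rw [Finset.coe_image, Set.coe_toFinset] at h4
        omega
    obtain ⟨a, b, c, ha, hb, hc, hab, hac, hbc⟩ := (Set.two_lt_ncard_iff (Set.toFinite S)).1 h2
    exact ⟨a, b, c, hab, hac, hbc, ha, hb, hc⟩

/-! ### Unit normals and dihedral angles -/

/-- `N` is the outward Minkowski unit normal of the facet with vertices `S`. -/
structure IsUnitNormal (x : V → E3) (S : Set V) (N : Mink) : Prop where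
  self : minkForm N N = 1
  nonpos : ∀ v, minkForm N (kleinLift (x v)) ≤ 0
  mem_iff : ∀ v, v ∈ S ↔ minkForm N (kleinLift (x v)) = 0

theorem minkForm_add_self_neg {p q : E3} (hp : ‖p‖ = 1) (hq : ‖q‖ = 1) (hpq : p ≠ q) :
    minkForm (kleinLift p + kleinLift q) (kleinLift p + kleinLift q) < 0 := by
  have := minkForm_kleinLift_neg hp hq hpq
  simp only [map_add, LinearMap.add_apply, minkForm_kleinLift_self hp, minkForm_kleinLift_self hq,
    minkForm_comm (kleinLift q) (kleinLift p)]
  linarith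

/-- The normal is orthogonal to the sum of two distinct null lifts, which is timelike. -/
theorem IsFacetFun.minkForm_self_pos {x : V → E3} (hx : ∀ v, ‖x v‖ = 1)
    (hinj : Function.Injective x) {N : Mink}
    (hN : IsFacetFun (fun v => kleinLift (x v)) (-minkForm N)) : 0 < minkForm N N := by
  obtain ⟨u, v, -, huv, -, -, hu, hv, -⟩ := hN.three
  refine _root_.minkForm_self_pos (minkForm_add_self_neg (hx u) (hx v) (hinj.ne huv)) ?_ ?_
  · rw [minkForm_comm, map_add]
    simp only [LinearMap.neg_apply, neg_eq_zero] at hu hv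
    rw [hu, hv, add_zero]
  · rintro rfl
    exact hN.ne_zero (by simp)

theorem IsUnitNormal.isFacetFun {x : V → E3} {S : Set V} {N : Mink} (hN : IsUnitNormal x S N)
    (hS : IsFacet (fun v => kleinLift (x v)) S) :
    IsFacetFun (fun v => kleinLift (x v)) (-minkForm N) where
  ne_zero h0 := by
    have := hN.self
    rw [neg_eq_zero.1 h0] at this
    simp at this
  nonneg v := by simpa using hN.nonpos v
  three := by
    obtain ⟨φ, hφ, rfl⟩ := hS
    obtain ⟨a, b, c, hab, hac, hbc, ha, hb, hc⟩ := hφ.three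
    refine ⟨a, b, c, hab, hac, hbc, ?_⟩
    simp only [LinearMap.neg_apply, neg_eq_zero]
    exact ⟨(hN.mem_iff a).1 ha, (hN.mem_iff b).1 hb, (hN.mem_iff c).1 hc⟩

theorem IsIdealRealization.exists_isUnitNormal {G : SimpleGraph V}
    {w : G.edgeSet → ℝ} {x : V → E3} (h : IsIdealRealization G w x) {S : Set V}
    (hS : IsFacet (fun v => kleinLift (x v)) S) : ∃ N, IsUnitNormal x S N := by
  obtain ⟨φ, hφ, rfl⟩ := hS
  obtain ⟨N, hN⟩ := exists_minkForm_eq (-φ)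
  have hφN : φ = -minkForm N := by rw [hN, neg_neg]
  rw [hφN] at hφ ⊢
  have hpos := hφ.minkForm_self_pos h.ideal h.injective
  have hs := Real.sqrt_pos.2 hpos
  refine ⟨(√(minkForm N N))⁻¹ • N, ?_, fun v => ?_, fun v => ?_⟩
  · simp only [map_smul, LinearMap.smul_apply, smul_eq_mul]
    rw [← mul_assoc, ← mul_inv, Real.mul_self_sqrt hpos.le, inv_mul_cancel₀ hpos.ne']
  · have := hφ.nonneg v
    simp only [LinearMap.neg_apply] at this
    simp only [map_smul, LinearMap.smul_apply, smul_eq_mul]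
    exact mul_nonpos_of_nonneg_of_nonpos (inv_nonneg.2 hs.le) (by linarith)
  · simp [hs.ne']

section Realization

variable [Finite V] {G : SimpleGraph V} {w : G.edgeSet → ℝ} {x : V → E3}

/-- Functionals vanishing at three common vertices are proportional; nonnegativity fixes the sign of
the factor and the square norm its size. -/
theorem IsUnitNormal.eq_smul (h : IsIdealRealization G w x) {S : Set V} {N N' : Mink}
    (hN : IsUnitNormal x S N) (hN' : IsFacetFun (fun v => kleinLift (x v)) (-minkForm N'))
    (hS : S = {v | (-minkForm N') (kleinLift (x v)) = 0}) : N' = √(minkForm N' N') • N := by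
  have hSf : IsFacet (fun v => kleinLift (x v)) S := ⟨_, hN', hS⟩
  have hNf := hN.isFacetFun hSf
  obtain ⟨a, b, c, hab, hac, hbc, ha, hb, hc⟩ := hN'.three
  have hz : ∀ v, (-minkForm N') (kleinLift (x v)) = 0 → (-minkForm N) (kleinLift (x v)) = 0 := by
    intro v hv
    have : v ∈ S := by rw [hS]; exact hv
    simpa using (hN.mem_iff v).1 this
  obtain ⟨r, hr⟩ := h.isConeConfig.exists_smul_of_three hab hac hbc hNf.ne_zero (hz a ha) (hz b hb)
    (hz c hc) ha hb hc
  have hNr : N' = r • N := by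
    apply minkForm_injective
    rw [map_smul, ← neg_inj, hr, smul_neg]
  have hr0 : 0 ≤ r := by
    obtain ⟨v, hv⟩ := h.isConeConfig.exists_ne_zero hNf.ne_zero
    have h1 := hN'.nonneg v
    rw [hr] at h1
    exact nonneg_of_mul_nonneg_left h1 (lt_of_le_of_ne (hNf.nonneg v) hv.symm)
  have hsq : minkForm N' N' = r ^ 2 := by
    rw [hNr]
    simp only [map_smul, LinearMap.smul_apply, smul_eq_mul, hN.self]
    ring
  rw [hsq, Real.sqrt_sq hr0, hNr]

/-- Both `N - M` and `N + M` are orthogonal to the timelike sum of the ends of the edge, so both are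
spacelike once nonzero. `N = M` would give `S = T`, and `N = -M` would put all vertices in one
plane. -/
theorem IsUnitNormal.abs_minkForm_lt_one (h : IsIdealRealization G w x) {u v : V} (huv : u ≠ v)
    {S T : Set V} {N M : Mink} (hN : IsUnitNormal x S N) (hM : IsUnitNormal x T M)
    (hS : IsFacet (fun v => kleinLift (x v)) S)
    (hST : S ≠ T) (huS : u ∈ S) (hvS : v ∈ S) (huT : u ∈ T) (hvT : v ∈ T) :
    |minkForm N M| < 1 := by
  have hT := minkForm_add_self_neg (h.ideal u) (h.ideal v) (h.injective.ne huv)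
  have oN : minkForm (kleinLift (x u) + kleinLift (x v)) N = 0 := by
    rw [minkForm_comm, map_add, (hN.mem_iff u).1 huS, (hN.mem_iff v).1 hvS, add_zero]
  have oM : minkForm (kleinLift (x u) + kleinLift (x v)) M = 0 := by
    rw [minkForm_comm, map_add, (hM.mem_iff u).1 huT, (hM.mem_iff v).1 hvT, add_zero]
  have h1 := minkForm_self_pos hT (N := N - M) (by rw [map_sub, oN, oM, sub_self]) (by
    intro h0
    rw [sub_eq_zero] at h0
    refine hST (Set.ext fun z => ?_)
    rw [hN.mem_iff, hM.mem_iff, h0])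
  have h2 := minkForm_self_pos hT (N := N + M) (by rw [map_add, oN, oM, add_zero]) (by
    intro h0
    have hNM : N = -M := eq_neg_of_add_eq_zero_left h0
    obtain ⟨z, hz⟩ := h.isConeConfig.exists_ne_zero (hN.isFacetFun hS).ne_zero
    have e1 := hN.nonpos z
    have e2 := hM.nonpos z
    rw [LinearMap.neg_apply, neg_ne_zero] at hz
    have e3 : minkForm N (kleinLift (x z)) = -minkForm M (kleinLift (x z)) := by
      rw [hNM]; simp
    exact hz (by linarith))
  simp only [map_sub, map_add, LinearMap.sub_apply, LinearMap.add_apply, hN.self, hM.self,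
    minkForm_comm M N] at h1 h2
  rw [abs_lt]
  constructor <;> linarith

/-- The Minkowski product of the unit normals of adjacent facets is the cosine of the exterior
dihedral angle. -/
theorem IsIdealRealization.minkForm_unitNormal (h : IsIdealRealization G w x) {u v : V}
    (huv : G.Adj u v) {S T : Set V} {N M : Mink} (hN : IsUnitNormal x S N)
    (hM : IsUnitNormal x T M) (hS : IsFacet (fun v => kleinLift (x v)) S)
    (hT : IsFacet (fun v => kleinLift (x v)) T) (hST : S ≠ T) (huS : u ∈ S) (hvS : v ∈ S)
    (huT : u ∈ T) (hvT : v ∈ T) :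
    minkForm N M = Real.cos (Real.pi - w ⟨s(u, v), G.mem_edgeSet.2 huv⟩) := by
  obtain ⟨k, l, hk, hl, hkl, huk, hvk, hul, hvl, hw⟩ := h.angle u v huv
  have hkf := hk.isFacetFun h.solid
  have hlf := hl.isFacetFun h.solid
  have hmem : ∀ (m : HalfSpace) (z : V), x z ∈ m.contact (idealHull x) →
      z ∈ {v | (-minkForm m.vector) (kleinLift (x v)) = 0} := by
    intro m z hz
    have : minkForm m.vector (kleinLift (x z)) = 0 := by
      rw [m.minkForm_vector_kleinLift, hz.2, sub_self]
    simp [this]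
  have hne : {v | (-minkForm k.vector) (kleinLift (x v)) = 0} ≠
      {v | (-minkForm l.vector) (kleinLift (x v)) = 0} := by
    intro heq
    obtain ⟨K, hK⟩ := h.exists_isUnitNormal ⟨_, hkf, rfl⟩
    have e1 := hK.eq_smul h hkf rfl
    have e2 := hK.eq_smul h hlf heq
    have p1 := Real.sqrt_pos.2 (hkf.minkForm_self_pos h.ideal h.injective)
    have p2 := Real.sqrt_pos.2 (hlf.minkForm_self_pos h.ideal h.injective)
    have hz : ∀ (m : HalfSpace) (p : E3), inner ℝ m.normal p = m.offset ↔
        minkForm m.vector (kleinLift p) = 0 := by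
      intro m p
      rw [m.minkForm_vector_kleinLift, sub_eq_zero]
    apply hkl
    ext p
    simp only [HalfSpace.contact, Set.mem_ofPred_eq, hz]
    rw [e1, e2]
    simp [p1.ne', p2.ne']
  -- Only two facets contain the edge, so the two half-spaces define `S` and `T`, in one order or
  -- the other.
  obtain ⟨A, B, -, -, -, -, -, -, -, hall⟩ := h.isConeConfig.exists_two_facets huv
  have a1 := hall _ hS huS hvS
  have a2 := hall _ hT huT hvT
  have a3 := hall _ ⟨_, hkf, rfl⟩ (hmem k u huk) (hmem k v hvk)
  have a4 := hall _ ⟨_, hlf, rfl⟩ (hmem l u hul) (hmem l v hvl)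
  have hcos : ∀ (m n : HalfSpace) (N M : Mink), m.vector = √(minkForm m.vector m.vector) • N →
      n.vector = √(minkForm n.vector n.vector) • M → 0 < minkForm m.vector m.vector →
      0 < minkForm n.vector n.vector → |minkForm N M| < 1 →
      Real.cos (m.normalAngle n) = minkForm N M := by
    intro m n N M hm hn pm pn hlt
    have s1 := Real.sqrt_pos.2 pm
    have s2 := Real.sqrt_pos.2 pn
    have hq : m.minkowski n / (√(m.minkowski m) * √(n.minkowski n)) = minkForm N M := by
      rw [← HalfSpace.minkForm_vector_vector, ← HalfSpace.minkForm_vector_vector,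
        ← HalfSpace.minkForm_vector_vector]
      have : minkForm m.vector n.vector =
          √(minkForm m.vector m.vector) * √(minkForm n.vector n.vector) * minkForm N M := by
        conv_lhs => rw [hm, hn]
        simp only [map_smul, LinearMap.smul_apply, smul_eq_mul]
        ring
      rw [this, mul_div_cancel_left₀ _ (mul_pos s1 s2).ne']
    rw [HalfSpace.normalAngle, hq, Real.cos_arccos (abs_lt.1 hlt).1.le (abs_lt.1 hlt).2.le]
  have hlt := hN.abs_minkForm_lt_one h huv.ne hM hS hST huS hvS huT hvT
  have pk := hkf.minkForm_self_pos h.ideal h.injective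
  have pl := hlf.minkForm_self_pos h.ideal h.injective
  rw [hw, sub_sub_cancel]
  have hcase : (S = {v | (-minkForm k.vector) (kleinLift (x v)) = 0} ∧
      T = {v | (-minkForm l.vector) (kleinLift (x v)) = 0}) ∨
      (T = {v | (-minkForm k.vector) (kleinLift (x v)) = 0} ∧
      S = {v | (-minkForm l.vector) (kleinLift (x v)) = 0}) := by
    clear * - a1 a2 a3 a4 hST hne
    grind
  rcases hcase with ⟨e1, e2⟩ | ⟨e1, e2⟩
  · exact (hcos k l N M (hN.eq_smul h hkf e1) (hM.eq_smul h hlf e2) pk pl hlt).symm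
  · rw [minkForm_comm] at hlt ⊢
    exact (hcos k l M N (hM.eq_smul h hkf e1) (hN.eq_smul h hlf e2) pk pl hlt).symm

end Realization

end IdealHull

/-! ### Angular measure of arcs -/

section Arcs

open MeasureTheory Real

theorem exists_polar (b c : ℝ) : ∃ β : ℝ, b = √(b ^ 2 + c ^ 2) * cos β ∧
    c = √(b ^ 2 + c ^ 2) * sin β := by
  refine ⟨Complex.arg ⟨b, c⟩, ?_, ?_⟩
  · have := Complex.norm_mul_cos_arg ⟨b, c⟩
    rw [Complex.norm_def, Complex.normSq_mk] at this
    rw [sq, sq]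
    exact this.symm
  · have := Complex.norm_mul_sin_arg ⟨b, c⟩
    rw [Complex.norm_def, Complex.normSq_mk] at this
    rw [sq, sq]
    exact this.symm

theorem lt_cos_iff_abs_lt_arccos {m t : ℝ} (hm : -1 ≤ m) (hm' : m ≤ 1) (ht : |t| ≤ π) :
    m < cos t ↔ |t| < arccos m := by
  rw [← cos_abs, ← Real.cos_arccos hm hm']
  rw [Real.strictAntiOn_cos.lt_iff_gt ⟨arccos_nonneg m, arccos_le_pi m⟩ ⟨abs_nonneg t, ht⟩,
    Real.cos_arccos hm hm']

theorem intervalIntegral_cos_gt {m : ℝ} (hm : -1 ≤ m) (hm' : m ≤ 1) :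
    ∫ t in (-π)..π, (if m < cos t then (1 : ℝ) else 0) = 2 * arccos m := by
  have h0 := arccos_nonneg m
  have h1 := arccos_le_pi m
  rw [intervalIntegral.integral_of_le (by linarith [pi_pos])]
  have hset : ∀ t ∈ Set.Ioc (-π) π, (if m < cos t then (1 : ℝ) else 0) =
      (Set.Ioo (-arccos m) (arccos m)).indicator (fun _ => 1) t := by
    intro t ht
    have := lt_cos_iff_abs_lt_arccos hm hm' (abs_le.2 ⟨ht.1.le, ht.2⟩)
    rw [abs_lt] at this
    simp only [this, Set.indicator_apply, Set.mem_Ioo]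
  rw [setIntegral_congr_fun measurableSet_Ioc hset, setIntegral_indicator measurableSet_Ioo,
    Set.inter_eq_self_of_subset_right]
  · simp only [integral_const, MeasurableSet.univ, measureReal_restrict_apply, Set.univ_inter,
      Real.volume_real_Ioo, smul_eq_mul, mul_one]
    rw [max_eq_left (by linarith)]
    ring
  · intro t ht
    exact ⟨by linarith [ht.1], by linarith [ht.2]⟩

theorem intervalIntegrable_ite_lt {f : ℝ → ℝ} (hf : Continuous f) (a b : ℝ) :
    IntervalIntegrable (fun t => if 0 < f t then (1 : ℝ) else 0) volume a b := by
  refine (intervalIntegrable_const (c := (1 : ℝ))).mono_fun ?_ ?_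
  · exact (Measurable.ite (measurableSet_lt measurable_const hf.measurable) measurable_const
      measurable_const).aestronglyMeasurable
  · refine Filter.Eventually.of_forall fun t => ?_
    dsimp only
    split_ifs <;> simp

/-- The angular measure of an arc of the circle cut off by a line. -/
theorem intervalIntegral_arc {a b c : ℝ} (h : a ^ 2 < b ^ 2 + c ^ 2) :
    ∫ t in (-π)..π, (if 0 < a + cos t * b + sin t * c then (1 : ℝ) else 0) =
      2 * arccos (-a / √(b ^ 2 + c ^ 2)) := by
  obtain ⟨β, hb, hc⟩ := exists_polar b c
  set R := √(b ^ 2 + c ^ 2) with hR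
  have hRpos : 0 < R := Real.sqrt_pos.2 (lt_of_le_of_lt (sq_nonneg a) h)
  have haR : |a| < R := by
    rw [hR, ← Real.sqrt_sq_eq_abs]
    exact Real.sqrt_lt_sqrt (sq_nonneg a) h
  obtain ⟨h1, h2⟩ := abs_lt.1 haR
  have hm : -1 ≤ -a / R := by rw [le_div_iff₀ hRpos]; linarith
  have hm' : -a / R ≤ 1 := by rw [div_le_iff₀ hRpos]; linarith
  rw [← intervalIntegral_cos_gt hm hm']
  have hcond : ∀ t, 0 < a + cos t * b + sin t * c ↔ -a / R < cos (t - β) := by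
    intro t
    rw [div_lt_iff₀ hRpos, cos_sub]
    have e : a + cos t * b + sin t * c = a + (cos t * cos β + sin t * sin β) * R := by
      rw [hb, hc]
      ring
    rw [e]
    constructor <;> intro <;> linarith
  simp only [hcond]
  rw [intervalIntegral.integral_comp_sub_right (fun t => if -a / R < cos t then (1 : ℝ) else 0) β]
  have hper : Function.Periodic (fun t => if -a / R < cos t then (1 : ℝ) else 0) (2 * π) := by
    intro t
    simp only [cos_add_two_pi]
  have := hper.intervalIntegral_add_eq (-π - β) (-π)
  rw [show -π - β + 2 * π = π - β by ring, show -π + 2 * π = π by ring] at this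
  exact this

/-- The equality says that the line is tangent to the unit circle, so it meets it at one angle
modulo `2π`. Such angles belong to ideal vertices and are discarded from the integral. -/
theorem countable_arc_zeros {a b c : ℝ} (h : a ^ 2 = b ^ 2 + c ^ 2) (ha : a < 0) :
    {t : ℝ | a + cos t * b + sin t * c = 0}.Countable := by
  obtain ⟨β, hb, hc⟩ := exists_polar b c
  have hR : √(b ^ 2 + c ^ 2) = -a := by rw [← h, Real.sqrt_sq_eq_abs, abs_of_neg ha]
  rw [hR] at hb hc
  refine (Set.countable_range fun n : ℤ => (n : ℝ) * (2 * π) + β).mono fun t ht => ?_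
  have h1 : cos (t - β) = 1 := by
    rw [cos_sub]
    have h2 : a * (1 - (cos t * cos β + sin t * sin β)) = 0 := by
      have h3 : a + cos t * b + sin t * c = 0 := ht
      rw [hb, hc] at h3
      linear_combination h3
    linarith [(mul_eq_zero.1 h2).resolve_left ha.ne]
  obtain ⟨n, hn⟩ := (Real.cos_eq_one_iff _).1 h1
  exact ⟨n, by simp only; linarith⟩

theorem arc_nonpos {a b c : ℝ} (h : a ^ 2 = b ^ 2 + c ^ 2) (ha : a < 0) (t : ℝ) :
    a + cos t * b + sin t * c ≤ 0 := by
  have h1 : (cos t * b + sin t * c) ^ 2 ≤ a ^ 2 := by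
    rw [h]
    nlinarith [sq_nonneg (cos t * c - sin t * b), Real.sin_sq_add_cos_sq t]
  have := Real.abs_le_sqrt h1
  rw [Real.sqrt_sq_eq_abs, abs_of_neg ha] at this
  linarith [(abs_le.1 this).2]

theorem arccos_div_sqrt (σ : ℝ) : arccos (σ / √(1 + σ ^ 2)) = π / 2 - arctan σ := by
  rw [arctan_eq_arcsin, arccos]

end Arcs

/-! ### Visual angles of the edges of a facet -/

/-- Orthonormal coordinates on the orthogonal complement of a spacelike unit vector. -/
theorem exists_orthonormal_frame {N o : Mink} (hN : minkForm N N = 1) (ho : minkForm o o = -1)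
    (hNo : minkForm N o = 0) :
    ∃ e₁ e₂ : Mink, minkForm e₁ e₁ = 1 ∧ minkForm e₂ e₂ = 1 ∧ minkForm e₁ e₂ = 0 ∧
      minkForm N e₁ = 0 ∧ minkForm N e₂ = 0 ∧ minkForm o e₁ = 0 ∧ minkForm o e₂ = 0 ∧
      ∀ Z, minkForm N Z = 0 → Z = -minkForm o Z • o + minkForm e₁ Z • e₁ + minkForm e₂ Z • e₂ := by
  have hT : minkForm o o < 0 := by rw [ho]; norm_num
  have key : ∀ {n : ℕ} (f : Fin n → Mink), n < 4 → ∃ e, e ≠ 0 ∧ ∀ i, minkForm (f i) e = 0 := by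
    intro n f hn
    have hker := LinearMap.ker_ne_bot_of_finrank_lt
      (f := LinearMap.pi fun i => minkForm (f i)) (by rw [finrank_mink]; simpa using hn)
    obtain ⟨e, he, hne⟩ := Submodule.exists_mem_ne_zero_of_ne_bot hker
    exact ⟨e, hne, fun i => congrFun (LinearMap.mem_ker.1 he) i⟩
  have unit : ∀ e, e ≠ 0 → minkForm o e = 0 →
      minkForm ((√(minkForm e e))⁻¹ • e) ((√(minkForm e e))⁻¹ • e) = 1 := by
    intro e he hoe
    have hpos := minkForm_self_pos hT hoe he
    simp only [map_smul, LinearMap.smul_apply, smul_eq_mul]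
    rw [← mul_assoc, ← mul_inv, Real.mul_self_sqrt hpos.le, inv_mul_cancel₀ hpos.ne']
  obtain ⟨f₁, hf₁, h₁⟩ := key ![N, o] (by norm_num)
  have hN1 : minkForm N f₁ = 0 := h₁ 0
  have ho1 : minkForm o f₁ = 0 := h₁ 1
  have u₁ := unit f₁ hf₁ ho1
  set e₁ := (√(minkForm f₁ f₁))⁻¹ • f₁ with he₁
  have hNe1 : minkForm N e₁ = 0 := by rw [he₁, map_smul, hN1, smul_zero]
  have hoe1 : minkForm o e₁ = 0 := by rw [he₁, map_smul, ho1, smul_zero]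
  obtain ⟨f₂, hf₂, h₂⟩ := key ![N, o, e₁] (by norm_num)
  have hN2 : minkForm N f₂ = 0 := h₂ 0
  have ho2 : minkForm o f₂ = 0 := h₂ 1
  have h12 : minkForm e₁ f₂ = 0 := h₂ 2
  have u₂ := unit f₂ hf₂ ho2
  set e₂ := (√(minkForm f₂ f₂))⁻¹ • f₂ with he₂
  have hNe2 : minkForm N e₂ = 0 := by rw [he₂, map_smul, hN2, smul_zero]
  have hoe2 : minkForm o e₂ = 0 := by rw [he₂, map_smul, ho2, smul_zero]
  have he12 : minkForm e₁ e₂ = 0 := by rw [he₂, map_smul, h12, smul_zero]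
  refine ⟨e₁, e₂, u₁, u₂, he12, hNe1, hNe2, hoe1, hoe2, fun Z hZ => ?_⟩
  -- Otherwise `Y` is spacelike, and `N`, `o`, `e₁`, `e₂`, `Y` would be five independent vectors in
  -- dimension four.
  have hzero : ∀ Y, minkForm N Y = 0 → minkForm o Y = 0 → minkForm e₁ Y = 0 →
      minkForm e₂ Y = 0 → Y = 0 := by
    intro Y hY1 hY2 hY3 hY4
    by_contra hne
    have hpos := minkForm_self_pos hT hY2 hne
    have hli : LinearIndependent ℝ ![N, o, e₁, e₂, Y] := by
      rw [Fintype.linearIndependent_iff]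
      intro g hg
      have e : ∀ z, g 0 * minkForm N z + g 1 * minkForm o z + g 2 * minkForm e₁ z +
          g 3 * minkForm e₂ z + g 4 * minkForm Y z = 0 := by
        intro z
        have := congrArg (fun w => minkForm w z) hg
        simpa [Fin.sum_univ_five] using this
      have g0 := e N
      have g1 := e o
      have g2 := e e₁
      have g3 := e e₂
      have g4 := e Y
      rw [minkForm_comm o N, minkForm_comm e₁ N, minkForm_comm e₂ N, minkForm_comm Y N, hN, hNo,
        hNe1, hNe2, hY1] at g0
      rw [minkForm_comm e₁ o, minkForm_comm e₂ o, minkForm_comm Y o, ho, hNo,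
        hoe1, hoe2, hY2] at g1
      rw [minkForm_comm e₂ e₁, minkForm_comm Y e₁, u₁, hNe1, hoe1, he12, hY3] at g2
      rw [minkForm_comm Y e₂, u₂, hNe2, hoe2, he12, hY4] at g3
      rw [hY1, hY2, hY3, hY4] at g4
      have g4' : g 4 * minkForm Y Y = 0 := by linarith
      intro i
      fin_cases i
      · change g 0 = 0; linarith
      · change g 1 = 0; linarith
      · change g 2 = 0; linarith
      · change g 3 = 0; linarith
      · exact (mul_eq_zero.1 g4').resolve_right hpos.ne'
    have := hli.fintype_card_le_finrank
    rw [finrank_mink] at this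
    simp at this
  have hz := hzero (Z - (-minkForm o Z • o + minkForm e₁ Z • e₁ + minkForm e₂ Z • e₂)) ?_ ?_ ?_ ?_
  · exact sub_eq_zero.1 hz
  · simp [hZ, hNo, hNe1, hNe2]
  · simp [ho, hoe1, hoe2]
  · simp [u₁, he12, minkForm_comm e₁ o, hoe1]
  · simp [u₂, he12, minkForm_comm e₂ o, hoe2, minkForm_comm e₂ e₁]

/-- A point of the circle of a facet lies beyond at most one of its edges. -/
theorem not_beyond_two {N₁ N₂ q A B C : Mink} (hA : minkForm A A = 0) (hB : minkForm B B = 0)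
    (hC : minkForm C C = 0) (hAB : minkForm A B < 0) (hAC : minkForm A C < 0)
    (hBC : minkForm B C < 0) (hq : minkForm q q = 0) (hqC : minkForm q C < 0)
    (hmem : q ∈ Submodule.span ℝ {A, B, C}) (h1A : minkForm N₁ A = 0) (h1B : minkForm N₁ B = 0)
    (h1C : minkForm N₁ C ≤ 0) (h1q : 0 < minkForm N₁ q) (h2A : minkForm N₂ A ≤ 0)
    (h2B : minkForm N₂ B ≤ 0) (h2C : minkForm N₂ C = 0) : minkForm N₂ q ≤ 0 := by
  obtain ⟨a, b, c, rfl⟩ := Submodule.mem_span_triple.1 hmem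
  simp only [map_add, map_smul, LinearMap.add_apply, LinearMap.smul_apply, smul_eq_mul, hA, hB, hC,
    h1A, h1B, h2C, minkForm_comm B A, minkForm_comm C A, minkForm_comm C B] at *
  -- Write `q = a A + b B + c C`. Lying beyond `AB` forces `c < 0`; nullity of `q` and its negative
  -- product with `C` then force `a, b > 0`. Since `N₂` kills `C`, its value at `q` is at most zero.
  have hc : c < 0 := by
    by_contra hc
    have := mul_nonpos_of_nonneg_of_nonpos (not_lt.1 hc) h1C
    linarith
  set p := minkForm A B
  set r := minkForm A C
  set s := minkForm B C
  have hab : 0 < a * b := by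
    have h1 : a * b * p = -c * (a * r + b * s) := by linarith
    have h2 : a * r + b * s < 0 := by linarith
    have h3 : -c * (a * r + b * s) < 0 := mul_neg_of_pos_of_neg (by linarith) h2
    rw [← h1] at h3
    exact pos_of_mul_neg_left h3 hAB.le
  have ha : 0 < a := by
    by_contra ha
    have ha' : a < 0 := lt_of_le_of_ne (not_lt.1 ha) (by rintro rfl; simp at hab)
    have hb' : b < 0 := neg_of_mul_pos_right hab ha'.le
    have := mul_pos_of_neg_of_neg ha' hAC
    have := mul_pos_of_neg_of_neg hb' hBC
    linarith
  have hb : 0 < b := pos_of_mul_pos_right hab ha.le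
  have := mul_nonpos_of_nonneg_of_nonpos ha.le h2A
  have := mul_nonpos_of_nonneg_of_nonpos hb.le h2B
  linarith

section VisualAngle

open Classical

variable {V : Type*} [Fintype V] {G : SimpleGraph V} {w : G.edgeSet → ℝ} {x : V → E3}

/-- The members of a family of vertex sets that share an edge of the graph with `S`. -/
noncomputable def adjacentFacets (G : SimpleGraph V) (F : Set V → Prop) (S : Set V) :
    Finset (Set V) :=
  Finset.univ.filter fun T => F T ∧ T ≠ S ∧ ∃ u v, G.Adj u v ∧ u ∈ S ∧ v ∈ S ∧ u ∈ T ∧ v ∈ T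

theorem mem_adjacentFacets {F : Set V → Prop} {S T : Set V} : T ∈ adjacentFacets G F S ↔
    F T ∧ T ≠ S ∧ ∃ u v, G.Adj u v ∧ u ∈ S ∧ v ∈ S ∧ u ∈ T ∧ v ∈ T := by
  simp [adjacentFacets]

/-- Half the angle under which the edge between facets with unit normals `N` and `M` is seen from
the projection of the ideal point over `Z` to the plane of the first facet. -/
noncomputable def halfVisualAngle (N M Z : Mink) : ℝ :=
  Real.pi / 2 - Real.arctan
    ((minkForm M Z / minkForm N Z - minkForm N M) / √(1 - minkForm N M ^ 2))

/-- Each point of the circle of a facet that is not a vertex lies beyond exactly one edge. -/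
theorem IsIdealRealization.sum_beyond (h : IsIdealRealization G w x) {Nrm : Set V → Mink}
    (hN : ∀ S, IsFacet (fun v => kleinLift (x v)) S → IsUnitNormal x S (Nrm S)) {S : Set V}
    (hS : IsFacet (fun v => kleinLift (x v)) S) {o q : Mink} (hq : minkForm q q = 0)
    (hNq : minkForm (Nrm S) q = 0) (hoq : minkForm o q < 0)
    (hqv : ∀ v ∈ S, minkForm q (kleinLift (x v)) < 0) :
    (∑ T ∈ adjacentFacets G (IsFacet fun v => kleinLift (x v)) S,
      if 0 < minkForm (Nrm T) q then (1 : ℝ) else 0) = 1 := by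
  have hc := h.isConeConfig
  have hSN := hN S hS
  have hSf := hSN.isFacetFun hS
  have hzS : ∀ v, (-minkForm (Nrm S)) (kleinLift (x v)) = 0 ↔ v ∈ S := by
    intro v
    rw [hSN.mem_iff, LinearMap.neg_apply, neg_eq_zero]
  -- existence
  obtain ⟨T, hTadj, hTq⟩ : ∃ T ∈ adjacentFacets G (IsFacet fun v => kleinLift (x v)) S,
      0 < minkForm (Nrm T) q := by
    have : Nonempty V := by
      obtain ⟨v, -⟩ := hSf.three
      exact ⟨v⟩
    -- The functional `-q` is positive on the vertices of the facet but only zero at `q`; adding a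
    -- small multiple of `o` makes it negative there.
    obtain ⟨ε, hε, hall⟩ : ∃ ε > 0, ∀ v ∈ S,
        0 ≤ -minkForm q (kleinLift (x v)) + ε * minkForm o (kleinLift (x v)) := by
      have hev : ∀ v, ∀ᶠ ε : ℝ in nhdsWithin 0 (Set.Ioi 0), v ∈ S →
          0 ≤ -minkForm q (kleinLift (x v)) + ε * minkForm o (kleinLift (x v)) := by
        intro v
        by_cases hv : v ∈ S
        · have hcont : Continuous fun ε : ℝ =>
              -minkForm q (kleinLift (x v)) + ε * minkForm o (kleinLift (x v)) := by fun_prop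
          have ht := (hcont.tendsto 0).mono_left (nhdsWithin_le_nhds (s := Set.Ioi 0))
          have hpos := hqv v hv
          filter_upwards [ht.eventually (lt_mem_nhds (a := 0) (by simpa using hpos))] with ε hε _
          exact hε.le
        · exact Filter.Eventually.of_forall fun ε hc => absurd hc hv
      obtain ⟨ε, h1, h2⟩ := ((Filter.eventually_all.2 hev).and self_mem_nhdsWithin).exists
      exact ⟨ε, h2, h1⟩
    obtain ⟨φ, hφ, hφq, u, v, huv, hu, hv, hu', hv'⟩ := hc.exists_adjacent_facet_neg hSf (Z := q)
      (by simp [hNq]) (ψ₀ := -minkForm q + ε • minkForm o)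
      (fun v hv => by simpa using hall v ((hzS v).1 hv))
      (by simpa [hq] using mul_neg_of_pos_of_neg hε hoq)
    obtain ⟨M, hM⟩ := exists_minkForm_eq (-φ)
    have hφM : φ = -minkForm M := by rw [hM, neg_neg]
    rw [hφM] at hφ hφq hu' hv'
    set T := {v | (-minkForm M) (kleinLift (x v)) = 0} with hT
    have hTf : IsFacet (fun v => kleinLift (x v)) T := ⟨_, hφ, rfl⟩
    have hMT := (hN T hTf).eq_smul h hφ rfl
    have hs := Real.sqrt_pos.2 (hφ.minkForm_self_pos h.ideal h.injective)
    have hTq : 0 < minkForm (Nrm T) q := by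
      rw [hMT] at hφq
      simp only [map_smul, LinearMap.neg_apply, LinearMap.smul_apply, smul_eq_mul,
        neg_lt_zero] at hφq
      exact pos_of_mul_pos_right hφq hs.le
    refine ⟨T, mem_adjacentFacets.2 ⟨hTf, ?_, u, v, huv, (hzS u).1 hu, (hzS v).1 hv, hu', hv'⟩, hTq⟩
    rintro heq
    rw [heq, hNq] at hTq
    exact lt_irrefl _ hTq
  -- uniqueness
  rw [Finset.sum_eq_single T]
  · rw [if_pos hTq]
  · intro T' hT'adj hne
    rw [if_neg]
    intro hT'q
    obtain ⟨hT, hTS, a, b, hab, haS, hbS, haT, hbT⟩ := mem_adjacentFacets.1 hTadj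
    obtain ⟨hT', hTS', c, d, hcd, hcS, hdS, hcT, hdT⟩ := mem_adjacentFacets.1 hT'adj
    -- Otherwise the edge shared by `S` and `T'` would be `ab`, which already lies in the facets `S`
    -- and `T`.
    have hex : ∃ z ∈ S, z ∈ T' ∧ z ≠ a ∧ z ≠ b := by
      by_contra! hcon
      have e1 := hcon c hcS hcT
      have e2 := hcon d hdS hdT
      have hcd' := hcd.ne
      have hmem : a ∈ T' ∧ b ∈ T' := by
        by_cases hca : c = a
        · subst hca
          have := e2 hcd'.symm
          subst this
          exact ⟨hcT, hdT⟩
        · have := e1 hca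
          subst this
          by_cases hda : d = a
          · subst hda
            exact ⟨hdT, hcT⟩
          · exact absurd (e2 hda).symm hcd'
      obtain ⟨A, B, -, -, -, -, -, -, -, hall⟩ := hc.exists_two_facets hab
      have f1 := hall S hS haS hbS
      have f2 := hall T hT haT hbT
      have f3 := hall T' hT' hmem.1 hmem.2
      clear * - f1 f2 f3 hne hTS hTS'
      grind
    obtain ⟨z, hzS', hzT', hza, hzb⟩ := hex
    have hspan : q ∈ Submodule.span ℝ {kleinLift (x a), kleinLift (x b), kleinLift (x z)} := by
      by_contra hnot
      obtain ⟨η, hη, hker⟩ := Submodule.exists_le_ker_of_notMem hnot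
      obtain ⟨r, hr⟩ := hc.exists_smul_of_three hab.ne hza.symm hzb.symm hSf.ne_zero
        ((hzS a).2 haS) ((hzS b).2 hbS) ((hzS z).2 hzS') (η := η)
        (hker (Submodule.subset_span (by simp))) (hker (Submodule.subset_span (by simp)))
        (hker (Submodule.subset_span (by simp)))
      exact hη (by simp [hr, hNq])
    have hlt := fun {u v : V} (huv : u ≠ v) =>
      minkForm_kleinLift_neg (h.ideal u) (h.ideal v) (h.injective.ne huv)
    exact absurd hT'q (not_lt.2 (not_beyond_two (minkForm_kleinLift_self (h.ideal a))
      (minkForm_kleinLift_self (h.ideal b)) (minkForm_kleinLift_self (h.ideal z)) (hlt hab.ne)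
      (hlt hza.symm) (hlt hzb.symm) hq (hqv z hzS') hspan (((hN T hT).mem_iff a).1 haT)
      (((hN T hT).mem_iff b).1 hbT) ((hN T hT).nonpos z) hTq ((hN T' hT').nonpos a)
      ((hN T' hT').nonpos b) (((hN T' hT').mem_iff z).1 hzT')))
  · exact fun hc => absurd hTadj hc

/-- The edges of a facet are seen under a total angle `2 * π` from the projection to its plane of
an ideal vertex outside of it. -/
theorem IsIdealRealization.sum_halfVisualAngle (h : IsIdealRealization G w x) {Nrm : Set V → Mink}
    (hN : ∀ S, IsFacet (fun v => kleinLift (x v)) S → IsUnitNormal x S (Nrm S)) {S : Set V}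
    (hS : IsFacet (fun v => kleinLift (x v)) S) {v₀ : V} (hv₀ : v₀ ∉ S) :
    ∑ T ∈ adjacentFacets G (IsFacet fun v => kleinLift (x v)) S,
      halfVisualAngle (Nrm S) (Nrm T) (kleinLift (x v₀)) = Real.pi := by
  have hSN := hN S hS
  set N := Nrm S with hNdef
  set Z := kleinLift (x v₀) with hZ
  have hZZ : minkForm Z Z = 0 := minkForm_kleinLift_self (h.ideal v₀)
  have hNZ : minkForm N Z < 0 :=
    lt_of_le_of_ne (hSN.nonpos v₀) fun h0 => hv₀ ((hSN.mem_iff v₀).2 h0)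
  set k := -minkForm N Z with hk
  have hkpos : 0 < k := neg_pos.2 hNZ
  have hNZk : minkForm N Z = -k := by rw [hk, neg_neg]
  -- The orthogonal projection of the ideal point to the plane of `S`: `Z + k N` is orthogonal to
  -- `N` and has square `-k²`.
  set o := k⁻¹ • Z + N with ho
  have hoo : minkForm o o = -1 := by
    simp only [ho, map_add, map_smul, LinearMap.add_apply, LinearMap.smul_apply, smul_eq_mul, hZZ,
      minkForm_comm Z N, hNZk, hSN.self]
    field_simp
    ring
  have hNo : minkForm N o = 0 := by
    simp only [ho, map_add, map_smul, smul_eq_mul, hNZk, hSN.self]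
    field_simp
    ring
  obtain ⟨e₁, e₂, h11, h22, h12, hN1, hN2, ho1, ho2, hframe⟩ :=
    exists_orthonormal_frame hSN.self hoo hNo
  have hnorm : ∀ Y, minkForm N Y = 0 →
      minkForm Y Y = -minkForm o Y ^ 2 + minkForm e₁ Y ^ 2 + minkForm e₂ Y ^ 2 := by
    intro Y hY
    have e := congrArg (minkForm Y) (hframe Y hY)
    simp only [map_add, map_smul, smul_eq_mul, minkForm_comm Y o, minkForm_comm Y e₁,
      minkForm_comm Y e₂] at e
    rw [e]
    ring
  -- The circle at infinity of the plane of `S`, parametrized by the angle of the direction seen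
  -- from `o`.
  let q : ℝ → Mink := fun t => o + Real.cos t • e₁ + Real.sin t • e₂
  have hq : ∀ (t : ℝ) Y, minkForm Y (q t) =
      minkForm o Y + Real.cos t * minkForm e₁ Y + Real.sin t * minkForm e₂ Y := by
    intro t Y
    rw [minkForm_comm Y]
    simp only [q, map_add, map_smul, LinearMap.add_apply, LinearMap.smul_apply, smul_eq_mul]
  have hNq : ∀ t, minkForm N (q t) = 0 := by
    intro t
    simp only [q, map_add, map_smul, hNo, hN1, hN2, smul_zero, add_zero]
  have hoq : ∀ t, minkForm o (q t) = -1 := by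
    intro t
    simp only [q, map_add, map_smul, hoo, ho1, ho2, smul_zero, add_zero]
  have hqq : ∀ t, minkForm (q t) (q t) = 0 := by
    intro t
    rw [hnorm _ (hNq t), hoq]
    have e1 : minkForm e₁ (q t) = Real.cos t := by
      simp [q, minkForm_comm e₁ o, ho1, h11, h12]
    have e2 : minkForm e₂ (q t) = Real.sin t := by
      simp [q, minkForm_comm e₂ o, ho2, h22, minkForm_comm e₂ e₁, h12]
    rw [e1, e2]
    linarith [Real.sin_sq_add_cos_sq t]
  -- vertices of the facet
  have hov : ∀ v ∈ S, minkForm o (kleinLift (x v)) < 0 := by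
    intro v hv
    have hne : v₀ ≠ v := by rintro rfl; exact hv₀ hv
    simp only [ho, map_add, map_smul, LinearMap.add_apply, LinearMap.smul_apply, smul_eq_mul,
      (hSN.mem_iff v).1 hv, add_zero]
    exact mul_neg_of_pos_of_neg (inv_pos.2 hkpos)
      (minkForm_kleinLift_neg (h.ideal v₀) (h.ideal v) (h.injective.ne hne))
  have hvnorm : ∀ v ∈ S, minkForm o (kleinLift (x v)) ^ 2 =
      minkForm e₁ (kleinLift (x v)) ^ 2 + minkForm e₂ (kleinLift (x v)) ^ 2 := by
    intro v hv
    have := hnorm _ ((hSN.mem_iff v).1 hv)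
    rw [minkForm_kleinLift_self (h.ideal v)] at this
    linarith
  -- The directions of the vertices, where no edge need be crossed; they are countable and do not
  -- affect the integral.
  let bad : Set ℝ := ⋃ v ∈ S, {t | minkForm o (kleinLift (x v)) +
    Real.cos t * minkForm e₁ (kleinLift (x v)) + Real.sin t * minkForm e₂ (kleinLift (x v)) = 0}
  have hbad : bad.Countable := (Set.to_countable S).biUnion fun v hv =>
    countable_arc_zeros (hvnorm v hv) (hov v hv)
  have hsum : ∀ t, t ∉ bad → (∑ T ∈ adjacentFacets G (IsFacet fun v => kleinLift (x v)) S,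
      if 0 < minkForm (Nrm T) (q t) then (1 : ℝ) else 0) = 1 := by
    intro t ht
    refine h.sum_beyond hN hS (hqq t) (hNq t) (o := o) (by rw [hoq]; norm_num) fun v hv => ?_
    rw [minkForm_comm, hq]
    refine lt_of_le_of_ne (arc_nonpos (hvnorm v hv) (hov v hv) t) fun h0 => ht ?_
    exact Set.mem_biUnion hv h0
  have hInt : ∫ t in (-Real.pi)..Real.pi,
      (∑ T ∈ adjacentFacets G (IsFacet fun v => kleinLift (x v)) S,
        if 0 < minkForm (Nrm T) (q t) then (1 : ℝ) else 0) = 2 * Real.pi := by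
    have h1 : ∫ t in (-Real.pi)..Real.pi,
        (∑ T ∈ adjacentFacets G (IsFacet fun v => kleinLift (x v)) S,
        if 0 < minkForm (Nrm T) (q t) then (1 : ℝ) else 0) =
        ∫ t in (-Real.pi)..Real.pi, (1 : ℝ) := by
      refine intervalIntegral.integral_congr_ae ?_
      have hae := hbad.ae_notMem MeasureTheory.volume
      filter_upwards [hae] with t ht _
      exact hsum t ht
    rw [h1, intervalIntegral.integral_const, smul_eq_mul]
    ring
  rw [intervalIntegral.integral_finsetSum] at hInt
  · have hterm : ∀ T ∈ adjacentFacets G (IsFacet fun v => kleinLift (x v)) S,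
        ∫ t in (-Real.pi)..Real.pi, (if 0 < minkForm (Nrm T) (q t) then (1 : ℝ) else 0) =
          2 * halfVisualAngle N (Nrm T) Z := by
      intro T hTadj
      obtain ⟨hT, hTS, a, b, hab, haS, hbS, haT, hbT⟩ := mem_adjacentFacets.1 hTadj
      have hTN := hN T hT
      have hlt := hSN.abs_minkForm_lt_one h hab.ne hTN hS hTS.symm haS hbS haT hbT
      set M := Nrm T
      set c := minkForm N M with hc
      set s := √(1 - c ^ 2) with hs
      have hc2 : c ^ 2 < 1 := by
        rw [← sq_abs]
        nlinarith [abs_nonneg c]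
      have hspos : 0 < s := Real.sqrt_pos.2 (by linarith)
      have hs2 : s ^ 2 = 1 - c ^ 2 := Real.sq_sqrt (by linarith)
      set σ := (minkForm M Z / minkForm N Z - c) / s with hσ
      -- In the frame of the plane, the part of `M` orthogonal to `N` has time product `-σ s` and
      -- spatial length `s √(1 + σ²)`. The arc beyond the edge is therefore `2 arccos(σ / √(1 +
      -- σ²))`.
      have hoM : minkForm o M = -(σ * s) := by
        simp only [ho, map_add, map_smul, LinearMap.add_apply, LinearMap.smul_apply, smul_eq_mul,
          ← hc, hσ, hNZk, minkForm_comm Z M]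
        field_simp
        ring
      have hproj : minkForm e₁ M ^ 2 + minkForm e₂ M ^ 2 = s ^ 2 * (1 + σ ^ 2) := by
        have h1 := hnorm (M - c • N) (by simp [← hc, hSN.self])
        simp only [map_sub, map_smul, LinearMap.sub_apply, LinearMap.smul_apply, smul_eq_mul,
          hTN.self, hSN.self, minkForm_comm M N, ← hc, hoM, minkForm_comm o N, hNo,
          minkForm_comm e₁ N, hN1, minkForm_comm e₂ N, hN2] at h1
        linear_combination -hs2 - h1
      simp only [hq]
      rw [intervalIntegral_arc (by rw [hproj, hoM]; nlinarith [sq_pos_of_pos hspos]), hproj, hoM,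
        neg_neg, Real.sqrt_mul (sq_nonneg s), Real.sqrt_sq hspos.le, mul_comm σ s,
        mul_div_mul_left _ _ hspos.ne', arccos_div_sqrt]
      rfl
    rw [Finset.sum_congr rfl hterm, ← Finset.mul_sum] at hInt
    linarith
  · intro T _
    have : Continuous fun t => minkForm (Nrm T) (q t) := by
      simp only [hq]
      fun_prop
    exact intervalIntegrable_ite_lt this _ _

end VisualAngle

/-- Otherwise the two facets at an edge not containing `v` would both contain `v` as well, and
facets with three common vertices coincide. -/
theorem IsConeConfig.exists_facet_avoiding {V W : Type*} [AddCommGroup W] [Module ℝ W]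
    {G : SimpleGraph V} {X : V → W} [Finite V] (h : IsConeConfig G X) {v u : V} (hvu : v ≠ u) :
    ∃ S, IsFacet X S ∧ v ∉ S := by
  obtain ⟨S, hS, hv⟩ := h.exists_facet_of_vertex hvu
  obtain ⟨a, -, -, ha, -, haS, -⟩ := h.exists_two_adj_in_facet hS hv
  obtain ⟨b, c, hbc, hb, hc, hbS, hcS, -⟩ := h.exists_two_adj_in_facet hS haS
  obtain ⟨z, hz, hzS, hzv⟩ : ∃ z, G.Adj a z ∧ z ∈ S ∧ z ≠ v := by
    by_cases hbv : b = v
    · exact ⟨c, hc, hcS, fun hcv => hbc (hbv.trans hcv.symm)⟩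
    · exact ⟨b, hb, hbS, hbv⟩
  by_contra! hall
  obtain ⟨A, B, ⟨φ, hφ, rfl⟩, ⟨ψ, hψ, rfl⟩, hAB, haA, hzA, haB, hzB, -⟩ := h.exists_two_facets hz
  have hvA := hall _ ⟨φ, hφ, rfl⟩
  have hvB := hall _ ⟨ψ, hψ, rfl⟩
  obtain ⟨r, hr⟩ := h.exists_smul_of_three ha.ne hzv.symm hz.ne hφ.ne_zero hvA haA hzA hvB haB hzB
  have hr0 : r ≠ 0 := by
    rintro rfl
    exact hψ.ne_zero (by rw [hr, zero_smul])
  apply hAB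
  ext w
  simp [hr, hr0]

/-! ### Comparison of two realizations -/

section Compare

variable {V : Type*} [Finite V] {G : SimpleGraph V} {w : G.edgeSet → ℝ} {x y : V → E3}

theorem IsIdealRealization.isFacet_iff (hx : IsIdealRealization G w x)
    (hy : IsIdealRealization G w y) (S : Set V) :
    IsFacet (fun v => kleinLift (x v)) S ↔ IsFacet (fun v => kleinLift (y v)) S :=
  ⟨hx.isConeConfig.isFacet_of_isFacet hy.isConeConfig,
    hy.isConeConfig.isFacet_of_isFacet hx.isConeConfig⟩

/-- The maximum principle: the Minkowski products of a vertex with the facet normals agree in both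
realizations, up to a factor depending on the vertex only. -/
theorem IsIdealRealization.exists_ratio (hx : IsIdealRealization G w x)
    (hy : IsIdealRealization G w y) {N M : Set V → Mink}
    (hN : ∀ S, IsFacet (fun v => kleinLift (x v)) S → IsUnitNormal x S (N S))
    (hM : ∀ S, IsFacet (fun v => kleinLift (y v)) S → IsUnitNormal y S (M S))
    (hcos : ∀ S T u v, G.Adj u v → IsFacet (fun v => kleinLift (x v)) S →
      IsFacet (fun v => kleinLift (x v)) T → S ≠ T → u ∈ S → v ∈ S → u ∈ T → v ∈ T →
      minkForm (N S) (N T) = minkForm (M S) (M T)) {v₀ v₁ : V} (h01 : v₀ ≠ v₁) :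
    ∃ ρ > 0, ∀ S, IsFacet (fun v => kleinLift (x v)) S →
      minkForm (M S) (kleinLift (y v₀)) = ρ * minkForm (N S) (kleinLift (x v₀)) := by
  have := Fintype.ofFinite V
  set n : Set V → ℝ := fun S => minkForm (N S) (kleinLift (x v₀)) with hn
  set m : Set V → ℝ := fun S => minkForm (M S) (kleinLift (y v₀)) with hm
  have hfac := hx.isFacet_iff hy
  have hn0 : ∀ S, IsFacet (fun v => kleinLift (x v)) S → v₀ ∉ S → n S < 0 := fun S hS hv =>
    lt_of_le_of_ne ((hN S hS).nonpos v₀) fun h0 => hv (((hN S hS).mem_iff v₀).2 h0)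
  have hm0 : ∀ S, IsFacet (fun v => kleinLift (x v)) S → v₀ ∉ S → m S < 0 := fun S hS hv =>
    lt_of_le_of_ne ((hM S ((hfac S).1 hS)).nonpos v₀)
      fun h0 => hv (((hM S ((hfac S).1 hS)).mem_iff v₀).2 h0)
  obtain ⟨S₁, hS₁, hvS₁⟩ := hx.isConeConfig.exists_facet_avoiding h01
  obtain ⟨S₀, ⟨hS₀, hvS₀⟩, hmax⟩ := Set.exists_max_image
    {S | IsFacet (fun v => kleinLift (x v)) S ∧ v₀ ∉ S} (fun S => m S / n S) (Set.toFinite _)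
    ⟨S₁, hS₁, hvS₁⟩
  set ρ := m S₀ / n S₀ with hρ
  have hρpos : 0 < ρ := div_pos_of_neg_of_neg (hm0 S₀ hS₀ hvS₀) (hn0 S₀ hS₀ hvS₀)
  have hadj : adjacentFacets G (IsFacet fun v => kleinLift (y v)) =
      adjacentFacets G (IsFacet fun v => kleinLift (x v)) := by
    funext S
    ext T
    rw [mem_adjacentFacets, mem_adjacentFacets, hfac]
  have key : ∀ S T, IsFacet (fun v => kleinLift (x v)) S → IsFacet (fun v => kleinLift (x v)) T →
      v₀ ∉ S → v₀ ∉ T → (∃ u v, G.Adj u v ∧ u ∈ S ∧ v ∈ S ∧ u ∈ T ∧ v ∈ T) →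
      m S / n S = ρ → m T / n T = ρ := by
    intro S T hS hT hvS hvT hedge hSρ
    by_cases hTS : T = S
    · rwa [hTS]
    have hnS := hn0 S hS hvS
    have hmS : m S = ρ * n S := by rw [← hSρ, div_mul_cancel₀ _ hnS.ne]
    have hsx := hx.sum_halfVisualAngle hN hS hvS
    have hsy := hy.sum_halfVisualAngle hM ((hfac S).1 hS) hvS
    rw [hadj] at hsy
    -- Maximality of the ratio at `S`; for facets containing `v₀` both sides are zero.
    have hratio : ∀ R, IsFacet (fun v => kleinLift (x v)) R → m R / m S ≤ n R / n S := by
      intro R hR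
      by_cases hvR : v₀ ∈ R
      · have e1 : n R = 0 := ((hN R hR).mem_iff v₀).1 hvR
        have e2 : m R = 0 := ((hM R ((hfac R).1 hR)).mem_iff v₀).1 hvR
        rw [e1, e2, zero_div, zero_div]
      · have hnR := hn0 R hR hvR
        have h1 := hmax R ⟨hR, hvR⟩
        have h2 : m R = m R / n R * n R := by rw [div_mul_cancel₀ _ hnR.ne]
        rw [hmS, h2, mul_div_mul_comm]
        have h3 : m R / n R / ρ ≤ 1 := by rwa [div_le_one hρpos]
        have h4 : 0 ≤ n R / n S := (div_pos_of_neg_of_neg hnR hnS).le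
        nlinarith
    have hle : ∀ R ∈ adjacentFacets G (IsFacet fun v => kleinLift (x v)) S,
        halfVisualAngle (N S) (N R) (kleinLift (x v₀)) ≤
          halfVisualAngle (M S) (M R) (kleinLift (y v₀)) := by
      intro R hRadj
      obtain ⟨hR, hRS, a, b, hab, haS, hbS, haR, hbR⟩ := mem_adjacentFacets.1 hRadj
      simp only [halfVisualAngle, hcos S R a b hab hS hR (Ne.symm hRS) haS hbS haR hbR]
      refine sub_le_sub_left (Real.arctan_strictMono.monotone ?_) _
      exact div_le_div_of_nonneg_right (sub_le_sub_right (hratio R hR) _) (Real.sqrt_nonneg _)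
    obtain ⟨a, b, hab, haS, hbS, haT, hbT⟩ := hedge
    -- Both families of half angles sum to `π`, so termwise inequality becomes equality.
    have heq := (Finset.sum_eq_sum_iff_of_le hle).1 (hsx.trans hsy.symm) T
      (mem_adjacentFacets.2 ⟨hT, hTS, a, b, hab, haS, hbS, haT, hbT⟩)
    have hlt := (hM S ((hfac S).1 hS)).abs_minkForm_lt_one hy hab.ne (hM T ((hfac T).1 hT))
      ((hfac S).1 hS) (Ne.symm hTS) haS hbS haT hbT
    have hspos : 0 < √(1 - minkForm (M S) (M T) ^ 2) := by
      apply Real.sqrt_pos.2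
      rw [← sq_abs]
      nlinarith [abs_nonneg (minkForm (M S) (M T))]
    simp only [halfVisualAngle, hcos S T a b hab hS hT (Ne.symm hTS) haS hbS haT hbT] at heq
    have h1 := Real.arctan_injective (sub_right_injective heq)
    have h2 := (div_left_inj' hspos.ne').1 h1
    have h3 : n T / n S = m T / m S := sub_left_injective h2
    have hnT := hn0 T hT hvT
    rw [hmS, div_eq_div_iff hnS.ne (mul_ne_zero hρpos.ne' hnS.ne)] at h3
    rw [div_eq_iff hnT.ne]
    have h4 : n S * (m T - ρ * n T) = 0 := by linear_combination -h3
    linarith [(mul_eq_zero.1 h4).resolve_left hnS.ne]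
  have hall := hx.isConeConfig.facet_connected v₀ (P := fun S => m S / n S = ρ)
    (fun S T hS hT hvS hvT hedge => ⟨key S T hS hT hvS hvT hedge, key T S hT hS hvT hvS (by
      obtain ⟨a, b, h1, h2, h3, h4, h5⟩ := hedge
      exact ⟨a, b, h1, h4, h5, h2, h3⟩)⟩) hS₀ hvS₀ rfl
  refine ⟨ρ, hρpos, fun S hS => ?_⟩
  by_cases hv : v₀ ∈ S
  · rw [((hN S hS).mem_iff v₀).1 hv, ((hM S ((hfac S).1 hS)).mem_iff v₀).1 hv, mul_zero]
  · exact (div_eq_iff (hn0 S hS hv).ne).1 (hall S hS hv)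

/-- The unit normals of the two facets at an edge span the orthogonal complement of the edge. -/
theorem IsIdealRealization.exists_eq_combination (h : IsIdealRealization G w x) {u v : V}
    (huv : G.Adj u v) {S T : Set V} {N M : Mink} (hN : IsUnitNormal x S N)
    (hM : IsUnitNormal x T M) (hS : IsFacet (fun v => kleinLift (x v)) S)
    (hST : S ≠ T) (huS : u ∈ S) (hvS : v ∈ S)
    (huT : u ∈ T) (hvT : v ∈ T) {Z : Mink} (hZu : minkForm Z (kleinLift (x u)) = 0)
    (hZv : minkForm Z (kleinLift (x v)) = 0) : ∃ p q : ℝ, Z = p • N + q • M := by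
  obtain ⟨φ₁, φ₂, hφ₁, hφ₂, h1u, h1v, h2u, h2v, hint, hall⟩ := h.isConeConfig.pencil huv
  have hcomb : ∀ {Z : Mink}, minkForm Z (kleinLift (x u)) = 0 →
      minkForm Z (kleinLift (x v)) = 0 → ∃ s t : ℝ, minkForm Z = s • φ₁ + t • φ₂ :=
    fun h1 h2 => hall _ h1 h2
  obtain ⟨a, b, hab⟩ := hcomb ((hN.mem_iff u).1 huS) ((hN.mem_iff v).1 hvS)
  obtain ⟨c, d, hcd⟩ := hcomb ((hM.mem_iff u).1 huT) ((hM.mem_iff v).1 hvT)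
  obtain ⟨s, t, hst⟩ := hcomb hZu hZv
  -- A zero determinant would make the normals dependent, against the product of absolute value less
  -- than one. Otherwise Cramer's rule gives the coefficients.
  by_cases hdet : a * d - b * c = 0
  · exfalso
    have hlt := hN.abs_minkForm_lt_one h huv.ne hM hS hST huS hvS huT hvT
    have hNM : d • N = b • M ∧ c • N = a • M := by
      constructor
      · apply minkForm_injective
        rw [map_smul, map_smul, hab, hcd]
        have : a * d = b * c := by linarith
        simp only [smul_add, smul_smul, this, mul_comm d]
      · apply minkForm_injective
        rw [map_smul, map_smul, hab, hcd]
        have : a * d = b * c := by linarith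
        simp only [smul_add, smul_smul]
        rw [mul_comm c a, mul_comm c b, this]
    have e1 := congrArg (minkForm N) hNM.1
    have e2 := congrArg (fun Z => minkForm Z M) hNM.1
    have e3 := congrArg (minkForm N) hNM.2
    have e4 := congrArg (fun Z => minkForm Z M) hNM.2
    simp only [map_smul, LinearMap.smul_apply, smul_eq_mul, hN.self, hM.self, mul_one]
      at e1 e2 e3 e4
    set k := minkForm N M
    have hk : 0 < 1 - k ^ 2 := by
      rw [← sq_abs]
      nlinarith [abs_nonneg k]
    have hb : b * (1 - k ^ 2) = 0 := by rw [e1] at e2; linear_combination -e2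
    have ha : a * (1 - k ^ 2) = 0 := by rw [e3] at e4; linear_combination -e4
    have ha0 := (mul_eq_zero.1 ha).resolve_right hk.ne'
    have hb0 := (mul_eq_zero.1 hb).resolve_right hk.ne'
    have hN0 : N = 0 := by
      apply minkForm_injective
      rw [hab, ha0, hb0]
      simp
    have := hN.self
    rw [hN0] at this
    simp at this
  · refine ⟨(s * d - t * c) / (a * d - b * c), (t * a - s * b) / (a * d - b * c), ?_⟩
    apply minkForm_injective
    rw [map_add, map_smul, map_smul, hab, hcd, hst]
    set D := a * d - b * c with hD
    have e1 : (s * d - t * c) / D * a + (t * a - s * b) / D * c = s := by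
      field_simp
      rw [hD]
      ring
    have e2 : (s * d - t * c) / D * b + (t * a - s * b) / D * d = t := by
      field_simp
      rw [hD]
      ring
    refine Eq.trans (b := ((s * d - t * c) / D * a + (t * a - s * b) / D * c) • φ₁ +
      ((s * d - t * c) / D * b + (t * a - s * b) / D * d) • φ₂) (by rw [e1, e2]) ?_
    module

/-- At a corner of a facet, the unit conormals of its two edges add up to a multiple of the
vertex. -/
theorem IsIdealRealization.exists_corner (h : IsIdealRealization G w x) {v a b : V}
    (ha : G.Adj v a) (hb : G.Adj v b) (hab : a ≠ b) {S S₁ S₂ : Set V} {N N₁ N₂ : Mink}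
    (hN : IsUnitNormal x S N) (hN₁ : IsUnitNormal x S₁ N₁) (hN₂ : IsUnitNormal x S₂ N₂)
    (hS : IsFacet (fun v => kleinLift (x v)) S) (hS₁ : IsFacet (fun v => kleinLift (x v)) S₁)
    (hS₂ : IsFacet (fun v => kleinLift (x v)) S₂) (h1 : S ≠ S₁) (h2 : S ≠ S₂) (hvS : v ∈ S)
    (haS : a ∈ S) (hbS : b ∈ S) (hv1 : v ∈ S₁) (ha1 : a ∈ S₁) (hv2 : v ∈ S₂) (hb2 : b ∈ S₂) :
    ∃ t : ℝ, 0 < t ∧ (√(1 - minkForm N N₁ ^ 2))⁻¹ • (N₁ - minkForm N N₁ • N) +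
      (√(1 - minkForm N N₂ ^ 2))⁻¹ • (N₂ - minkForm N N₂ • N) = t • kleinLift (x v) := by
  have hc := h.isConeConfig
  have notmem : ∀ {T : Set V} {z z' : V}, IsFacet (fun v => kleinLift (x v)) T → S ≠ T → v ∈ T →
      z ∈ S → z ∈ T → v ≠ z → v ≠ z' → z ≠ z' → z' ∈ S → z' ∉ T := by
    intro T z z' hT hST hvT hzS hzT hvz hvz' hzz' hz'S hz'T
    obtain ⟨φ, hφ, rfl⟩ := hS
    obtain ⟨ψ, hψ, rfl⟩ := hT
    obtain ⟨r, hr⟩ := hc.exists_smul_of_three hvz hvz' hzz' hφ.ne_zero hvS hzS hz'S hvT hzT hz'T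
    have hr0 : r ≠ 0 := by
      rintro rfl
      exact hψ.ne_zero (by rw [hr, zero_smul])
    exact hST (by ext w; simp [hr, hr0])
  have hb1 : b ∉ S₁ := notmem hS₁ h1 hv1 haS ha1 ha.ne hb.ne hab hbS
  have ha2 : a ∉ S₂ := notmem hS₂ h2 hv2 hbS hb2 hb.ne ha.ne hab.symm haS
  have hlt1 := hN.abs_minkForm_lt_one h ha.ne hN₁ hS h1 hvS haS hv1 ha1
  have hlt2 := hN.abs_minkForm_lt_one h hb.ne hN₂ hS h2 hvS hbS hv2 hb2
  have hs : ∀ c : ℝ, |c| < 1 → 0 < 1 - c ^ 2 := by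
    intro c hc
    rw [← sq_abs]
    nlinarith [abs_nonneg c]
  set c₁ := minkForm N N₁ with hc1
  set c₂ := minkForm N N₂ with hc2
  have hs1 := hs c₁ hlt1
  have hs2 := hs c₂ hlt2
  have hr1 := Real.sqrt_pos.2 hs1
  have hr2 := Real.sqrt_pos.2 hs2
  have hq1 := Real.sq_sqrt hs1.le
  have hq2 := Real.sq_sqrt hs2.le
  set s₁ := √(1 - c₁ ^ 2)
  set s₂ := √(1 - c₂ ^ 2)
  set M₁ := s₁⁻¹ • (N₁ - c₁ • N) with hM1
  set M₂ := s₂⁻¹ • (N₂ - c₂ • N) with hM2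
  have nv := (hN.mem_iff v).1 hvS
  have na := (hN.mem_iff a).1 haS
  have nb := (hN.mem_iff b).1 hbS
  have n1v := (hN₁.mem_iff v).1 hv1
  have n1a := (hN₁.mem_iff a).1 ha1
  have n2v := (hN₂.mem_iff v).1 hv2
  have n2b := (hN₂.mem_iff b).1 hb2
  have n1b : minkForm N₁ (kleinLift (x b)) < 0 :=
    lt_of_le_of_ne (hN₁.nonpos b) fun h0 => hb1 ((hN₁.mem_iff b).2 h0)
  have n2a : minkForm N₂ (kleinLift (x a)) < 0 :=
    lt_of_le_of_ne (hN₂.nonpos a) fun h0 => ha2 ((hN₂.mem_iff a).2 h0)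
  have m2v : minkForm M₂ (kleinLift (x v)) = 0 := by simp [hM2, n2v, nv]
  have m2b : minkForm M₂ (kleinLift (x b)) = 0 := by simp [hM2, n2b, nb]
  have m2a : minkForm M₂ (kleinLift (x a)) < 0 := by
    simp only [hM2, map_smul, map_sub, LinearMap.smul_apply, LinearMap.sub_apply, na, smul_eq_mul,
      mul_zero, sub_zero]
    exact mul_neg_of_pos_of_neg (inv_pos.2 hr2) n2a
  have m2N : minkForm M₂ N = 0 := by
    simp [hM2, minkForm_comm N₂ N, ← hc2, hN.self]
  have m22 : minkForm M₂ M₂ = 1 := by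
    simp only [hM2, map_smul, map_sub, LinearMap.smul_apply, LinearMap.sub_apply, smul_eq_mul,
      hN.self, hN₂.self, minkForm_comm N₂ N, ← hc2]
    field_simp
    linear_combination -hq2
  have m11 : minkForm M₁ M₁ = 1 := by
    simp only [hM1, map_smul, map_sub, LinearMap.smul_apply, LinearMap.sub_apply, smul_eq_mul,
      hN.self, hN₁.self, minkForm_comm N₁ N, ← hc1]
    field_simp
    linear_combination -hq1
  have m1b : minkForm M₁ (kleinLift (x b)) < 0 := by
    simp only [hM1, map_smul, map_sub, LinearMap.smul_apply, LinearMap.sub_apply, nb, smul_eq_mul,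
      mul_zero, sub_zero]
    exact mul_neg_of_pos_of_neg (inv_pos.2 hr1) n1b
  have va := minkForm_kleinLift_neg (h.ideal v) (h.ideal a) (h.injective.ne ha.ne)
  have vb := minkForm_kleinLift_neg (h.ideal v) (h.ideal b) (h.injective.ne hb.ne)
  have vv := minkForm_kleinLift_self (h.ideal v)
  -- `t` is chosen to make `t v - M₂` orthogonal to `a`. This vector is also orthogonal to `v` and
  -- `N`, and has square one, so it is `M₁` or `-M₁`; its negative product with `b` selects `M₁`.
  set t := minkForm M₂ (kleinLift (x a)) / minkForm (kleinLift (x v)) (kleinLift (x a)) with ht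
  have htpos : 0 < t := div_pos_of_neg_of_neg m2a va
  have htm : t * minkForm (kleinLift (x v)) (kleinLift (x a)) = minkForm M₂ (kleinLift (x a)) := by
    rw [ht, div_mul_cancel₀ _ va.ne]
  set E := t • kleinLift (x v) - M₂ with hE
  obtain ⟨p, q, hpq⟩ := h.exists_eq_combination ha hN hN₁ hS h1 hvS haS hv1 ha1 (Z := E)
    (by simp [hE, vv, m2v]) (by simp [hE, htm])
  have hEN : minkForm E N = 0 := by
    simp [hE, m2N, minkForm_comm _ N, nv]
  have hEE : minkForm E E = 1 := by
    simp only [hE, map_sub, map_smul, LinearMap.sub_apply, LinearMap.smul_apply, smul_eq_mul, vv,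
      m22, m2v, minkForm_comm (kleinLift (x v)) M₂]
    ring
  have hp : p = -q * c₁ := by
    rw [hpq] at hEN
    simp only [map_add, map_smul, LinearMap.add_apply, LinearMap.smul_apply, smul_eq_mul, hN.self,
      minkForm_comm N₁ N, ← hc1] at hEN
    linarith
  have hEM : E = (q * s₁) • M₁ := by
    rw [hpq, hp, hM1, smul_smul, mul_assoc, mul_inv_cancel₀ hr1.ne', mul_one, smul_sub, smul_smul]
    module
  have hk2 : (q * s₁) ^ 2 = 1 := by
    rw [hEM] at hEE
    simp only [map_smul, LinearMap.smul_apply, smul_eq_mul, m11] at hEE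
    linarith
  have hEb : minkForm E (kleinLift (x b)) < 0 := by
    simp only [hE, map_sub, map_smul, LinearMap.sub_apply, LinearMap.smul_apply, smul_eq_mul, m2b,
      sub_zero]
    exact mul_neg_of_pos_of_neg htpos vb
  have hkpos : 0 < q * s₁ := by
    rw [hEM] at hEb
    simp only [map_smul, LinearMap.smul_apply, smul_eq_mul] at hEb
    exact pos_of_mul_neg_left hEb m1b.le
  have hk : q * s₁ = 1 := by nlinarith
  rw [hk, one_smul] at hEM
  exact ⟨t, htpos, by rw [← hEM, hE, sub_add_cancel]⟩

/-- The Gram matrices of the ideal vertices agree after rescaling. -/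
theorem IsIdealRealization.exists_gram (hx : IsIdealRealization G w x)
    (hy : IsIdealRealization G w y) :
    ∃ b : V → ℝ, (∀ v, 0 < b v) ∧ ∀ u v, minkForm (kleinLift (y u)) (kleinLift (y v)) =
      b u * b v * minkForm (kleinLift (x u)) (kleinLift (x v)) := by
  have hfac := hx.isFacet_iff hy
  choose! N hN using fun S (hS : IsFacet (fun v => kleinLift (x v)) S) =>
    hx.exists_isUnitNormal hS
  choose! M hM using fun S (hS : IsFacet (fun v => kleinLift (y v)) S) =>
    hy.exists_isUnitNormal hS
  have hcos : ∀ S T u v, G.Adj u v → IsFacet (fun v => kleinLift (x v)) S →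
      IsFacet (fun v => kleinLift (x v)) T → S ≠ T → u ∈ S → v ∈ S → u ∈ T → v ∈ T →
      minkForm (N S) (N T) = minkForm (M S) (M T) := by
    intro S T u v huv hS hT hST h1 h2 h3 h4
    rw [hx.minkForm_unitNormal huv (hN S hS) (hN T hT) hS hT hST h1 h2 h3 h4,
      hy.minkForm_unitNormal huv (hM S ((hfac S).1 hS)) (hM T ((hfac T).1 hT)) ((hfac S).1 hS)
        ((hfac T).1 hT) hST h1 h2 h3 h4]
  have hother : ∀ v : V, ∃ u, v ≠ u := by
    intro v
    by_contra! hc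
    have hsub : Set.range (fun v => kleinLift (x v)) ⊆ {kleinLift (x v)} := by
      rintro _ ⟨u, rfl⟩
      rw [← hc u]
      rfl
    have h1 : (⊤ : Submodule ℝ Mink) ≤ Submodule.span ℝ {kleinLift (x v)} := by
      rw [← hx.isConeConfig.span]
      exact Submodule.span_mono hsub
    have h2 := Submodule.finrank_mono h1
    rw [finrank_top, finrank_mink] at h2
    have h3 := finrank_span_le_card (R := ℝ) ({kleinLift (x v)} : Set Mink)
    simp only [Set.toFinset_singleton, Finset.card_singleton] at h3
    omega
  have hratio : ∀ v, ∃ ρ > 0, ∀ S, IsFacet (fun v => kleinLift (x v)) S →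
      minkForm (M S) (kleinLift (y v)) = ρ * minkForm (N S) (kleinLift (x v)) := by
    intro v
    obtain ⟨u, hu⟩ := hother v
    exact hx.exists_ratio hy hN hM hcos hu
  choose ρ hρ hρN using hratio
  -- The corner identity writes a multiple of vertex `v` in normals, with coefficients common to
  -- both realizations. Pairing with vertex `u` brings in only the factor `ρ u`.
  have hlam : ∀ v, ∃ l > 0, ∀ u, minkForm (kleinLift (y v)) (kleinLift (y u)) =
      ρ u * l * minkForm (kleinLift (x v)) (kleinLift (x u)) := by
    intro v
    obtain ⟨u, hu⟩ := hother v
    obtain ⟨S, hS, hvS⟩ := hx.isConeConfig.exists_facet_of_vertex hu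
    obtain ⟨a, b, hab, ha, hb, haS, hbS, -⟩ := hx.isConeConfig.exists_two_adj_in_facet hS hvS
    have hex : ∀ z, G.Adj v z → z ∈ S → ∃ T, IsFacet (fun v => kleinLift (x v)) T ∧ S ≠ T ∧
        v ∈ T ∧ z ∈ T := by
      intro z hz hzS
      obtain ⟨A, B, hA, hB, hAB, h1, h2, h3, h4, -⟩ := hx.isConeConfig.exists_two_facets hz
      by_cases hSA : S = A
      · exact ⟨B, hB, fun hSB => hAB (hSA.symm.trans hSB), h3, h4⟩
      · exact ⟨A, hA, hSA, h1, h2⟩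
    obtain ⟨S₁, hS₁, h1, hv1, ha1⟩ := hex a ha haS
    obtain ⟨S₂, hS₂, h2, hv2, hb2⟩ := hex b hb hbS
    obtain ⟨t, ht, e⟩ := hx.exists_corner ha hb hab (hN S hS) (hN S₁ hS₁) (hN S₂ hS₂) hS hS₁ hS₂
      h1 h2 hvS haS hbS hv1 ha1 hv2 hb2
    have hS' := (hfac S).1 hS
    have hS₁' := (hfac S₁).1 hS₁
    have hS₂' := (hfac S₂).1 hS₂
    obtain ⟨t', ht', e'⟩ := hy.exists_corner ha hb hab (hM S hS') (hM S₁ hS₁') (hM S₂ hS₂') hS'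
      hS₁' hS₂' h1 h2 hvS haS hbS hv1 ha1 hv2 hb2
    rw [← hcos S S₁ v a ha hS hS₁ h1 hvS haS hv1 ha1,
      ← hcos S S₂ v b hb hS hS₂ h2 hvS hbS hv2 hb2] at e'
    refine ⟨t / t', div_pos ht ht', fun u => ?_⟩
    have f := congrArg (fun Z => minkForm Z (kleinLift (x u))) e
    have f' := congrArg (fun Z => minkForm Z (kleinLift (y u))) e'
    simp only [map_add, map_sub, map_smul, LinearMap.add_apply, LinearMap.sub_apply,
      LinearMap.smul_apply, smul_eq_mul] at f f'
    rw [hρN u S hS, hρN u S₁ hS₁, hρN u S₂ hS₂] at f'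
    have : t' * minkForm (kleinLift (y v)) (kleinLift (y u)) =
        ρ u * (t * minkForm (kleinLift (x v)) (kleinLift (x u))) := by
      rw [← f, ← f']
      ring
    field_simp
    linarith
  choose l hl hlρ using hlam
  -- Symmetry of the form makes `l` proportional to `ρ`.
  have hprop : ∀ u v, ρ u * l v = ρ v * l u := by
    intro u v
    by_cases huv : u = v
    · rw [huv]
    have h1 := hlρ v u
    have h2 := hlρ u v
    rw [minkForm_comm, h2, minkForm_comm (kleinLift (x v))] at h1
    exact (mul_right_cancel₀ (minkForm_kleinLift_neg (hx.ideal u) (hx.ideal v)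
      (hx.injective.ne huv)).ne h1).symm
  by_cases hV : Nonempty V
  · obtain ⟨v₁⟩ := hV
    set μ := l v₁ / ρ v₁ with hμ
    have hμpos : 0 < μ := div_pos (hl v₁) (hρ v₁)
    have hlμ : ∀ v, l v = μ * ρ v := by
      intro v
      have := hprop v v₁
      have hne := (hρ v₁).ne'
      rw [hμ]
      field_simp
      linarith
    refine ⟨fun v => √μ * ρ v, fun v => mul_pos (Real.sqrt_pos.2 hμpos) (hρ v), fun u v => ?_⟩
    rw [hlρ u v, hlμ u]
    have := Real.mul_self_sqrt hμpos.le
    linear_combination -(ρ u * ρ v * minkForm (kleinLift (x u)) (kleinLift (x v))) * this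
  · exact ⟨fun _ => 1, fun _ => one_pos, fun u => absurd ⟨u⟩ hV⟩

end Compare

/-! ### The Lorentz transformation -/

/-- A linear map matching two spanning families of Minkowski space with the same Gram matrix. -/
theorem exists_isometry_of_gram {V : Type*} [Finite V] {A B : V → Mink}
    (hA : Submodule.span ℝ (Set.range A) = ⊤) (hB : Submodule.span ℝ (Set.range B) = ⊤)
    (hAB : ∀ u v, minkForm (A u) (A v) = minkForm (B u) (B v)) :
    ∃ L : Mink →ₗ[ℝ] Mink, (∀ v, L (A v) = B v) ∧
      ∀ a b, minkForm (L a) (L b) = minkForm a b := by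
  classical
  have := Fintype.ofFinite V
  have hform : ∀ c d : V → ℝ,
      minkForm (Fintype.linearCombination ℝ B c) (Fintype.linearCombination ℝ B d) =
        minkForm (Fintype.linearCombination ℝ A c) (Fintype.linearCombination ℝ A d) := by
    intro c d
    simp only [Fintype.linearCombination_apply, map_sum, map_smul, LinearMap.sum_apply,
      LinearMap.smul_apply, hAB]
  have hsurj : ∀ {C : V → Mink}, Submodule.span ℝ (Set.range C) = ⊤ →
      Function.Surjective (Fintype.linearCombination ℝ C) := by
    intro C hC
    rw [← LinearMap.range_eq_top, Fintype.range_linearCombination, hC]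
  -- Any linear choice `R` of coefficients works: equal Gram matrices and nondegeneracy make the
  -- image independent of the choice.
  obtain ⟨R, hR⟩ := (Fintype.linearCombination ℝ A).exists_rightInverse_of_surjective
    (LinearMap.range_eq_top.2 (hsurj hA))
  have hR' : ∀ a, Fintype.linearCombination ℝ A (R a) = a := fun a => LinearMap.congr_fun hR a
  refine ⟨Fintype.linearCombination ℝ B ∘ₗ R, fun v => ?_, fun a b => ?_⟩
  · rw [LinearMap.comp_apply, ← sub_eq_zero]
    apply minkForm_injective
    refine LinearMap.ext fun Z => ?_
    obtain ⟨d, rfl⟩ := hsurj hB Z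
    have h1 := hform (R (A v)) d
    have h2 := hform (Pi.single v 1) d
    rw [hR'] at h1
    rw [Fintype.linearCombination_apply_single, Fintype.linearCombination_apply_single, one_smul,
      one_smul] at h2
    rw [map_sub, LinearMap.sub_apply, h1, h2, sub_self, map_zero, LinearMap.zero_apply]
  · rw [LinearMap.comp_apply, LinearMap.comp_apply, hform, hR', hR']

/-- Linear automorphisms of Minkowski space matching the lifted ideal vertices up to positive
factors. -/
theorem IsIdealRealization.exists_lorentz {V : Type*} [Finite V] {G : SimpleGraph V}
    {w : G.edgeSet → ℝ} {x y : V → E3} (hx : IsIdealRealization G w x)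
    (hy : IsIdealRealization G w y) :
    ∃ (L : Mink ≃ₗ[ℝ] Mink) (b : V → ℝ), (∀ v, 0 < b v) ∧
      (∀ v, L (kleinLift (x v)) = b v • kleinLift (y v)) ∧
      ∀ a b, minkForm (L a) (L b) = minkForm a b := by
  obtain ⟨b, hb, hgram⟩ := hx.exists_gram hy
  have hspan : Submodule.span ℝ (Set.range fun v => (b v)⁻¹ • kleinLift (y v)) = ⊤ := by
    rw [eq_top_iff, ← hy.isConeConfig.span, Submodule.span_le]
    rintro _ ⟨v, rfl⟩
    have := Submodule.smul_mem _ (b v) (Submodule.subset_span (R := ℝ)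
      (Set.mem_range_self (f := fun v => (b v)⁻¹ • kleinLift (y v)) v))
    simpa [smul_smul, mul_inv_cancel₀ (hb v).ne'] using this
  have hgram' : ∀ u v, minkForm (kleinLift (x u)) (kleinLift (x v)) =
      minkForm ((b u)⁻¹ • kleinLift (y u)) ((b v)⁻¹ • kleinLift (y v)) := by
    intro u v
    have := (hb u).ne'
    have := (hb v).ne'
    simp only [map_smul, LinearMap.smul_apply, smul_eq_mul, hgram]
    field_simp
  obtain ⟨L, hL, hLform⟩ := exists_isometry_of_gram hx.isConeConfig.span hspan hgram'
  have hinj : Function.Injective L := by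
    rw [← LinearMap.ker_eq_bot, LinearMap.ker_eq_bot']
    intro a ha
    apply minkForm_injective
    refine LinearMap.ext fun Z => ?_
    rw [← hLform, ha, map_zero, LinearMap.zero_apply, LinearMap.zero_apply]
  refine ⟨LinearEquiv.ofInjectiveEndo L hinj, fun v => (b v)⁻¹, fun v => inv_pos.2 (hb v),
    fun v => hL v, fun a b => hLform a b⟩

/-! ### Action on hyperbolic space -/

/-- A linear automorphism preserving the Minkowski form and the future. -/
structure IsOrthochronous (L : Mink ≃ₗ[ℝ] Mink) : Prop where
  form : ∀ a b, minkForm (L a) (L b) = minkForm a b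
  pos : ∀ p : H3, 0 < (L (kleinLift p)).1

theorem minkForm_kleinLift_kleinLift_self_neg (p : H3) :
    minkForm (kleinLift p) (kleinLift p) < 0 := by
  rw [minkForm_kleinLift, real_inner_self_eq_norm_sq]
  nlinarith [p.2, norm_nonneg p.1]

/-- The projective action on Klein points. -/
noncomputable def projectiveMap (L : Mink ≃ₗ[ℝ] Mink) (p : E3) : E3 :=
  (L (kleinLift p)).1⁻¹ • (L (kleinLift p)).2

theorem smul_kleinLift_projectiveMap {L : Mink ≃ₗ[ℝ] Mink} {p : E3}
    (h : (L (kleinLift p)).1 ≠ 0) :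
    (L (kleinLift p)).1 • kleinLift (projectiveMap L p) = L (kleinLift p) := by
  ext1
  · simp [kleinLift]
  · simp only [kleinLift, projectiveMap, Prod.smul_mk]
    exact smul_inv_smul₀ h _

theorem projectiveMap_eq {L : Mink ≃ₗ[ℝ] Mink} {p q : E3} {t : ℝ} (ht : t ≠ 0)
    (h : L (kleinLift p) = t • kleinLift q) : projectiveMap L p = q := by
  rw [projectiveMap, h]
  simp [kleinLift, smul_smul, ht]

/-- A timelike vector having negative product with a future null vector is in the future. -/
theorem pos_of_minkForm_neg {a : Mink} {ξ : E3} (ha : minkForm a a < 0) (hξ : ‖ξ‖ = 1)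
    (h : minkForm a (kleinLift ξ) < 0) : 0 < a.1 := by
  simp only [minkForm_apply, kleinLift, real_inner_self_eq_norm_sq, mul_one] at ha h
  have h1 := abs_real_inner_le_norm a.2 ξ
  rw [hξ, mul_one] at h1
  by_contra! hc
  have h2 := neg_le_of_abs_le h1
  nlinarith [norm_nonneg a.2]

namespace IsOrthochronous

variable {L : Mink ≃ₗ[ℝ] Mink}

theorem smul_kleinLift (hL : IsOrthochronous L) (p : H3) :
    (L (kleinLift p)).1 • kleinLift (projectiveMap L p) = L (kleinLift p) :=
  smul_kleinLift_projectiveMap (hL.pos p).ne'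

theorem minkForm_eq (hL : IsOrthochronous L) (p q : H3) :
    minkForm (kleinLift p) (kleinLift q) = (L (kleinLift p)).1 * (L (kleinLift q)).1 *
      minkForm (kleinLift (projectiveMap L p)) (kleinLift (projectiveMap L q)) := by
  rw [← hL.form]
  conv_lhs => rw [← hL.smul_kleinLift p, ← hL.smul_kleinLift q]
  simp only [map_smul, LinearMap.smul_apply, smul_eq_mul]
  ring

theorem norm_lt_one (hL : IsOrthochronous L) (p : H3) : ‖projectiveMap L p‖ < 1 := by
  have h1 := hL.minkForm_eq p p
  have h2 := minkForm_kleinLift_kleinLift_self_neg p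
  rw [h1] at h2
  have h3 := neg_of_mul_neg_right h2 (mul_pos (hL.pos p) (hL.pos p)).le
  rw [minkForm_kleinLift, real_inner_self_eq_norm_sq] at h3
  nlinarith [norm_nonneg (projectiveMap L p)]

theorem symm (hL : IsOrthochronous L) : IsOrthochronous L.symm where
  form a b := by rw [← hL.form, L.apply_symm_apply, L.apply_symm_apply]
  pos p := by
    -- The time coordinate is minus the product with the lift of the centre, and `L` carries this
    -- product to that of two future timelike vectors, which is negative.
    have h0 : (0 : ℝ) < (L (kleinLift 0)).1 := hL.pos ⟨0, by simp⟩
    have hq := hL.norm_lt_one ⟨0, by simp⟩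
    have e := hL.form (L.symm (kleinLift p)) (kleinLift 0)
    rw [L.apply_symm_apply, ← smul_kleinLift_projectiveMap h0.ne', map_smul,
      minkForm_kleinLift, smul_eq_mul] at e
    have h1 : inner ℝ (p : E3) (projectiveMap L 0) < 1 :=
      (real_inner_le_norm _ _).trans_lt
        (mul_lt_one_of_nonneg_of_lt_one_left (norm_nonneg _) p.2 hq.le)
    have h2 : minkForm (L.symm (kleinLift p)) (kleinLift 0) = -(L.symm (kleinLift p)).1 := by
      simp [minkForm_apply, kleinLift]
    rw [h2] at e
    linarith [mul_neg_of_pos_of_neg h0 (sub_neg.2 h1)]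

theorem projectiveMap_symm (hL : IsOrthochronous L) (p : H3) :
    projectiveMap L.symm (projectiveMap L p) = p := by
  apply projectiveMap_eq (inv_pos.2 (hL.pos p)).ne'
  rw [LinearEquiv.symm_apply_eq, map_smul]
  exact (inv_smul_eq_iff₀ (hL.pos p).ne').2 (hL.smul_kleinLift p).symm |>.symm

/-- The bijection of hyperbolic space induced by an orthochronous automorphism. -/
noncomputable def equiv (hL : IsOrthochronous L) : H3 ≃ H3 where
  toFun p := ⟨projectiveMap L p, hL.norm_lt_one p⟩
  invFun p := ⟨projectiveMap L.symm p, hL.symm.norm_lt_one p⟩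
  left_inv p := Subtype.ext (hL.projectiveMap_symm p)
  right_inv p := Subtype.ext (hL.symm.projectiveMap_symm p)

theorem isHypIsometry_equiv (hL : IsOrthochronous L) : IsHypIsometry hL.equiv := by
  intro p q
  have e1 : ∀ p q : E3, 1 - inner ℝ p q = -minkForm (kleinLift p) (kleinLift q) := by
    intro p q
    rw [minkForm_kleinLift]
    ring
  have e2 : ∀ p : E3, 1 - ‖p‖ ^ 2 = -minkForm (kleinLift p) (kleinLift p) := by
    intro p
    rw [minkForm_kleinLift, real_inner_self_eq_norm_sq]
    ring
  have hp := hL.pos p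
  have hq := hL.pos q
  have e3 : ∀ p : H3, √(-minkForm (kleinLift p) (kleinLift p)) = (L (kleinLift p)).1 *
      √(-minkForm (kleinLift (projectiveMap L p)) (kleinLift (projectiveMap L p))) := by
    intro p
    rw [hL.minkForm_eq p p, ← mul_neg, Real.sqrt_mul (mul_self_nonneg _),
      Real.sqrt_mul_self (hL.pos p).le]
  simp only [hypDist, e1, e2, e3 p, e3 q, hL.minkForm_eq p q]
  congr 1
  change -minkForm (kleinLift (projectiveMap L p)) (kleinLift (projectiveMap L q)) /
    (√(-minkForm (kleinLift (projectiveMap L p)) (kleinLift (projectiveMap L p))) *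
      √(-minkForm (kleinLift (projectiveMap L q)) (kleinLift (projectiveMap L q)))) = _
  rw [mul_mul_mul_comm, ← mul_neg, mul_div_mul_left _ _ (mul_pos hp hq).ne']

/-- Points whose lifts are sent into the cone over the target hull form a convex set: the positive
factors `s`, `t` only reweight a convex combination. -/
theorem projectiveMap_mem_idealHull {V : Type*} {x y : V → E3} {b : V → ℝ} (hb : ∀ v, 0 < b v)
    (h : ∀ v, L (kleinLift (x v)) = b v • kleinLift (y v)) {p : E3} (hp : p ∈ idealHull x) :
    projectiveMap L p ∈ idealHull y := by
  have key : p ∈ {p | ∃ q ∈ idealHull y, ∃ t : ℝ, 0 < t ∧ L (kleinLift p) = t • kleinLift q} := by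
    refine convexHull_min ?_ ?_ hp
    · rintro _ ⟨v, rfl⟩
      exact ⟨y v, subset_convexHull ℝ _ ⟨v, rfl⟩, b v, hb v, h v⟩
    · rintro p ⟨p', hp', s, hs, e⟩ q ⟨q', hq', t, ht, f⟩ α β hα hβ hαβ
      have hpos : 0 < α * s + β * t := by
        rcases hα.eq_or_lt with rfl | hα'
        · have : β = 1 := by linarith
          rw [this]
          linarith
        · have := mul_nonneg hβ ht.le
          have := mul_pos hα' hs
          linarith
      refine ⟨(α * s / (α * s + β * t)) • p' + (β * t / (α * s + β * t)) • q',
        convex_convexHull ℝ _ hp' hq' (by positivity) (by positivity) (by field_simp),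
        α * s + β * t, hpos, ?_⟩
      rw [kleinLift_combo p q hαβ, kleinLift_combo p' q' (by field_simp), map_add, map_smul,
        map_smul, e, f, smul_add, smul_smul, smul_smul, smul_smul, smul_smul,
        mul_div_cancel₀ _ hpos.ne', mul_div_cancel₀ _ hpos.ne']
  obtain ⟨q, hq, t, ht, e⟩ := key
  rwa [projectiveMap_eq ht.ne' e]

theorem image_idealPolyhedron (hL : IsOrthochronous L) {V : Type*} {x y : V → E3} {b : V → ℝ}
    (hb : ∀ v, 0 < b v) (h : ∀ v, L (kleinLift (x v)) = b v • kleinLift (y v)) :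
    hL.equiv '' idealPolyhedron x = idealPolyhedron y := by
  apply Set.Subset.antisymm
  · rintro _ ⟨p, hp, rfl⟩
    exact projectiveMap_mem_idealHull hb h hp
  · intro p hp
    refine ⟨hL.equiv.symm p, ?_, hL.equiv.apply_symm_apply p⟩
    refine projectiveMap_mem_idealHull (b := fun v => (b v)⁻¹) (fun v => inv_pos.2 (hb v))
      (fun v => ?_) hp
    rw [LinearEquiv.symm_apply_eq, map_smul, h, inv_smul_smul₀ (hb v).ne']

theorem sendsIdealPoint (hL : IsOrthochronous L) {ξ η : E3} {t : ℝ} (ht : 0 < t)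
    (h : L (kleinLift ξ) = t • kleinLift η) : SendsIdealPoint hL.equiv ξ η := by
  have hcont : Continuous fun p => L (kleinLift p) :=
    (LinearMap.continuous_of_finiteDimensional L.toLinearMap).comp continuous_kleinLift
  have hne : (L (kleinLift ξ)).1 ≠ 0 := by
    rw [h]
    simpa [kleinLift] using ht.ne'
  have hc : ContinuousAt (projectiveMap L) ξ :=
    (hcont.fst.continuousAt.inv₀ hne).smul hcont.snd.continuousAt
  have h1 : Filter.Tendsto (projectiveMap L) (nhds ξ) (nhds η) := by
    have := hc.tendsto
    rwa [projectiveMap_eq ht.ne' h] at this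
  exact h1.comp Filter.tendsto_comap

end IsOrthochronous

theorem theorem2 {V : Type*} [Finite V] (G : SimpleGraph V) (w : G.edgeSet → ℝ) (x y : V → E3)
    (hx : IsIdealRealization G w x) (hy : IsIdealRealization G w y) :
    ∃ φ : H3 ≃ H3, IsHypIsometry φ ∧ φ '' idealPolyhedron x = idealPolyhedron y ∧
      ∀ v, SendsIdealPoint φ (x v) (y v) := by
  obtain ⟨L, b, hb, h, hform⟩ := hx.exists_lorentz hy
  obtain ⟨v⟩ : Nonempty V := by
    by_contra hV
    rw [not_nonempty_iff] at hV
    have := hx.solid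
    simp [idealHull, Set.range_eq_empty] at this
  -- The map sends one future null vector to a positive multiple of another. The negative product of
  -- a Klein point with the former is preserved, so the image of the point is in the future.
  have hL : IsOrthochronous L := by
    refine ⟨hform, fun p => pos_of_minkForm_neg (ξ := y v) ?_ (hy.ideal v) ?_⟩
    · rw [hform]
      exact minkForm_kleinLift_kleinLift_self_neg p
    · have h1 : minkForm (kleinLift p) (kleinLift (x v)) < 0 := by
        rw [minkForm_kleinLift, sub_neg]
        calc inner ℝ (p : E3) (x v) ≤ ‖(p : E3)‖ * ‖x v‖ := real_inner_le_norm _ _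
          _ < 1 := by rw [hx.ideal, mul_one]; exact p.2
      rw [← hform, h, map_smul, smul_eq_mul] at h1
      exact neg_of_mul_neg_right h1 (hb v).le
  exact ⟨hL.equiv, hL.isHypIsometry_equiv, hL.image_idealPolyhedron hb h,
    fun v => hL.sendsIdealPoint (hb v) (h v)⟩
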